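/- \textbf{Model.} Consider a service system with customer classes $i=1,\dots,I$ and server pools $j=1,\dots,J$ ($I,J\ge1$), arrival rates $\lambda_i>0$, pool sizes $\beta_j>0$ and service rates $\mu_{ij}\ge 0$. Assume that the static planning problem (minimize $\rho$ subject to $\lambda_{ij}\ge0$, with $\lambda_{ij}=0$ if $\mu_{ij}=0$, $\sum_j\lambda_{ij}=\lambda_i$, and $\sum_i\lambda_{ij}/(\beta_j\mu_{ij})\le\rho$ for all $j$) has a unique optimal solution, that its value satisfies $\rho<1$, and that the set $\mathcal E$ of basic activities $(ij)$, those with $\lambda_{ij}>0$ in this solution, forms a tree on the vertex set of all classes and pools; only basic activities are used. Assume also that whenever $\psi_{ij}\ge 0$, $\sum_j\mu_{ij}\psi_{ij}=\lambda_i$ for all $i$ and $\sum_i\psi_{ij}\le\beta_j$ for all $j$ (sums over $\mathcal E$), then $\psi_{ij}>0$ for all $(ij)\in\mathcal E$. \textbf{Leaf activity priority.} Classes are numbered (class $1$ has the highest priority) in the order in which they are removed in some successive removal of leaves of the tree. The activities are then listed, from the highest to the lowest priority, by repeatedly taking the highest-priority class that still has remaining edges; if it is a leaf of the remaining tree, its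 only remaining edge is listed next, and otherwise some edge from it to a pool that is a leaf of the remaining tree; the listed edge is removed. Pools are numbered so that the lowest-priority activity is $(IJ)$. An arriving customer of class $i$ takes an idle server in the pool $j$ with $(ij)$ of the highest priority among those pools with idle servers, and queues if there is none. A server of pool $j$ that completes a service takes a customer of the highest-priority non-empty queue among classes $i$ with $(ij)\in\mathcal E$, and becomes idle if there is none. The equilibrium is $\psi^*_{ij}=\lambda_{ij}/\mu_{ij}$, $q^*_i=0$, where now, recursively in the order of priority, $$\lambda_{ij}=\min\Bigl(\lambda_i-\sum_{j':(ij')<(ij)}\lambda_{ij'},\ \mu_{ij}\bigl(\beta_j-\sum_{i'<i}\lambda_{i'j}/\mu_{i'j}\bigr)\Bigr).$$ \textbf{Scaling.} In the system with parameter $r>0$, pool $j$ has $\lfloor r\beta_j\rfloor$ servers; $\Psi^r_{ij}(t)$ is the number of class $i$ customers in service in pool $j$, $Q^r_i(t)$ the number of waiting class $i$ customers, and $A^r_i(t)$, $D^r_{ij}(t)$ count the arrivals and the service completions in $[0,t]$. In the initial state no pool is overfilled and no customer waits while a server able to serve it is idle. Fix $0<\epsilon<1/2$, a sequence $r\to\infty$,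 and scales $h(r)$ with $r^{1/2+\epsilon}\le h(r)=o(r)$. Put $\tilde f^r(t)=h(r)^{-1}\bigl(\Psi^r_{ij}(t)-r\psi^*_{ij},\,Q^r_i(t)\bigr)$, and let $|\cdot|$ be the Euclidean norm. A \emph{local fluid model} is a Lipschitz function $\tilde f=(\tilde\psi_{ij},\tilde q_i)$ on $[0,\infty)$ with $\tilde q_i(t)=0$ and $\sum_j\tilde\psi_{ij}(t)=\sum_j\tilde\psi_{ij}(0)-\sum_j\int_0^t\mu_{ij}\tilde\psi_{ij}(s)\,ds$ for all $i$, and $\sum_i\tilde\psi_{ij}(t)=0$ for all $j<J$. Let $L$ be the linear map $L(u_{ij},w_i)=(c_{ij},0)$, where $(c_{ij})$ is the unique solution of $\sum_jc_{ij}=w_i+\sum_ju_{ij}$ for all $i$, $\sum_ic_{ij}=0$ for all $j<J$. \textbf{Theorem.} The map $L$ is well defined and linear. Consider a sequence of deterministic realizations (with events occurring one at a time) such that, uniformly on compact subsets of $[0,\infty)$, $$h(r)^{-1}\bigl(A^r_i(t)-\lambda_irt\bigr)\to0\ \ \forall i,\qquad h(r)^{-1}\Bigl(D^r_{ij}(t)-\mu_{ij}\int_0^t\Psi^r_{ij}(s)\,ds\Bigr)\to0\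 \ \forall (ij)\in\mathcal E,$$ and such that $\tilde f^r(0)\to\tilde f^\circ(0)$ for some fixed vector $\tilde f^\circ(0)$. Then every subsequence of $r$ has a further subsequence along which $\tilde f^r\to\tilde f$ uniformly on compact subsets of $[0,\infty)$ not containing $0$, where $\tilde f$ is a local fluid model with $\tilde f(0)=L\tilde f^\circ(0)$. There are constants $c_1,c_2>0$ such that every local fluid model satisfies $|\tilde f(t)|\le|\tilde f(0)|\,c_1e^{-c_2t}$ for all $t\ge0$. In addition, for every $K>0$ there is $C=C(K)>0$ such that, for every such sequence of realizations, $|\tilde f^\circ(0)|\le K$ implies $$\limsup_{r\to\infty}\ \sup_{0\le t\le1}|\tilde f^r(t)|\le CK.$$ The constants $c_1,c_2,C$ depend only on the network and its priorities (and $C$ on $K$). -/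

import Mathlib

open Filter Topology

/-- Raw data of the model: `m + 1` customer classes, `n + 1` server pools, arrival rates `lam`,
pool sizes `beta`, service rates `mu` (all before multiplication by the scaling parameter),
and the list `order` of the basic activities, from the highest to the lowest priority.
Classes are numbered in order of priority (`0` is the highest). -/
structure Network (m n : ℕ) where
  lam : Fin (m + 1) → ℝ
  beta : Fin (n + 1) → ℝ
  mu : Fin (m + 1) → Fin (n + 1) → ℝ
  order : List (Fin (m + 1) × Fin (n + 1))

namespace Network

variable {m n : ℕ}

/-- The basic activities (edges of the activity tree). -/
abbrev Edge (N : Network m n) : Type := {e : Fin (m + 1) × Fin (n + 1) // e ∈ N.order}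

/-- Customer class of an activity. -/
abbrev Edge.cls {N : Network m n} (e : N.Edge) : Fin (m + 1) := e.1.1

/-- Server pool of an activity. -/
abbrev Edge.pool {N : Network m n} (e : N.Edge) : Fin (n + 1) := e.1.2

/-- Position of an activity in the priority list: a smaller value is a higher priority. -/
def rank (N : Network m n) (e : N.Edge) : ℕ := N.order.idxOf e.1

/-- Service rate of an activity. -/
def rate (N : Network m n) (e : N.Edge) : ℝ := N.mu e.cls e.pool

/-- Sum over the activities of a given class. -/
def classSum (N : Network m n) {M : Type*} [AddCommMonoid M] (x : N.Edge → M)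
    (i : Fin (m + 1)) : M :=
  ∑ e : N.Edge with e.cls = i, x e

/-- Sum over the activities of a given pool. -/
def poolSum (N : Network m n) {M : Type*} [AddCommMonoid M] (x : N.Edge → M)
    (j : Fin (n + 1)) : M :=
  ∑ e : N.Edge with e.pool = j, x e

/-! ### Static planning problem -/

/-- Feasibility of `(x, rho)` for the static planning problem; activities with zero service
rate cannot be used. -/
structure SPPFeasible (N : Network m n) (x : Fin (m + 1) → Fin (n + 1) → ℝ) (rho : ℝ) :
    Prop where
  nonneg : ∀ i j, 0 ≤ x i j
  zero_of_mu : ∀ i j, N.mu i j = 0 → x i j = 0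
  demand : ∀ i, ∑ j, x i j = N.lam i
  load : ∀ j, ∑ i, x i j / (N.beta j * N.mu i j) ≤ rho

/-- Optimality for the static planning problem. -/
def SPPOptimal (N : Network m n) (x : Fin (m + 1) → Fin (n + 1) → ℝ) (rho : ℝ) : Prop :=
  N.SPPFeasible x rho ∧ ∀ x' rho', N.SPPFeasible x' rho' → rho ≤ rho'

/-! ### Activity tree and priorities -/

/-- The undirected bipartite graph of basic activities on classes and pools. -/
def graph (N : Network m n) : SimpleGraph (Fin (m + 1) ⊕ Fin (n + 1)) where
  Adj v w := ∃ i j, (i, j) ∈ N.order ∧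
    ((v = Sum.inl i ∧ w = Sum.inr j) ∨ (v = Sum.inr j ∧ w = Sum.inl i))
  symm := ⟨fun _ _ ⟨i, j, hij, h⟩ => ⟨i, j, hij, by tauto⟩⟩
  loopless := ⟨by
    rintro v ⟨i, j, -, ⟨h, h'⟩ | ⟨h, h'⟩⟩ <;> rw [h] at h' <;> cases h'⟩

/-- The vertices of `G` are removed in the order of the list, each being a leaf (a vertex with at
most one neighbour) of what remains at the time of its removal. -/
def LeafElimination {V : Type*} (G : SimpleGraph V) : List V → Prop
  | [] => True
  | v :: l => (∀ w ∈ l, ∀ w' ∈ l, G.Adj v w → G.Adj v w' → w = w') ∧ LeafElimination G l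

/-- The edge priority procedure: the next edge belongs to the highest-priority class that still
has edges; either that class is a leaf of the remaining tree (no other edge of it remains), or
the pool of the edge is a leaf of the remaining tree. -/
def EdgeElimination : List (Fin (m + 1) × Fin (n + 1)) → Prop
  | [] => True
  | e :: l => (∀ e' ∈ l, e.1 ≤ e'.1) ∧
      ((∀ e' ∈ l, e'.1 ≠ e.1) ∨ (∀ e' ∈ l, e'.2 ≠ e.2)) ∧ EdgeElimination l

/-- The standing assumptions of the model. -/
structure Standing (N : Network m n) : Prop where
  lam_pos : ∀ i, 0 < N.lam i
  beta_pos : ∀ j, 0 < N.beta j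
  mu_nonneg : ∀ i j, 0 ≤ N.mu i j
  /-- Complete resource pooling (first part) and underload: the static planning problem has a
  unique optimal solution, the basic activities are those it uses, and its value is `< 1`. -/
  crp : ∃ x rho, N.SPPOptimal x rho ∧
    (∀ x' rho', N.SPPOptimal x' rho' → x' = x ∧ rho' = rho) ∧
    (∀ i j, (i, j) ∈ N.order ↔ 0 < x i j) ∧ rho < 1
  /-- Complete resource pooling (second part): the basic activities form a tree. -/
  tree : N.graph.IsTree
  /-- Every set of activity occupancies that carries the whole load uses all activities. -/
  all_used : ∀ psi : N.Edge → ℝ, (∀ e, 0 ≤ psi e) →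
    (∀ i, N.lam i = N.classSum (fun e => N.rate e * psi e) i) →
    (∀ j, N.poolSum psi j ≤ N.beta j) → ∀ e, 0 < psi e
  /-- Classes are numbered in the order in which some elimination of tree leaves removes them. -/
  class_order : ∃ l : List (Fin (m + 1) ⊕ Fin (n + 1)), l.Nodup ∧ (∀ v, v ∈ l) ∧
    LeafElimination N.graph l ∧
    l.Pairwise (fun v w => ∀ i i', v = Sum.inl i → w = Sum.inl i' → i < i')
  /-- The activities are listed in an order produced by the edge priority procedure. -/
  order_nodup : N.order.Nodup
  edge_order : EdgeElimination N.order
  /-- The lowest-priority activity is (last class, last pool). -/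
  order_last : N.order.getLast? = some (Fin.last m, Fin.last n)

/-! ### Equilibrium point -/

/-- Equilibrium routing rates: each activity, in the order of priority, gets the minimum of what
is left of the arrival rate of its class and what the free part of its pool can process. -/
noncomputable def eqRate (N : Network m n) (e : N.Edge) : ℝ :=
  min
    (N.lam e.cls - ∑ e' : {e' : N.Edge // e'.cls = e.cls ∧ N.rank e' < N.rank e}, N.eqRate e'.1)
    (N.rate e * (N.beta e.pool -
      ∑ e' : {e' : N.Edge // e'.pool = e.pool ∧ N.rank e' < N.rank e},
        N.eqRate e'.1 / N.rate e'.1))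
termination_by N.rank e
decreasing_by
  · exact e'.2.2
  · exact e'.2.2

/-- Equilibrium occupancies; the equilibrium queues are zero. -/
noncomputable def psiStar (N : Network m n) (e : N.Edge) : ℝ := N.eqRate e / N.rate e

/-! ### Sample paths under the leaf activity priority policy -/

/-- State of the system together with the counters of events: `Psi e` customers in service in
activity `e`, `Q i` waiting customers, `A i` arrivals so far, `D e` service completions so far. -/
structure State (N : Network m n) where
  Psi : N.Edge → ℕ
  Q : Fin (m + 1) → ℕ
  A : Fin (m + 1) → ℕ
  D : N.Edge → ℕ

/-- One event under the policy, when pool `j` has `cap j` servers. -/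
inductive Step (N : Network m n) (cap : Fin (n + 1) → ℕ) : N.State → N.State → Prop
  /-- A customer arrives and takes an idle server of the pool for which the activity has the
  highest priority among the pools with idle servers. -/
  | arrivalServed (s : N.State) (e : N.Edge)
      (idle : N.poolSum s.Psi e.pool < cap e.pool)
      (best : ∀ e' : N.Edge, e'.cls = e.cls → N.poolSum s.Psi e'.pool < cap e'.pool →
        N.rank e ≤ N.rank e') :
      Step N cap s
        { Psi := s.Psi + Pi.single e 1, Q := s.Q, A := s.A + Pi.single e.cls 1, D := s.D }
  /-- A customer arrives and queues, as no pool that can serve it has idle servers. -/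
  | arrivalQueued (s : N.State) (i : Fin (m + 1))
      (full : ∀ e : N.Edge, e.cls = i → ¬ N.poolSum s.Psi e.pool < cap e.pool) :
      Step N cap s
        { Psi := s.Psi, Q := s.Q + Pi.single i 1, A := s.A + Pi.single i 1, D := s.D }
  /-- A service in activity `e` ends and the server picks the waiting customer of the
  highest-priority class among those that it can serve. -/
  | departureNext (s : N.State) (e e' : N.Edge) (busy : 0 < s.Psi e)
      (same : e'.pool = e.pool) (waiting : 0 < s.Q e'.cls)
      (best : ∀ e'' : N.Edge, e''.pool = e.pool → 0 < s.Q e''.cls → e'.cls ≤ e''.cls) :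
      Step N cap s
        { Psi := s.Psi - Pi.single e 1 + Pi.single e' 1, Q := s.Q - Pi.single e'.cls 1,
          A := s.A, D := s.D + Pi.single e 1 }
  /-- A service in activity `e` ends and the server becomes idle, as no customer that it can
  serve is waiting. -/
  | departureIdle (s : N.State) (e : N.Edge) (busy : 0 < s.Psi e)
      (empty : ∀ e' : N.Edge, e'.pool = e.pool → s.Q e'.cls = 0) :
      Step N cap s
        { Psi := s.Psi - Pi.single e 1, Q := s.Q, A := s.A, D := s.D + Pi.single e 1 }

/-- Number of servers in each pool of the system with parameter `r`. -/
noncomputable def capacity (N : Network m n) (r : ℝ) (j : Fin (n + 1)) : ℕ := ⌊r * N.beta j⌋₊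

/-- A realization (on `t ≥ 0`) of the system with parameter `r`: a right-continuous piecewise
constant path that starts in a legitimate state (pools not overfilled, no customer waiting while
a server that can serve it is idle) and changes only by single events of the policy. -/
structure IsRealization (N : Network m n) (r : ℝ) (X : ℝ → N.State) : Prop where
  init_A : (X 0).A = 0
  init_D : (X 0).D = 0
  init_cap : ∀ j, N.poolSum (X 0).Psi j ≤ N.capacity r j
  init_work : ∀ e : N.Edge, 0 < (X 0).Q e.cls → N.poolSum (X 0).Psi e.pool = N.capacity r e.pool
  right_const : ∀ t, 0 ≤ t → ∀ᶠ s in 𝓝[>] t, X s = X t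
  left_step : ∀ t, 0 < t → ∃ x : N.State, (∀ᶠ s in 𝓝[<] t, X s = x) ∧
    (X t = x ∨ N.Step (N.capacity r) x (X t))

/-! ### Local fluid scaling and local fluid models -/

/-- Vectors `(u_e, w_i)` indexed by activities and classes, with the Euclidean norm. -/
abbrev Vec (N : Network m n) : Type := EuclideanSpace ℝ (N.Edge ⊕ Fin (m + 1))

/-- The activity part of a vector. -/
def Vec.act {N : Network m n} (v : N.Vec) : N.Edge → ℝ := fun e => v (Sum.inl e)

/-- The queue part of a vector. -/
def Vec.queue {N : Network m n} (v : N.Vec) : Fin (m + 1) → ℝ := fun i => v (Sum.inr i)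

/-- The deviation from equilibrium in the system with parameter `r`, scaled down by `h`. -/
noncomputable def scaled (N : Network m n) (r h : ℝ) (s : N.State) : N.Vec :=
  WithLp.toLp 2 (Sum.elim (fun e => h⁻¹ * ((s.Psi e : ℝ) - r * N.psiStar e))
    (fun i => h⁻¹ * (s.Q i : ℝ)))

/-- `c` is the image of `v` under the relaxation map: queues vanish, class totals are those of
`v`, and the totals of all pools except the last one vanish. -/
structure IsRelaxation (N : Network m n) (v c : N.Vec) : Prop where
  queue : ∀ i, c.queue i = 0
  total : ∀ i, N.classSum v.act i + v.queue i = N.classSum c.act i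
  pools : ∀ j, j ≠ Fin.last n → N.poolSum c.act j = 0

/-- Local fluid models: Lipschitz trajectories on `[0, ∞)` with the three defining properties. -/
structure IsLocalFluidModel (N : Network m n) (f : ℝ → N.Vec) : Prop where
  lipschitz : ∃ c, LipschitzOnWith c f (Set.Ici 0)
  queue : ∀ t, 0 ≤ t → ∀ i, (f t).queue i = 0
  total : ∀ t, 0 ≤ t → ∀ i, N.classSum (f t).act i = N.classSum (f 0).act i -
    N.classSum (fun e => ∫ s in (0 : ℝ)..t, N.rate e * (f s).act e) i
  pools : ∀ t, 0 ≤ t → ∀ j, j ≠ Fin.last n → N.poolSum (f t).act j = 0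

/-- A sequence of realizations `X k` of the systems with parameters `r k → ∞`, with space scale
`h k` between `r ^ (1 / 2 + ε)` and `o(r)`, whose arrivals and departures satisfy the
law-of-large-numbers conditions on the scale `h`, and whose scaled initial states converge
to `f0`. -/
structure IsLocalFluidSequence (N : Network m n) (ε : ℝ) (r h : ℕ → ℝ) (X : ℕ → ℝ → N.State)
    (f0 : N.Vec) : Prop where
  eps_pos : 0 < ε
  eps_lt : ε < 1 / 2
  r_pos : ∀ k, 0 < r k
  r_tendsto : Tendsto r atTop atTop
  h_ge : ∀ k, (r k) ^ (1 / 2 + ε) ≤ h k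
  h_small : Tendsto (fun k => h k / r k) atTop (𝓝 0)
  realization : ∀ k, N.IsRealization (r k) (X k)
  arrivals : ∀ i, ∀ T : ℝ, TendstoUniformlyOn
    (fun k t => (h k)⁻¹ * (((X k t).A i : ℝ) - N.lam i * r k * t)) (fun _ => 0) atTop
    (Set.Icc 0 T)
  departures : ∀ e : N.Edge, ∀ T : ℝ, TendstoUniformlyOn
    (fun k t => (h k)⁻¹ * (((X k t).D e : ℝ) -
      N.rate e * ∫ s in (0 : ℝ)..t, ((X k s).Psi e : ℝ))) (fun _ => 0) atTop
    (Set.Icc 0 T)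
  initial : Tendsto (fun k => N.scaled (r k) (h k) (X k 0)) atTop (𝓝 f0)

end Network

/-! ### Rooting the activity tree along the priority order -/

namespace Network

variable {m n : ℕ}

/-! Each activity, when it is listed, has an endpoint with no later activity. Taking the class
endpoint whenever possible matches the activities bijectively with all vertices except the last
pool, and so roots the tree at that pool. The `children` of an activity are the other activities at
its leaf vertex. They all have higher priority, and along the children relation class-type and
pool-type activities alternate. Most of the proof is induction along this relation. It shows that
vertex totals determine an activity vector (hence the map `relax`), and that the local fluid
dynamics is triangular: each class total solves a scalar linear equation forced by children that
already decay. This gives `exists_decay`. Existence of local fluid models comes from a matrix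
exponential.

An exchange argument shows that the equilibrium uses every activity, fills every pool but the last,
and leaves slack in the last one. Attach to each vertex a deficit: the queue of a class, or the idle
servers of a pool. While some child of `e` has a deficit, the policy starts no service in `e`, so on
the scale `h` the occupancy of `e` drains at a rate of order `r / h`, which tends to infinity. A
balance at the leaf vertex turns this drain into a decrease of the children's total deficit.
Propagated from high to low priority (`exists_gap_bound`), this makes all deficits small after a
time of order `h / r`. Queues on the last pool are excluded by its slack.

Once queues and pool totals are negligible, only the class totals evolve, and they obey the fluid
equation up to the assumed small fluctuations. The initial transient contributes an integral of
order `h / r`, so Grönwall's inequality compares the path with any local fluid model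
(`exists_comparison`). The a priori bound needed there is obtained by continuation in time,
comparing with the zero model (`exists_tracking`). Class totals including queues do not jump in the
limit, while the deficits vanish at once. This is why the limit starts from the relaxed initial
state, and why convergence is only away from time zero. -/

theorem edgeElimination_le : ∀ {l : List (Fin (m + 1) × Fin (n + 1))}, EdgeElimination l →
    ∀ a ∈ l, ∀ b ∈ l, l.idxOf a < l.idxOf b → a.1 ≤ b.1
  | [], _, a, ha, _, _, _ => by simp at ha
  | c :: l, h, a, ha, b, hb, hab => by
    obtain ⟨h1, -, h3⟩ := h
    have hbc : c ≠ b := by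
      rintro rfl
      simp at hab
    have hbl : b ∈ l := by
      rcases List.mem_cons.1 hb with h | h
      · exact absurd h.symm hbc
      · exact h
    by_cases hac : c = a
    · subst hac; exact h1 b hbl
    · rw [List.idxOf_cons_ne _ hac, List.idxOf_cons_ne _ hbc] at hab
      have hal : a ∈ l := by
        rcases List.mem_cons.1 ha with h | h
        · exact absurd h.symm hac
        · exact h
      exact edgeElimination_le h3 a hal b hbl (by omega)

theorem edgeElimination_leaf : ∀ {l : List (Fin (m + 1) × Fin (n + 1))}, EdgeElimination l →
    ∀ a ∈ l, (∀ b ∈ l, l.idxOf a < l.idxOf b → b.1 ≠ a.1) ∨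
      (∀ b ∈ l, l.idxOf a < l.idxOf b → b.2 ≠ a.2)
  | [], _, a, ha => by simp at ha
  | c :: l, h, a, ha => by
    obtain ⟨-, h2, h3⟩ := h
    have key : ∀ b ∈ c :: l, (c :: l).idxOf a < (c :: l).idxOf b → b ∈ l := by
      intro b hb hab
      rcases List.mem_cons.1 hb with h | h
      · subst h; simp at hab
      · exact h
    by_cases hac : c = a
    · subst hac
      rcases h2 with h2 | h2
      · exact Or.inl fun b hb hab => h2 b (key b hb hab)
      · exact Or.inr fun b hb hab => h2 b (key b hb hab)
    · have hal : a ∈ l := by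
        rcases List.mem_cons.1 ha with h | h
        · exact absurd h.symm hac
        · exact h
      have key' : ∀ b ∈ c :: l, (c :: l).idxOf a < (c :: l).idxOf b → l.idxOf a < l.idxOf b := by
        intro b hb hab
        have hbc : c ≠ b := by
          rintro rfl
          simp at hab
        rw [List.idxOf_cons_ne _ hac, List.idxOf_cons_ne _ hbc] at hab
        omega
      rcases edgeElimination_leaf h3 a hal with h | h
      · exact Or.inl fun b hb hab => h b (key b hb hab) (key' b hb hab)
      · exact Or.inr fun b hb hab => h b (key b hb hab) (key' b hb hab)

variable {N : Network m n}

theorem rank_injective : Function.Injective N.rank := by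
  intro e e' h
  apply Subtype.ext
  have := (List.idxOf_inj e.2).1 h
  exact this

/-- The activity has the lowest priority in its class. -/
def ClsLast (N : Network m n) (e : N.Edge) : Prop :=
  ∀ e' : N.Edge, e'.cls = e.cls → N.rank e' ≤ N.rank e

/-- The activity has the lowest priority in its pool. -/
def PoolLast (N : Network m n) (e : N.Edge) : Prop :=
  ∀ e' : N.Edge, e'.pool = e.pool → N.rank e' ≤ N.rank e

theorem ClsLast.unique {e e' : N.Edge} (h : N.ClsLast e) (h' : N.ClsLast e')
    (he : e.cls = e'.cls) : e = e' :=
  rank_injective (le_antisymm (h' e he) (h e' he.symm))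

theorem PoolLast.unique {e e' : N.Edge} (h : N.PoolLast e) (h' : N.PoolLast e')
    (he : e.pool = e'.pool) : e = e' :=
  rank_injective (le_antisymm (h' e he) (h e' he.symm))

theorem Edge.ext' {e e' : N.Edge} (h : e.cls = e'.cls) (h' : e.pool = e'.pool) : e = e' :=
  Subtype.ext (Prod.ext h h')

open Classical in
/-- The other activities of the vertex which is a leaf at the removal of `e`. -/
noncomputable def children (N : Network m n) (e : N.Edge) : Finset N.Edge :=
  if N.ClsLast e then Finset.univ.filter fun e' : N.Edge => e'.cls = e.cls ∧ e' ≠ e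
  else Finset.univ.filter fun e' : N.Edge => e'.pool = e.pool ∧ e' ≠ e

theorem mem_children_cls {e e' : N.Edge} (h : N.ClsLast e) :
    e' ∈ N.children e ↔ e'.cls = e.cls ∧ e' ≠ e := by
  simp [children, h]

theorem mem_children_pool {e e' : N.Edge} (h : ¬ N.ClsLast e) :
    e' ∈ N.children e ↔ e'.pool = e.pool ∧ e' ≠ e := by
  simp [children, h]

theorem sum_children_cls {M : Type*} [AddCommMonoid M] {e : N.Edge} (h : N.ClsLast e)
    (x : N.Edge → M) : N.classSum x e.cls = x e + ∑ e' ∈ N.children e, x e' := by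
  classical
  rw [classSum, ← Finset.add_sum_erase _ x (a := e) (by simp)]
  congr 1
  apply Finset.sum_congr _ fun _ _ => rfl
  ext e'
  simp only [mem_children_cls h, Finset.mem_erase, Finset.mem_filter, Finset.mem_univ, true_and]
  tauto

theorem sum_children_pool {M : Type*} [AddCommMonoid M] {e : N.Edge} (h : ¬ N.ClsLast e)
    (x : N.Edge → M) : N.poolSum x e.pool = x e + ∑ e' ∈ N.children e, x e' := by
  classical
  rw [poolSum, ← Finset.add_sum_erase _ x (a := e) (by simp)]
  congr 1
  apply Finset.sum_congr _ fun _ _ => rfl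
  ext e'
  simp only [mem_children_pool h, Finset.mem_erase, Finset.mem_filter, Finset.mem_univ, true_and]
  tauto

theorem Standing.mu_pos (hN : N.Standing) (i : Fin (m + 1)) (j : Fin (n + 1)) (h : (i, j) ∈ N.order) :
    0 < N.mu i j := by
  obtain ⟨x, ρ, ⟨hx, -⟩, -, hE, -⟩ := hN.crp
  refine lt_of_le_of_ne (hN.mu_nonneg i j) fun h0 => ?_
  have := (hE i j).1 h
  rw [hx.zero_of_mu i j h0.symm] at this
  exact lt_irrefl _ this

theorem Standing.rate_pos (hN : N.Standing) (e : N.Edge) : 0 < N.rate e :=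
  hN.mu_pos _ _ e.2

theorem Standing.cls_le (hN : N.Standing) {e e' : N.Edge} (h : N.rank e < N.rank e') :
    e.cls ≤ e'.cls :=
  edgeElimination_le hN.edge_order e.1 e.2 e'.1 e'.2 h

theorem Standing.clsLast_or_poolLast (hN : N.Standing) (e : N.Edge) :
    N.ClsLast e ∨ N.PoolLast e := by
  rcases edgeElimination_leaf hN.edge_order e.1 e.2 with h | h
  · exact Or.inl fun e' he' => not_lt.1 fun hlt => h e'.1 e'.2 hlt he'
  · exact Or.inr fun e' he' => not_lt.1 fun hlt => h e'.1 e'.2 hlt he'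

theorem Standing.exists_root (hN : N.Standing) :
    ∃ e : N.Edge, e.cls = Fin.last m ∧ e.pool = Fin.last n ∧ ∀ e', N.rank e' ≤ N.rank e := by
  have h := hN.order_last
  have hmem : (Fin.last m, Fin.last n) ∈ N.order := List.mem_of_getLast? h
  refine ⟨⟨_, hmem⟩, rfl, rfl, fun e' => ?_⟩
  have hlt : N.rank e' < N.order.length := List.idxOf_lt_length_iff.2 e'.2
  have hne : N.order ≠ [] := List.ne_nil_of_mem hmem
  have : N.order.idxOf (Fin.last m, Fin.last n) = N.order.length - 1 := by
    rw [List.getLast?_eq_getElem?] at h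
    obtain ⟨hl, hg⟩ := List.getElem?_eq_some_iff.1 h
    rw [← hg]
    exact hN.order_nodup.idxOf_getElem _ hl
  simp only [rank, this] at hlt ⊢
  omega

/-- The globally last activity is last both in its class and in its pool, so the last pool is never
the leaf vertex assigned to an activity. It is the root, and the only pool whose total is left free.
-/
theorem Standing.clsLast_of_pool_eq_last (hN : N.Standing) {e : N.Edge}
    (h : e.pool = Fin.last n) : N.ClsLast e := by
  rcases hN.clsLast_or_poolLast e with h1 | h1
  · exact h1
  · obtain ⟨e0, -, h02, h03⟩ := hN.exists_root
    have : e = e0 := h1.unique (fun e' _ => h03 e') (h.trans h02.symm)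
    subst this
    exact fun e' _ => h03 e'

theorem Standing.pool_ne_last (hN : N.Standing) {e : N.Edge} (h : ¬ N.ClsLast e) :
    e.pool ≠ Fin.last n := fun h' => h (hN.clsLast_of_pool_eq_last h')

theorem Standing.poolLast (hN : N.Standing) {e : N.Edge} (h : ¬ N.ClsLast e) : N.PoolLast e :=
  (hN.clsLast_or_poolLast e).resolve_left h

theorem Standing.exists_clsLast (hN : N.Standing) (i : Fin (m + 1)) :
    ∃ e : N.Edge, e.cls = i ∧ N.ClsLast e := by
  obtain ⟨x, ρ, ⟨hx, -⟩, -, hE, -⟩ := hN.crp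
  have hpos : 0 < ∑ j, x i j := by rw [hx.demand i]; exact hN.lam_pos i
  obtain ⟨j, -, hj⟩ := Finset.exists_lt_of_sum_lt (s := Finset.univ) (f := fun _ => (0 : ℝ))
    (g := fun j => x i j) (by simpa using hpos)
  have hne : (Finset.univ.filter fun e : N.Edge => e.cls = i).Nonempty :=
    ⟨⟨(i, j), (hE i j).2 hj⟩, by simp⟩
  obtain ⟨e, he, hmax⟩ := Finset.exists_max_image _ N.rank hne
  simp only [Finset.mem_filter, Finset.mem_univ, true_and] at he hmax
  exact ⟨e, he, fun e' he' => hmax e' (he'.trans he)⟩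

/-- A tree has one edge fewer than vertices, and the activities map onto its edges. Only this
inequality is needed for the counting arguments. -/
theorem Standing.card_vertices_le (hN : N.Standing) :
    (m + 1) + (n + 1) ≤ Fintype.card N.Edge + 1 := by
  classical
  have h := hN.tree.card_edgeFinset
  rw [Fintype.card_sum, Fintype.card_fin, Fintype.card_fin] at h
  rw [← h, add_le_add_iff_right]
  have hsub : N.graph.edgeFinset ⊆
      (Finset.univ : Finset N.Edge).image fun e => s(Sum.inl e.cls, Sum.inr e.pool) := by
    intro z
    induction z using Sym2.ind with
    | _ v w =>
      rw [SimpleGraph.mem_edgeFinset, SimpleGraph.mem_edgeSet]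
      rintro ⟨i, j, hij, ⟨rfl, rfl⟩ | ⟨rfl, rfl⟩⟩
      · exact Finset.mem_image.2 ⟨⟨(i, j), hij⟩, Finset.mem_univ _, rfl⟩
      · exact Finset.mem_image.2 ⟨⟨(i, j), hij⟩, Finset.mem_univ _, Sym2.eq_swap⟩
  exact (Finset.card_le_card hsub).trans Finset.card_image_le

-- Pigeonhole: class-last activities inject into the classes, and the others inject into the pools
-- different from the last. If `j` were missed as well, there would be too few activities for a
-- tree.
open Classical in
theorem Standing.exists_poolLast (hN : N.Standing) (j : Fin (n + 1)) (hj : j ≠ Fin.last n) :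
    ∃ e : N.Edge, e.pool = j ∧ ¬ N.ClsLast e := by
  have h1 : (Finset.univ.filter fun e : N.Edge => N.ClsLast e).card ≤ m + 1 := by
    refine (Finset.card_le_card_of_injOn (t := Finset.univ) (fun e => e.cls)
      (fun _ _ => Finset.mem_univ _) ?_).trans_eq (by simp)
    intro e he e' he' h
    simp only [Finset.coe_filter, Finset.mem_univ, true_and, Set.mem_ofPred_eq] at he he'
    exact he.unique he' h
  have h2 : (Finset.univ.filter fun e : N.Edge => N.ClsLast e).card +
      (Finset.univ.filter fun e : N.Edge => ¬ N.ClsLast e).card = Fintype.card N.Edge := by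
    rw [← Finset.card_univ]
    convert Finset.card_filter_add_card_filter_not (s := (Finset.univ : Finset N.Edge)) N.ClsLast
  have h3 := hN.card_vertices_le
  by_contra! hcon
  have h4 : (Finset.univ.filter fun e : N.Edge => ¬ N.ClsLast e).card ≤
      ((Finset.univ.erase (Fin.last n)).erase j).card := by
    refine Finset.card_le_card_of_injOn (fun e => e.pool) ?_ ?_
    · intro e he
      simp only [Finset.coe_filter, Finset.mem_univ, true_and, Set.mem_ofPred_eq] at he
      simp only [Finset.coe_erase, Finset.coe_univ, Set.mem_sdiff, Set.mem_univ, true_and,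
        Set.mem_singleton_iff]
      exact ⟨hN.pool_ne_last he, fun h => he (hcon e h)⟩
    · intro e he e' he' h
      simp only [Finset.coe_filter, Finset.mem_univ, true_and, Set.mem_ofPred_eq] at he he'
      exact (hN.poolLast he).unique (hN.poolLast he') h
  rw [Finset.card_erase_of_mem (by simp [hj]), Finset.card_erase_of_mem (by simp),
    Finset.card_univ, Fintype.card_fin] at h4
  -- There is a second pool because `j` is not the last one. With `n = 0` the truncated count `n + 1
  -- - 1 - 1` would give no contradiction.
  have h5 : n ≠ 0 := by
    rintro rfl
    exact hj (Fin.ext (by have := j.2; simp only [Fin.val_last]; omega))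
  omega

theorem Standing.rank_lt_of_mem_children (hN : N.Standing) {e e' : N.Edge}
    (h : e' ∈ N.children e) : N.rank e' < N.rank e := by
  by_cases hc : N.ClsLast e
  · rw [mem_children_cls hc] at h
    exact lt_of_le_of_ne (hc e' h.1) fun h' => h.2 (rank_injective h')
  · rw [mem_children_pool hc] at h
    exact lt_of_le_of_ne (hN.poolLast hc e' h.1) fun h' => h.2 (rank_injective h')

theorem not_clsLast_of_mem_children {e e' : N.Edge} (hc : N.ClsLast e)
    (h : e' ∈ N.children e) : ¬ N.ClsLast e' := by
  rw [mem_children_cls hc] at h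
  exact fun h' => h.2 (h'.unique hc h.1)

theorem Standing.clsLast_of_mem_children (hN : N.Standing) {e e' : N.Edge} (hc : ¬ N.ClsLast e)
    (h : e' ∈ N.children e) : N.ClsLast e' := by
  rw [mem_children_pool hc] at h
  exact (hN.clsLast_or_poolLast e').resolve_right fun h' => h.2 (h'.unique (hN.poolLast hc) h.1)

theorem Standing.cls_lt_of_mem_children (hN : N.Standing) {e e' : N.Edge} (hc : ¬ N.ClsLast e)
    (h : e' ∈ N.children e) : e'.cls < e.cls := by
  have h1 := hN.cls_le (hN.rank_lt_of_mem_children h)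
  rw [mem_children_pool hc] at h
  exact lt_of_le_of_ne h1 fun h' => h.2 (Edge.ext' h' h.1)

/-- Strong induction along the children relation. -/
theorem Standing.children_induction (hN : N.Standing) {p : N.Edge → Prop}
    (h : ∀ e, (∀ e' ∈ N.children e, p e') → p e) (e : N.Edge) : p e := by
  induction hk : N.rank e using Nat.strong_induction_on generalizing e with
  | _ k ih =>
    subst hk
    exact h e fun e' he' => ih _ (hN.rank_lt_of_mem_children he') e' rfl

/-! ### Activity vectors versus vertex totals; the relaxation map -/

/-- Class totals and totals of all pools but the last, as a linear map. -/
noncomputable def totals (N : Network m n) :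
    (N.Edge → ℝ) →ₗ[ℝ] (Fin (m + 1) → ℝ) × ({j : Fin (n + 1) // j ≠ Fin.last n} → ℝ) where
  toFun u := (fun i => N.classSum u i, fun j => N.poolSum u j.1)
  map_add' u v := by
    ext <;> simp [classSum, poolSum, Finset.sum_add_distrib]
  map_smul' a u := by
    ext <;> simp [classSum, poolSum, Finset.mul_sum]

/-- Leaf peeling: the total at the leaf vertex of `e` is the value at `e` plus the values at its
children, which vanish by induction. -/
theorem Standing.eq_zero_of_totals (hN : N.Standing) {u : N.Edge → ℝ}
    (h1 : ∀ i, N.classSum u i = 0) (h2 : ∀ j, j ≠ Fin.last n → N.poolSum u j = 0) (e : N.Edge) :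
    u e = 0 := by
  induction e using hN.children_induction with
  | h e ih =>
    by_cases hc : N.ClsLast e
    · have := sum_children_cls hc u
      rw [h1, Finset.sum_eq_zero ih] at this
      linarith
    · have := sum_children_pool hc u
      rw [h2 _ (hN.pool_ne_last hc), Finset.sum_eq_zero ih] at this
      linarith

theorem Standing.totals_injective (hN : N.Standing) : Function.Injective N.totals := by
  rw [← LinearMap.ker_eq_bot, LinearMap.ker_eq_bot']
  intro u hu
  ext e
  exact hN.eq_zero_of_totals (fun i => congrFun (congrArg Prod.fst hu) i)
    (fun j hj => congrFun (congrArg Prod.snd hu) ⟨j, hj⟩) e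

/-- Injectivity gives one inequality and the edge count of the tree the other. Hence injectivity
alone makes the totals an isomorphism. -/
theorem Standing.finrank_totals (hN : N.Standing) :
    Module.finrank ℝ (N.Edge → ℝ) = Module.finrank ℝ
      ((Fin (m + 1) → ℝ) × ({j : Fin (n + 1) // j ≠ Fin.last n} → ℝ)) := by
  refine le_antisymm (LinearMap.finrank_le_finrank_of_injective hN.totals_injective) ?_
  rw [Module.finrank_prod, Module.finrank_fintype_fun_eq_card, Module.finrank_fintype_fun_eq_card,
    Module.finrank_fintype_fun_eq_card, Fintype.card_fin]
  have h := hN.card_vertices_le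
  have h' : Fintype.card {j : Fin (n + 1) // j ≠ Fin.last n} = n := by
    simp
  omega

/-- An activity vector is determined by its class totals and the totals of all pools but the
last. -/
noncomputable def Standing.totalsEquiv (hN : N.Standing) :
    (N.Edge → ℝ) ≃ₗ[ℝ] (Fin (m + 1) → ℝ) × ({j : Fin (n + 1) // j ≠ Fin.last n} → ℝ) :=
  LinearEquiv.ofInjectiveOfFinrankEq N.totals hN.totals_injective hN.finrank_totals

theorem Standing.totalsEquiv_apply (hN : N.Standing) (u : N.Edge → ℝ) :
    hN.totalsEquiv u = N.totals u := rfl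

/-- The inverse of the totals isomorphism is bounded, being linear in finite dimension. This turns
estimates on vertex totals into estimates on each single activity. -/
theorem Standing.exists_bound (hN : N.Standing) :
    ∃ C : ℝ, 1 ≤ C ∧ ∀ (u : N.Edge → ℝ) (δ : ℝ), 0 ≤ δ → (∀ i, |N.classSum u i| ≤ δ) →
      (∀ j, j ≠ Fin.last n → |N.poolSum u j| ≤ δ) → ∀ e, |u e| ≤ C * δ := by
  let R := hN.totalsEquiv.symm.toContinuousLinearEquiv.toContinuousLinearMap
  refine ⟨‖R‖ + 1, by linarith [norm_nonneg R], fun u δ hδ h1 h2 e => ?_⟩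
  have hR : R (N.totals u) = u := hN.totalsEquiv.symm_apply_apply u
  have h3 : ‖N.totals u‖ ≤ δ := by
    rw [Prod.norm_def]
    refine max_le ?_ ?_
    · exact (pi_norm_le_iff_of_nonneg hδ).2 h1
    · exact (pi_norm_le_iff_of_nonneg hδ).2 fun j => h2 j.1 j.2
  calc |u e| ≤ ‖u‖ := norm_le_pi_norm u e
    _ = ‖R (N.totals u)‖ := by rw [hR]
    _ ≤ ‖R‖ * ‖N.totals u‖ := R.le_opNorm _
    _ ≤ ‖R‖ * δ := by gcongr
    _ ≤ (‖R‖ + 1) * δ := by nlinarith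

/-- The relaxation map. -/
noncomputable def Standing.relax (hN : N.Standing) : N.Vec →ₗ[ℝ] N.Vec where
  toFun v := WithLp.toLp 2 (Sum.elim
    (hN.totalsEquiv.symm (fun i => N.classSum v.act i + v.queue i, 0)) 0)
  map_add' v w := by
    have : ((fun i => N.classSum (v + w).act i + (v + w).queue i, 0) :
        (Fin (m + 1) → ℝ) × ({j : Fin (n + 1) // j ≠ Fin.last n} → ℝ)) =
        (fun i => N.classSum v.act i + v.queue i, 0) +
        (fun i => N.classSum w.act i + w.queue i, 0) := by
      ext
      · simp only [Vec.act, Vec.queue, classSum, PiLp.add_apply, Finset.sum_add_distrib,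
          Prod.mk_add_mk, Pi.add_apply]
        ring
      · simp
    rw [this, map_add]
    ext x
    rcases x with e | i <;> simp
  map_smul' a v := by
    have : ((fun i => N.classSum (a • v).act i + (a • v).queue i, 0) :
        (Fin (m + 1) → ℝ) × ({j : Fin (n + 1) // j ≠ Fin.last n} → ℝ)) =
        a • (fun i => N.classSum v.act i + v.queue i, 0) := by
      ext
      · simp [Vec.act, Vec.queue, classSum, Finset.mul_sum, mul_add]
      · simp
    rw [this, map_smul]
    ext x
    rcases x with e | i <;> simp

theorem Standing.totals_relax (hN : N.Standing) (v : N.Vec) :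
    N.totals (hN.relax v).act = (fun i => N.classSum v.act i + v.queue i, 0) := by
  rw [← hN.totalsEquiv_apply]
  exact hN.totalsEquiv.apply_symm_apply _

theorem Standing.isRelaxation_relax (hN : N.Standing) (v : N.Vec) :
    N.IsRelaxation v (hN.relax v) where
  queue _ := rfl
  total i := (congrFun (congrArg Prod.fst (hN.totals_relax v)) i).symm
  pools j hj := congrFun (congrArg Prod.snd (hN.totals_relax v)) ⟨j, hj⟩

theorem Standing.isRelaxation_iff (hN : N.Standing) (v c : N.Vec) :
    N.IsRelaxation v c ↔ c = hN.relax v := by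
  refine ⟨fun h => ?_, fun h => h ▸ hN.isRelaxation_relax v⟩
  have h' := hN.isRelaxation_relax v
  have hact : c.act = (hN.relax v).act := by
    apply hN.totals_injective
    refine Prod.ext (funext fun i => ?_) (funext fun j => ?_)
    · exact ((h.total i).symm.trans (h'.total i))
    · exact (h.pools _ j.2).trans (h'.pools _ j.2).symm
  ext x
  rcases x with e | i
  · exact congrFun hact e
  · exact (h.queue i).trans (h'.queue i).symm

/-! ### The equilibrium point -/

/-- Feasible occupancies. -/
structure FeasibleOcc (N : Network m n) (psi : N.Edge → ℝ) : Prop where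
  nonneg : ∀ e, 0 ≤ psi e
  demand : ∀ i, N.lam i = N.classSum (fun e => N.rate e * psi e) i
  load : ∀ j, N.poolSum psi j ≤ N.beta j
  slack : N.poolSum psi (Fin.last n) < N.beta (Fin.last n)

/-- The optimal solution of the static planning problem, restricted to basic activities, is the
starting point of the exchange argument. Its value below one makes every pool strictly underloaded.
Only the slack of the last pool is recorded, since the exchange fills the others. -/
theorem Standing.exists_feasibleOcc (hN : N.Standing) : ∃ psi, N.FeasibleOcc psi := by
  obtain ⟨x, ρ, ⟨hx, -⟩, -, hE, hρ⟩ := hN.crp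
  have hload : ∀ j, N.poolSum (fun e : N.Edge => x e.cls e.pool / N.rate e) j < N.beta j := by
    intro j
    have h1 := hx.load j
    have h2 : ∑ i, x i j / (N.beta j * N.mu i j) =
        (∑ i, x i j / N.mu i j) / N.beta j := by
      rw [Finset.sum_div]
      refine Finset.sum_congr rfl fun i _ => ?_
      rw [div_div, mul_comm]
    have h3 : ∑ i, x i j / N.mu i j = N.poolSum (fun e : N.Edge => x e.cls e.pool / N.rate e) j := by
      unfold poolSum
      symm
      -- The sum over all classes and the sum over activities differ only by pairs that carry no
      -- load.
      refine Finset.sum_bij_ne_zero (fun e _ _ => e.cls) (fun _ _ _ => Finset.mem_univ _) ?_ ?_ ?_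
      · intro e he _ e' he' _ h
        simp only [Finset.mem_filter, Finset.mem_univ, true_and] at he he'
        exact Edge.ext' h (he.trans he'.symm)
      · intro i _ hi
        have hxi : x i j ≠ 0 := fun h => hi (by simp [h])
        exact ⟨⟨(i, j), (hE i j).2 (lt_of_le_of_ne (hx.nonneg i j) hxi.symm)⟩, by simp, hi, rfl⟩
      · intro e he _
        simp only [Finset.mem_filter, Finset.mem_univ, true_and] at he
        subst he
        rfl
    rw [h2, h3] at h1
    have h4 := (div_le_iff₀ (hN.beta_pos j)).1 h1
    nlinarith [hN.beta_pos j]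
  refine ⟨fun e => x e.cls e.pool / N.rate e, fun e => ?_, fun i => ?_, fun j => (hload j).le,
    hload _⟩
  · exact div_nonneg (hx.nonneg _ _) (hN.rate_pos e).le
  · rw [← hx.demand i]
    unfold classSum
    symm
    refine Finset.sum_bij_ne_zero (fun e _ _ => e.pool) (fun _ _ _ => Finset.mem_univ _) ?_ ?_ ?_
    · intro e he _ e' he' _ h
      simp only [Finset.mem_filter, Finset.mem_univ, true_and] at he he'
      exact Edge.ext' (he.trans he'.symm) h
    · intro j _ hi
      refine ⟨⟨(i, j), (hE i j).2 (lt_of_le_of_ne (hx.nonneg i j) (Ne.symm hi))⟩, by simp, ?_, rfl⟩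
      rw [mul_div_cancel₀ _ (hN.rate_pos _).ne']
      exact hi
    · intro e he _
      simp only [Finset.mem_filter, Finset.mem_univ, true_and] at he
      subst he
      exact mul_div_cancel₀ _ (hN.rate_pos _).ne'

/-- Sum over a vertex, split at an activity. -/
theorem sum_filter_split (p : N.Edge → Prop) [DecidablePred p] (e : N.Edge) (he : p e) (x : N.Edge → ℝ) :
    ∑ e' with p e', x e' = (∑ e' : {e' : N.Edge // p e' ∧ N.rank e' < N.rank e}, x e'.1) + x e +
      ∑ e' with p e' ∧ N.rank e < N.rank e', x e' := by
  rw [← Finset.sum_subtype (Finset.univ.filter fun e' => p e' ∧ N.rank e' < N.rank e)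
    (by simp) x, Finset.sum_filter, Finset.sum_filter, Finset.sum_filter]
  have h1 : x e = ∑ e', if e' = e then x e' else 0 := by simp
  conv_rhs => rw [h1]
  rw [← Finset.sum_add_distrib, ← Finset.sum_add_distrib]
  refine Finset.sum_congr rfl fun e' _ => ?_
  rcases lt_trichotomy (N.rank e') (N.rank e) with h | h | h
  · have hne : e' ≠ e := by rintro rfl; exact lt_irrefl _ h
    simp [h, hne, h.not_gt]
  · have := rank_injective h
    subst this
    simp [he]
  · have hne : e' ≠ e := by rintro rfl; exact lt_irrefl _ h
    simp [h, hne, h.not_gt]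

/-- Shifting the load of later activities of a class towards an activity which is the last one of
its pool. -/
theorem FeasibleOcc.shift {psi : N.Edge → ℝ} (h : N.FeasibleOcc psi) (e : N.Edge)
    (hp : e.pool ≠ Fin.last n) {a θ : ℝ} (ha : psi e ≤ a) (hθ : 0 ≤ θ) (hθ1 : θ ≤ 1)
    (hload : N.poolSum psi e.pool + (a - psi e) ≤ N.beta e.pool)
    (hdem : N.rate e * a + θ * ∑ e' with e'.cls = e.cls ∧ N.rank e < N.rank e',
      N.rate e' * psi e' = N.rate e * psi e + ∑ e' with e'.cls = e.cls ∧ N.rank e < N.rank e',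
      N.rate e' * psi e') :
    N.FeasibleOcc fun e' => if e' = e then a else
      if e'.cls = e.cls ∧ N.rank e < N.rank e' then θ * psi e' else psi e' := by
  set psi' : N.Edge → ℝ := fun e' => if e' = e then a else
      if e'.cls = e.cls ∧ N.rank e < N.rank e' then θ * psi e' else psi e' with hpsi'
  have hle : ∀ e', e' ≠ e → psi' e' ≤ psi e' := by
    intro e' hne
    simp only [hpsi', hne, if_false]
    split_ifs
    · nlinarith [h.nonneg e']
    · exact le_rfl
  have hpool : ∀ j, j ≠ e.pool → N.poolSum psi' j ≤ N.poolSum psi j := by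
    intro j hj
    refine Finset.sum_le_sum fun e' he' => hle e' ?_
    rintro rfl
    simp only [Finset.mem_filter, Finset.mem_univ, true_and] at he'
    exact hj he'.symm
  refine ⟨fun e' => ?_, fun i => ?_, fun j => ?_, ?_⟩
  · simp only [hpsi']
    split_ifs
    · exact (h.nonneg e).trans ha
    · exact mul_nonneg hθ (h.nonneg _)
    · exact h.nonneg _
  · rw [h.demand i]
    by_cases hi : i = e.cls
    · subst hi
      unfold classSum
      rw [sum_filter_split (fun e' => e'.cls = e.cls) e rfl,
        sum_filter_split (fun e' => e'.cls = e.cls) e rfl]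
      have h1 : ∀ e' : {e' : N.Edge // e'.cls = e.cls ∧ N.rank e' < N.rank e},
          psi' e'.1 = psi e'.1 := by
        rintro ⟨e', h1, h2⟩
        have hne : e' ≠ e := by rintro rfl; exact lt_irrefl _ h2
        simp [hpsi', hne, h2.not_gt]
      have h2 : psi' e = a := by simp [hpsi']
      have h3 : ∑ e' with e'.cls = e.cls ∧ N.rank e < N.rank e', N.rate e' * psi' e' =
          θ * ∑ e' with e'.cls = e.cls ∧ N.rank e < N.rank e', N.rate e' * psi e' := by
        rw [Finset.mul_sum]
        refine Finset.sum_congr rfl fun e' he' => ?_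
        simp only [Finset.mem_filter, Finset.mem_univ, true_and] at he'
        have hne : e' ≠ e := by rintro rfl; exact lt_irrefl _ he'.2
        simp only [hpsi', hne, he'.1, he'.2, if_false, and_self, if_true]
        ring
      simp only [h1, h2]
      rw [h3]
      linarith
    · refine Finset.sum_congr rfl fun e' he' => ?_
      simp only [Finset.mem_filter, Finset.mem_univ, true_and] at he'
      subst he'
      have hne : e' ≠ e := by rintro rfl; exact hi rfl
      simp [hpsi', hne, hi]
  · by_cases hj : j = e.pool
    · subst hj
      refine le_trans ?_ hload
      unfold poolSum
      rw [← Finset.add_sum_erase _ psi' (a := e) (by simp),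
        ← Finset.add_sum_erase _ psi (a := e) (by simp)]
      have h1 : ∑ x ∈ (Finset.univ.filter fun e' : N.Edge => e'.pool = e.pool).erase e, psi' x ≤
          ∑ x ∈ (Finset.univ.filter fun e' : N.Edge => e'.pool = e.pool).erase e, psi x :=
        Finset.sum_le_sum fun e' he' => hle e' (Finset.ne_of_mem_erase he')
      have h2 : psi' e = a := by simp [hpsi']
      linarith
    · exact (hpool j hj).trans (h.load j)
  · exact (hpool _ hp.symm).trans_lt h.slack

theorem psiStar_mul_rate (hN : N.Standing) (e : N.Edge) : N.rate e * N.psiStar e = N.eqRate e :=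
  mul_div_cancel₀ _ (hN.rate_pos e).ne'

theorem eqRate_eq (hN : N.Standing) (e : N.Edge) : N.eqRate e = min
    (N.lam e.cls - ∑ e' : {e' : N.Edge // e'.cls = e.cls ∧ N.rank e' < N.rank e},
      N.rate e'.1 * N.psiStar e'.1)
    (N.rate e * (N.beta e.pool -
      ∑ e' : {e' : N.Edge // e'.pool = e.pool ∧ N.rank e' < N.rank e}, N.psiStar e'.1)) := by
  rw [eqRate]
  simp only [psiStar_mul_rate hN]
  rfl

/-- Greedy exchange, one activity at a time in the order of priority. At a class-last activity the
demand equation already forces the equilibrium value. At a pool-last one the pool is filled up, with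
load taken from later activities of the same class. -/
theorem Standing.exists_feasibleOcc_agree (hN : N.Standing) (k : ℕ) :
    ∃ psi, N.FeasibleOcc psi ∧ ∀ e, N.rank e < k → psi e = N.psiStar e := by
  induction k with
  | zero =>
    obtain ⟨psi, h⟩ := hN.exists_feasibleOcc
    exact ⟨psi, h, fun e he => absurd he (Nat.not_lt_zero _)⟩
  | succ k ih =>
    obtain ⟨psi, h, hag⟩ := ih
    by_cases hk : ∃ e : N.Edge, N.rank e = k
    swap
    · push Not at hk
      exact ⟨psi, h, fun e he => hag e (lt_of_le_of_ne (Nat.lt_succ_iff.1 he) (hk e))⟩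
    obtain ⟨e, rfl⟩ := hk
    have hμ := hN.rate_pos e
    have hcls := h.demand e.cls
    have hpool := h.load e.pool
    have hps : N.poolSum psi e.pool = _ := sum_filter_split (fun e' => e'.pool = e.pool) e rfl psi
    rw [classSum, sum_filter_split (fun e' => e'.cls = e.cls) e rfl] at hcls
    have hrest : 0 ≤ ∑ e' with e'.pool = e.pool ∧ N.rank e < N.rank e', psi e' :=
      Finset.sum_nonneg fun e' _ => h.nonneg e'
    have heq := eqRate_eq hN e
    have h1 : ∀ (p : N.Edge → Prop) [DecidablePred p] (c : N.Edge → ℝ),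
        ∑ e' : {e' : N.Edge // p e' ∧ N.rank e' < N.rank e}, c e'.1 * N.psiStar e'.1 =
        ∑ e' : {e' : N.Edge // p e' ∧ N.rank e' < N.rank e}, c e'.1 * psi e'.1 :=
      fun p _ c => Finset.sum_congr rfl fun e' _ => by rw [hag e'.1 e'.2.2]
    have h2 := h1 (fun e' => e'.pool = e.pool) (fun _ => 1)
    simp only [one_mul] at h2
    rw [h1 (fun e' => e'.cls = e.cls) N.rate, h2] at heq
    set S1 := ∑ e' : {e' : N.Edge // e'.cls = e.cls ∧ N.rank e' < N.rank e},
      N.rate e'.1 * psi e'.1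
    set S2 := ∑ e' : {e' : N.Edge // e'.pool = e.pool ∧ N.rank e' < N.rank e}, psi e'.1
    by_cases hc : N.ClsLast e
    · have hz : ∑ e' with e'.cls = e.cls ∧ N.rank e < N.rank e', N.rate e' * psi e' = 0 := by
        refine Finset.sum_eq_zero fun e' he' => ?_
        simp only [Finset.mem_filter, Finset.mem_univ, true_and] at he'
        exact absurd (hc e' he'.1) (not_le.2 he'.2)
      rw [hz] at hcls
      refine ⟨psi, h, fun e' he' => ?_⟩
      rcases (Nat.lt_succ_iff.1 he').lt_or_eq with hlt | hre
      · exact hag e' hlt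
      · have := rank_injective hre
        subst this
        rw [min_eq_left] at heq
        · rw [psiStar, heq, eq_div_iff hμ.ne']
          linarith
        · nlinarith
    · have hzp : ∑ e' with e'.pool = e.pool ∧ N.rank e < N.rank e', psi e' = 0 := by
        refine Finset.sum_eq_zero fun e' he' => ?_
        simp only [Finset.mem_filter, Finset.mem_univ, true_and] at he'
        exact absurd (hN.poolLast hc e' he'.1) (not_le.2 he'.2)
      rw [hzp] at hps
      set R := ∑ e' with e'.cls = e.cls ∧ N.rank e < N.rank e', N.rate e' * psi e' with hR
      have hR0 : 0 ≤ R := Finset.sum_nonneg fun e' _ => mul_nonneg (hN.rate_pos e').le (h.nonneg e')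
      -- The pool cannot absorb all that remains of its class: otherwise moving everything there (`θ
      -- = 0`) would leave a later activity of the class unused, against `all_used`. So the second
      -- entry of the minimum is the smaller one.
      have hlt : N.rate e * (N.beta e.pool - S2) < N.rate e * psi e + R := by
        by_contra hcon
        push Not at hcon
        have hsh := h.shift e (hN.pool_ne_last hc) (a := psi e + R / N.rate e) (θ := 0)
          (le_add_of_nonneg_right (div_nonneg hR0 hμ.le)) le_rfl zero_le_one
          (by
            have : R / N.rate e ≤ N.beta e.pool - S2 - psi e := by
              rw [div_le_iff₀ hμ]; nlinarith
            linarith)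
          (by rw [mul_add, mul_div_cancel₀ _ hμ.ne']; ring)
        rw [ClsLast] at hc
        push Not at hc
        obtain ⟨e', h3, h4⟩ := hc
        have hpos := hN.all_used _ hsh.nonneg hsh.demand hsh.load e'
        have hne : e' ≠ e := by rintro rfl; exact lt_irrefl _ h4
        simp [hne, h3, h4] at hpos
      have hRpos : 0 < R := by nlinarith
      -- Fill the pool exactly, and scale the later activities of the class by the factor that
      -- preserves its demand.
      have hsh := h.shift e (hN.pool_ne_last hc) (a := N.beta e.pool - S2)
        (θ := (N.rate e * psi e + R - N.rate e * (N.beta e.pool - S2)) / R) (by linarith)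
        (div_nonneg (by linarith) hR0) (by rw [div_le_one hRpos]; nlinarith) (by linarith)
        (by rw [div_mul_cancel₀ _ hRpos.ne']; ring)
      refine ⟨_, hsh, fun e' he' => ?_⟩
      rcases (Nat.lt_succ_iff.1 he').lt_or_eq with hlt' | hre
      · have hne : e' ≠ e := by rintro rfl; exact lt_irrefl _ hlt'
        simp [hne, hlt'.not_gt, hag e' hlt']
      · have := rank_injective hre
        subst this
        rw [min_eq_right (by linarith)] at heq
        rw [psiStar, heq]
        simp only [if_true]
        field_simp

theorem Standing.feasibleOcc_psiStar (hN : N.Standing) : N.FeasibleOcc N.psiStar := by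
  obtain ⟨psi, h, hag⟩ := hN.exists_feasibleOcc_agree N.order.length
  have : psi = N.psiStar := funext fun e => hag e (List.idxOf_lt_length_iff.2 e.2)
  exact this ▸ h

theorem Standing.psiStar_pos (hN : N.Standing) (e : N.Edge) : 0 < N.psiStar e :=
  hN.all_used _ hN.feasibleOcc_psiStar.nonneg hN.feasibleOcc_psiStar.demand
    hN.feasibleOcc_psiStar.load e

/-- At the last activity of the pool, the minimum cannot be the remaining demand of the class,
because that class has later activities with positive occupancy. Hence the minimum is the remaining
capacity, and the pool is full. -/
theorem Standing.poolSum_psiStar (hN : N.Standing) (j : Fin (n + 1)) (hj : j ≠ Fin.last n) :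
    N.poolSum N.psiStar j = N.beta j := by
  obtain ⟨e, rfl, hc⟩ := hN.exists_poolLast j hj
  have heq := eqRate_eq hN e
  have hdem := hN.feasibleOcc_psiStar.demand e.cls
  rw [classSum, sum_filter_split (fun e' => e'.cls = e.cls) e rfl] at hdem
  have hzp : ∑ e' with e'.pool = e.pool ∧ N.rank e < N.rank e', N.psiStar e' = 0 := by
    refine Finset.sum_eq_zero fun e' he' => ?_
    simp only [Finset.mem_filter, Finset.mem_univ, true_and] at he'
    exact absurd (hN.poolLast hc e' he'.1) (not_le.2 he'.2)
  have hpos : 0 < ∑ e' with e'.cls = e.cls ∧ N.rank e < N.rank e', N.rate e' * N.psiStar e' := by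
    refine Finset.sum_pos (fun e' _ => mul_pos (hN.rate_pos e') (hN.psiStar_pos e')) ?_
    rw [ClsLast] at hc
    push Not at hc
    obtain ⟨e', h3, h4⟩ := hc
    exact ⟨e', by simp [h3, h4]⟩
  rw [poolSum, sum_filter_split (fun e' => e'.pool = e.pool) e rfl, hzp]
  rcases min_choice (N.lam e.cls - ∑ e' : {e' : N.Edge // e'.cls = e.cls ∧ N.rank e' < N.rank e},
      N.rate e'.1 * N.psiStar e'.1)
    (N.rate e * (N.beta e.pool -
      ∑ e' : {e' : N.Edge // e'.pool = e.pool ∧ N.rank e' < N.rank e}, N.psiStar e'.1)) with h | h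
  · rw [h, ← psiStar_mul_rate hN] at heq
    linarith
  · rw [h, ← psiStar_mul_rate hN] at heq
    have := mul_left_cancel₀ (hN.rate_pos e).ne' heq
    linarith

end Network

/-! ### Sample paths: induction, work conservation and service starts -/

/-- Induction on a half-line of reals. -/
theorem real_induction_Ici {a : ℝ} {P : ℝ → Prop} (h0 : P a)
    (hl : ∀ t, a < t → (∀ s, a ≤ s → s < t → P s) → P t)
    (hr : ∀ t, a ≤ t → (∀ s, a ≤ s → s ≤ t → P s) → ∀ᶠ s in 𝓝[>] t, P s) :
    ∀ t, a ≤ t → P t := by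
  by_contra! hcon
  obtain ⟨t, hat, ht⟩ := hcon
  set S : Set ℝ := {t | a ≤ t ∧ ¬ P t}
  have hbdd : BddBelow S := ⟨a, fun s hs => hs.1⟩
  have hne : S.Nonempty := ⟨t, hat, ht⟩
  set τ := sInf S
  have haτ : a ≤ τ := le_csInf hne fun s hs => hs.1
  have hlt : ∀ s, a ≤ s → s < τ → P s := fun s hs hsτ => by
    by_contra hn
    exact notMem_of_lt_csInf hsτ hbdd ⟨hs, hn⟩
  have hτ : P τ := by
    rcases haτ.eq_or_lt with h | h
    · rw [← h]; exact h0
    · exact hl τ h hlt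
  have hle : ∀ s, a ≤ s → s ≤ τ → P s := fun s hs hsτ => by
    rcases hsτ.eq_or_lt with h | h
    · rw [h]; exact hτ
    · exact hlt s hs h
  obtain ⟨u, hu, hu'⟩ := mem_nhdsGT_iff_exists_Ioo_subset.1 (hr τ haτ hle)
  obtain ⟨s, hs, hsu⟩ := exists_lt_of_csInf_lt hne hu
  have hτs : τ ≤ s := csInf_le hbdd hs
  rcases hτs.eq_or_lt with h | h
  · rw [h] at hτ; exact hs.2 hτ
  · exact hs.2 (hu' ⟨h, hsu⟩)

namespace Network

variable {m n : ℕ} {N : Network m n}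

/-- Induction along a path of the system. -/
theorem IsRealization.induction {r : ℝ} {X : ℝ → N.State} (hX : N.IsRealization r X) {a : ℝ}
    (ha : 0 ≤ a) {P : ℝ → N.State → Prop} (h0 : P a (X a))
    (hmono : ∀ s t x, a ≤ s → s ≤ t → P s x → P t x)
    (hstep : ∀ t x y, a ≤ t → P t x → N.Step (N.capacity r) x y → P t y) :
    ∀ t, a ≤ t → P t (X t) := by
  refine real_induction_Ici h0 (fun t hat h => ?_) (fun t hat h => ?_)
  · obtain ⟨x, hx, hxt⟩ := hX.left_step t (ha.trans_lt hat)
    have h1 : ∀ᶠ s in 𝓝[<] t, s ∈ Set.Ioo a t := Ioo_mem_nhdsLT hat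
    obtain ⟨s, hs, hs'⟩ := (hx.and h1).exists
    have hPx : P t x := hmono s t x hs'.1.le hs'.2.le (hs ▸ h s hs'.1.le hs'.2)
    rcases hxt with h | h
    · rw [h]; exact hPx
    · exact hstep t x _ hat.le hPx h
  · filter_upwards [hX.right_const t (ha.trans hat), self_mem_nhdsWithin] with s hs hts
    rw [hs]
    exact hmono t s _ hat (le_of_lt hts) (h t hat le_rfl)

theorem classSum_add {M : Type*} [AddCommMonoid M] (x y : N.Edge → M) (i : Fin (m + 1)) :
    N.classSum (x + y) i = N.classSum x i + N.classSum y i := by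
  simp [classSum, Finset.sum_add_distrib]

theorem poolSum_add {M : Type*} [AddCommMonoid M] (x y : N.Edge → M) (j : Fin (n + 1)) :
    N.poolSum (x + y) j = N.poolSum x j + N.poolSum y j := by
  simp [poolSum, Finset.sum_add_distrib]

theorem classSum_single (e : N.Edge) (i : Fin (m + 1)) :
    N.classSum (Pi.single e (1 : ℕ)) i = if e.cls = i then 1 else 0 := by
  simp [classSum, Pi.single_apply]

theorem poolSum_single (e : N.Edge) (j : Fin (n + 1)) :
    N.poolSum (Pi.single e (1 : ℕ)) j = if e.pool = j then 1 else 0 := by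
  simp [poolSum, Pi.single_apply]

theorem exists_add_single {α : Type*} [DecidableEq α] {x : α → ℕ} {a : α} (h : 0 < x a) :
    ∃ y : α → ℕ, x = y + Pi.single a 1 := by
  refine ⟨x - Pi.single a 1, funext fun b => ?_⟩
  by_cases hb : b = a
  · subst hb; simp; omega
  · simp [hb]

/-- Work conservation: pools are not overfilled, and no customer waits while a server that can
serve it is idle. -/
structure Legit (N : Network m n) (cap : Fin (n + 1) → ℕ) (x : N.State) : Prop where
  cap_le : ∀ j, N.poolSum x.Psi j ≤ cap j
  work : ∀ e : N.Edge, 0 < x.Q e.cls → N.poolSum x.Psi e.pool = cap e.pool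

theorem Legit.step {cap : Fin (n + 1) → ℕ} {x y : N.State} (hx : N.Legit cap x)
    (h : N.Step cap x y) : N.Legit cap y := by
  rcases h with ⟨e, idle, best⟩ | ⟨i, full⟩ | ⟨e, e', busy, same, waiting, best⟩ |
    ⟨e, busy, empty⟩
  · refine ⟨fun j => ?_, fun e' he' => ?_⟩
    · have := hx.cap_le j
      simp only [poolSum_add, poolSum_single]
      split_ifs with h
      · subst h; omega
      · omega
    · have := hx.work e' he'
      simp only [poolSum_add, poolSum_single]
      split_ifs with h
      · rw [h] at idle; omega
      · omega
  · refine ⟨hx.cap_le, fun e' he' => ?_⟩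
    by_cases h : e'.cls = i
    · exact le_antisymm (hx.cap_le _) (not_lt.1 (full e' h))
    · refine hx.work e' ?_
      simpa [h] using he'
  · obtain ⟨P, hP⟩ := exists_add_single busy
    have hpool : ∀ j, N.poolSum (x.Psi - Pi.single e 1 + Pi.single e' 1) j =
        N.poolSum x.Psi j := by
      intro j
      rw [hP, add_tsub_cancel_right, poolSum_add, poolSum_add, poolSum_single, poolSum_single, same]
    refine ⟨fun j => (hpool j).trans_le (hx.cap_le j), fun e'' he'' => ?_⟩
    refine (hpool _).trans (hx.work e'' (he''.trans_le ?_))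
    simp
  · obtain ⟨P, hP⟩ := exists_add_single busy
    have hpool : ∀ j, N.poolSum x.Psi j =
        N.poolSum (x.Psi - Pi.single e 1) j + if e.pool = j then 1 else 0 := by
      intro j
      rw [hP, add_tsub_cancel_right, poolSum_add, poolSum_single]
    refine ⟨fun j => ?_, fun e' he' => ?_⟩
    · have := hx.cap_le j
      rw [hpool] at this
      simp only
      omega
    · have := hx.work e' he'
      rw [hpool] at this
      split_ifs at this with h
      · exact absurd (empty e' h.symm) he'.ne'
      · exact this

theorem IsRealization.legit {r : ℝ} {X : ℝ → N.State} (hX : N.IsRealization r X) (t : ℝ)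
    (ht : 0 ≤ t) : N.Legit (N.capacity r) (X t) :=
  hX.induction le_rfl (P := fun _ x => N.Legit (N.capacity r) x) ⟨hX.init_cap, hX.init_work⟩
    (fun _ _ _ _ _ h => h) (fun _ _ _ _ h hs => h.step hs) t ht

theorem Step.conservation {cap : Fin (n + 1) → ℕ} {x y : N.State}
    (h : N.Step cap x y) (i : Fin (m + 1)) :
    N.classSum y.Psi i + y.Q i + N.classSum y.D i + x.A i =
      N.classSum x.Psi i + x.Q i + N.classSum x.D i + y.A i := by
  rcases h with ⟨e, idle, best⟩ | ⟨i', full⟩ | ⟨e, e', busy, same, waiting, best⟩ |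
    ⟨e, busy, empty⟩
  · simp only [classSum_add, classSum_single, Pi.add_apply, Pi.single_apply, eq_comm (a := i)]
    split_ifs <;> omega
  · simp only [Pi.add_apply, Pi.single_apply]
    omega
  · obtain ⟨P, hP⟩ := exists_add_single busy
    obtain ⟨Q, hQ⟩ := exists_add_single waiting
    simp only [hP, hQ, add_tsub_cancel_right, classSum_add, classSum_single, Pi.add_apply,
      Pi.single_apply, eq_comm (a := i)]
    omega
  · obtain ⟨P, hP⟩ := exists_add_single busy
    simp only [hP, add_tsub_cancel_right, classSum_add, classSum_single]
    omega

theorem IsRealization.conservation {r : ℝ} {X : ℝ → N.State} (hX : N.IsRealization r X) (t : ℝ)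
    (ht : 0 ≤ t) (i : Fin (m + 1)) :
    N.classSum (X t).Psi i + (X t).Q i + N.classSum (X t).D i =
      N.classSum (X 0).Psi i + (X 0).Q i + (X t).A i := by
  refine hX.induction le_rfl (P := fun _ x => N.classSum x.Psi i + x.Q i + N.classSum x.D i =
      N.classSum (X 0).Psi i + (X 0).Q i + x.A i) ?_ (fun _ _ _ _ _ h => h) ?_ t ht
  · simp [hX.init_A, hX.init_D, classSum]
  · intro t x y _ h hs
    have := hs.conservation i
    omega

theorem Step.D_le {cap : Fin (n + 1) → ℕ} {x y : N.State} (h : N.Step cap x y) (e : N.Edge) :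
    x.D e ≤ y.D e := by
  cases h <;> simp

/-- The number of service starts, which is `Psi e + D e` up to a constant, does not decrease. -/
theorem Step.start_le {cap : Fin (n + 1) → ℕ} {x y : N.State} (h : N.Step cap x y) (e : N.Edge) :
    x.Psi e + x.D e ≤ y.Psi e + y.D e := by
  rcases h with ⟨e0, idle, best⟩ | ⟨i', full⟩ | ⟨e0, e', busy, same, waiting, best⟩ |
    ⟨e0, busy, empty⟩
  · simp only [Pi.add_apply]; omega
  · simp
  · obtain ⟨P, hP⟩ := exists_add_single busy
    simp only [hP, add_tsub_cancel_right, Pi.add_apply]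
    omega
  · obtain ⟨P, hP⟩ := exists_add_single busy
    simp only [hP, add_tsub_cancel_right, Pi.add_apply]
    omega

theorem IsRealization.D_monotoneOn {r : ℝ} {X : ℝ → N.State} (hX : N.IsRealization r X)
    (e : N.Edge) : MonotoneOn (fun t => ((X t).D e : ℝ)) (Set.Ici 0) := by
  intro s hs t _ hst
  exact Nat.cast_le.2 (hX.induction hs (P := fun _ x => (X s).D e ≤ x.D e) le_rfl
    (fun _ _ _ _ _ h => h) (fun _ _ _ _ h hs => h.trans (hs.D_le e)) t hst)

theorem IsRealization.start_monotoneOn {r : ℝ} {X : ℝ → N.State} (hX : N.IsRealization r X)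
    (e : N.Edge) : MonotoneOn (fun t => (((X t).Psi e + (X t).D e : ℕ) : ℝ)) (Set.Ici 0) := by
  intro s hs t _ hst
  exact Nat.cast_le.2 (hX.induction hs (P := fun _ x => (X s).Psi e + (X s).D e ≤ x.Psi e + x.D e)
    le_rfl (fun _ _ _ _ _ h => h) (fun _ _ _ _ h hs => h.trans (hs.start_le e)) t hst)

/-- An occupancy is the difference of two monotone counters, service starts and service completions.
-/
theorem IsRealization.intervalIntegrable {r : ℝ} {X : ℝ → N.State} (hX : N.IsRealization r X)
    (e : N.Edge) {s t : ℝ} (hs : 0 ≤ s) (ht : 0 ≤ t) :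
    IntervalIntegrable (fun u => ((X u).Psi e : ℝ)) MeasureTheory.volume s t := by
  have hsub : Set.uIcc s t ⊆ Set.Ici 0 := fun u hu => (le_inf hs ht).trans hu.1
  have h1 := ((hX.start_monotoneOn e).mono hsub).intervalIntegrable
    (μ := MeasureTheory.volume)
  have h2 := ((hX.D_monotoneOn e).mono hsub).intervalIntegrable (μ := MeasureTheory.volume)
  refine (h1.sub h2).congr (fun u _ => ?_)
  simp

open Classical in
/-- The deficit attached to the vertex which is a leaf at the removal of `e`: the queue of its
class or the number of idle servers of its pool. -/
noncomputable def own (N : Network m n) (cap : Fin (n + 1) → ℕ) (e : N.Edge) (x : N.State) : ℕ :=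
  if N.ClsLast e then x.Q e.cls else cap e.pool - N.poolSum x.Psi e.pool

theorem own_cls {cap : Fin (n + 1) → ℕ} {e : N.Edge} (h : N.ClsLast e) (x : N.State) :
    N.own cap e x = x.Q e.cls := by simp [own, h]

theorem own_pool {cap : Fin (n + 1) → ℕ} {e : N.Edge} (h : ¬ N.ClsLast e) (x : N.State) :
    N.own cap e x = cap e.pool - N.poolSum x.Psi e.pool := by simp [own, h]

/-- Total deficit of the children of `e`. -/
noncomputable def gap (N : Network m n) (cap : Fin (n + 1) → ℕ) (e : N.Edge) (x : N.State) : ℕ :=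
  ∑ e' ∈ N.children e, N.own cap e' x

theorem Step.own_le {cap : Fin (n + 1) → ℕ} {x y : N.State} (h : N.Step cap x y) (e : N.Edge) :
    N.own cap e y ≤ N.own cap e x + 1 := by
  by_cases hc : N.ClsLast e
  · simp only [own_cls hc]
    rcases h with ⟨e0, idle, best⟩ | ⟨i', full⟩ | ⟨e0, e', busy, same, waiting, best⟩ |
      ⟨e0, busy, empty⟩
    · simp
    · simp only [Pi.add_apply, Pi.single_apply]
      split_ifs <;> omega
    · simp only [Pi.sub_apply]
      omega
    · simp
  · simp only [own_pool hc]
    rcases h with ⟨e0, idle, best⟩ | ⟨i', full⟩ | ⟨e0, e', busy, same, waiting, best⟩ |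
      ⟨e0, busy, empty⟩
    · simp only [poolSum_add]
      omega
    · simp
    · obtain ⟨P, hP⟩ := exists_add_single busy
      simp only [hP, add_tsub_cancel_right, poolSum_add, poolSum_single, same]
      omega
    · obtain ⟨P, hP⟩ := exists_add_single busy
      simp only [hP, add_tsub_cancel_right, poolSum_add, poolSum_single]
      split_ifs <;> omega

/-- The jump bound is crude but negligible after division by `h`, which tends to infinity. It
controls a gap that becomes positive at a jump. -/
theorem Step.gap_le {cap : Fin (n + 1) → ℕ} {x y : N.State} (h : N.Step cap x y) (e : N.Edge) :
    N.gap cap e y ≤ N.gap cap e x + Fintype.card N.Edge := by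
  unfold gap
  calc ∑ e' ∈ N.children e, N.own cap e' y ≤ ∑ e' ∈ N.children e, (N.own cap e' x + 1) :=
        Finset.sum_le_sum fun e' _ => h.own_le e'
    _ = ∑ e' ∈ N.children e, N.own cap e' x + (N.children e).card := by
        simp [Finset.sum_add_distrib]
    _ ≤ _ := by gcongr; exact Finset.card_le_univ _

theorem exists_of_gap_pos {cap : Fin (n + 1) → ℕ} {x : N.State} {e : N.Edge}
    (h : 0 < N.gap cap e x) : ∃ e' ∈ N.children e, 0 < N.own cap e' x := by
  obtain ⟨e', he', h'⟩ := Finset.exists_ne_zero_of_sum_ne_zero h.ne'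
  exact ⟨e', he', Nat.pos_of_ne_zero h'⟩

/-- Work conservation: the leaf vertex of `e` and the leaf vertex of a child are a class and a pool
joined by the child activity, so they cannot carry a queue and idle servers at the same time. -/
theorem Standing.own_eq_zero (hN : N.Standing) {cap : Fin (n + 1) → ℕ} {x : N.State}
    (hx : N.Legit cap x) {e : N.Edge} (h : 0 < N.gap cap e x) : N.own cap e x = 0 := by
  obtain ⟨e', he', hpos⟩ := exists_of_gap_pos h
  by_cases hc : N.ClsLast e
  · rw [own_pool (not_clsLast_of_mem_children hc he')] at hpos
    rw [own_cls hc]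
    by_contra hne
    have := hx.work e' (by rw [((mem_children_cls hc).1 he').1]; exact Nat.pos_of_ne_zero hne)
    omega
  · rw [own_cls (hN.clsLast_of_mem_children hc he')] at hpos
    rw [own_pool hc]
    have := hx.work e' hpos
    rw [((mem_children_pool hc).1 he').1] at this
    omega

/-- No service starts in `e` while a child of `e` has a deficit. -/
theorem Standing.start_eq (hN : N.Standing) {cap : Fin (n + 1) → ℕ} {x y : N.State}
    (hx : N.Legit cap x) (h : N.Step cap x y) {e : N.Edge} (hgap : 0 < N.gap cap e x) :
    y.Psi e + y.D e = x.Psi e + x.D e := by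
  obtain ⟨e', he', hpos⟩ := exists_of_gap_pos hgap
  have hrank := hN.rank_lt_of_mem_children he'
  rcases h with ⟨e0, idle, best⟩ | ⟨i', full⟩ | ⟨e0, e1, busy, same, waiting, best⟩ |
    ⟨e0, busy, empty⟩
  -- An arrival prefers an idle child pool, which has higher priority than `e`. In the pool case a
  -- waiting child class means that the pool of `e` has no idle server.
  · have hne : e ≠ e0 := by
      rintro rfl
      by_cases hc : N.ClsLast e
      · rw [own_pool (not_clsLast_of_mem_children hc he')] at hpos
        have := best e' ((mem_children_cls hc).1 he').1 (by omega)
        omega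
      · rw [own_cls (hN.clsLast_of_mem_children hc he')] at hpos
        have := hx.work e' hpos
        rw [((mem_children_pool hc).1 he').1] at this
        omega
    simp [hne]
  · rfl
  -- If a child pool has idle servers, no customer of the class of `e` is waiting. In the pool case
  -- the waiting child class has strictly higher priority than the class of `e`.
  · have hne : e ≠ e1 := by
      rintro rfl
      by_cases hc : N.ClsLast e
      · rw [own_pool (not_clsLast_of_mem_children hc he')] at hpos
        have := hx.work e' (by rw [((mem_children_cls hc).1 he').1]; exact waiting)
        omega
      · rw [own_cls (hN.clsLast_of_mem_children hc he')] at hpos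
        have := best e' (((mem_children_pool hc).1 he').1.trans same) hpos
        exact absurd (hN.cls_lt_of_mem_children hc he') (not_lt.2 this)
    obtain ⟨P, hP⟩ := exists_add_single busy
    simp only [hP, add_tsub_cancel_right, Pi.add_apply, Pi.single_eq_of_ne hne]
    omega
  · obtain ⟨P, hP⟩ := exists_add_single busy
    simp only [hP, add_tsub_cancel_right, Pi.add_apply]
    omega

/-- Before any time `t` there is a time, either `0` or one with a small deficit of the children
of `e`, since which no service has started in `e`. -/
theorem IsRealization.exists_last_exit {r : ℝ} {X : ℝ → N.State} (hX : N.IsRealization r X)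
    (hN : N.Standing) (e : N.Edge) (t : ℝ) (ht : 0 ≤ t) : ∃ σ, 0 ≤ σ ∧ σ ≤ t ∧
      (σ = 0 ∨ N.gap (N.capacity r) e (X σ) ≤ Fintype.card N.Edge) ∧
      (X t).Psi e + (X t).D e = (X σ).Psi e + (X σ).D e := by
  refine real_induction_Ici (P := fun t => ∃ σ, 0 ≤ σ ∧ σ ≤ t ∧
      (σ = 0 ∨ N.gap (N.capacity r) e (X σ) ≤ Fintype.card N.Edge) ∧
      (X t).Psi e + (X t).D e = (X σ).Psi e + (X σ).D e) ⟨0, le_rfl, le_rfl, Or.inl rfl, rfl⟩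
    (fun t ht h => ?_) (fun t ht h => ?_) t ht
  · obtain ⟨x, hx, hxt⟩ := hX.left_step t ht
    have h1 : ∀ᶠ s in 𝓝[<] t, s ∈ Set.Ioo 0 t := Ioo_mem_nhdsLT ht
    obtain ⟨s, hs, hs0, hst⟩ := (hx.and h1).exists
    obtain ⟨σ, h2, h3, h4, h5⟩ := h s hs0.le hst
    rcases hxt with h' | h'
    · exact ⟨σ, h2, h3.trans hst.le, h4, by rw [h', ← hs]; exact h5⟩
    -- If the gap was zero just before the event, the clock restarts at `t`, where the gap is at
    -- most the one-event bound. If it was positive, the event starts no service in `e` and the old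
    -- `σ` still works.
    · rcases Nat.eq_zero_or_pos (N.gap (N.capacity r) e x) with hz | hpos
      · exact ⟨t, ht.le, le_rfl, Or.inr (by have := h'.gap_le e; omega), rfl⟩
      · refine ⟨σ, h2, h3.trans hst.le, h4, ?_⟩
        rw [hN.start_eq (hs ▸ hX.legit s hs0.le) h' hpos, ← hs]
        exact h5
  · filter_upwards [hX.right_const t ht, self_mem_nhdsWithin] with s hs hts
    obtain ⟨σ, h2, h3, h4⟩ := h t ht le_rfl
    exact ⟨σ, h2, h3.trans (le_of_lt hts), by rw [hs]; exact h4⟩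

end Network

/-! ### Analytic tools: reflection cascade, Grönwall, forced linear decay -/

/-- Cascade of one-sided reflections: if the gap `∑ e' ∈ ch e, o e'` of every node is driven down
at a large rate `κ` while it is positive, up to small errors, then all gaps vanish
up to small errors after a time of order `1 / κ`. -/
theorem exists_gap_bound {ι : Type*} [Fintype ι] (rank : ι → ℕ) (ch : ι → Finset ι)
    (hch : ∀ e, ∀ e' ∈ ch e, rank e' < rank e) :
    ∃ Γ c : ℝ, 1 ≤ Γ ∧ 0 < c ∧ ∀ (p o : ι → ℝ → ℝ) (τ b η κ G : ℝ),
      0 ≤ b → 0 ≤ η → 0 ≤ G → 0 ≤ κ → Γ * b ≤ κ →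
      (∀ e t, 0 ≤ t → t ≤ τ → 0 ≤ o e t) →
      (∀ e s t, 0 ≤ s → s ≤ t → t ≤ τ →
        |(p e t - p e s) + (o e t - o e s) + ∑ e' ∈ ch e, (p e' t - p e' s)| ≤ b * (t - s) + η) →
      (∀ e t, 0 ≤ t → t ≤ τ → ∃ σ, 0 ≤ σ ∧ σ ≤ t ∧ (σ = 0 ∨ ∑ e' ∈ ch e, o e' σ ≤ η) ∧
        p e t - p e σ ≤ -κ * (t - σ) + b * (t - σ) + η) →
      (∀ e t, 0 ≤ t → t ≤ τ → 0 < ∑ e' ∈ ch e, o e' t → o e t = 0) →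
      (∀ e, ∑ e' ∈ ch e, o e' 0 ≤ G) →
      ∀ e t, 0 ≤ t → t ≤ τ → ∑ e' ∈ ch e, o e' t ≤ Γ * (max (G - c * κ * t) 0 + η) := by
  -- The induction on rank also carries the near-constancy of `p e + o e`, which is what the parent
  -- of `e` needs. At time `s` the remaining transient is `max (G - c * κ * s) 0`.
  suffices H : ∀ k : ℕ, ∃ Γ c : ℝ, 1 ≤ Γ ∧ 0 < c ∧ ∀ (p o : ι → ℝ → ℝ) (τ b η κ G : ℝ),
      0 ≤ b → 0 ≤ η → 0 ≤ G → 0 ≤ κ → Γ * b ≤ κ →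
      (∀ e t, 0 ≤ t → t ≤ τ → 0 ≤ o e t) →
      (∀ e s t, 0 ≤ s → s ≤ t → t ≤ τ →
        |(p e t - p e s) + (o e t - o e s) + ∑ e' ∈ ch e, (p e' t - p e' s)| ≤ b * (t - s) + η) →
      (∀ e t, 0 ≤ t → t ≤ τ → ∃ σ, 0 ≤ σ ∧ σ ≤ t ∧ (σ = 0 ∨ ∑ e' ∈ ch e, o e' σ ≤ η) ∧
        p e t - p e σ ≤ -κ * (t - σ) + b * (t - σ) + η) →
      (∀ e t, 0 ≤ t → t ≤ τ → 0 < ∑ e' ∈ ch e, o e' t → o e t = 0) →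
      (∀ e, ∑ e' ∈ ch e, o e' 0 ≤ G) →
      ∀ e, rank e < k →
        (∀ t, 0 ≤ t → t ≤ τ → ∑ e' ∈ ch e, o e' t ≤ Γ * (max (G - c * κ * t) 0 + η)) ∧
        (∀ s t, 0 ≤ s → s ≤ t → t ≤ τ → |(p e t - p e s) + (o e t - o e s)| ≤
          Γ * (max (G - c * κ * s) 0 + η + b * (t - s))) by
    obtain ⟨Γ, c, h1, h2, h⟩ := H ((Finset.univ.sup rank) + 1)
    refine ⟨Γ, c, h1, h2, fun p o τ b η κ G hb hη hG hκ hΓ ho ha hσ hc hd e t ht htτ => ?_⟩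
    exact (h p o τ b η κ G hb hη hG hκ hΓ ho ha hσ hc hd e
      (Nat.lt_succ_iff.2 (Finset.le_sup (Finset.mem_univ e)))).1 t ht htτ
  intro k
  induction k with
  | zero => exact ⟨1, 1, le_rfl, one_pos, fun _ _ _ _ _ _ _ _ _ _ _ _ _ _ _ _ _ e he =>
      absurd he (Nat.not_lt_zero _)⟩
  | succ k ih =>
    obtain ⟨Γ, c, hΓ1, hc0, ih⟩ := ih
    set C : ℝ := (Fintype.card ι : ℝ) with hC
    have hC0 : 0 ≤ C := Nat.cast_nonneg _
    -- `C * Γ` pays for the children. The 3 pays for the gap at `σ` and for the errors in the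
    -- balance and in the drain of `p e`.
    set M : ℝ := C * Γ + 3 with hM
    have hCΓ : 0 ≤ C * Γ := by positivity
    have hM3 : 3 ≤ M := by linarith
    -- In the new constant, `2 * M` covers the gap at two times, `1` the balance and `C * Γ` the
    -- children; the last `Γ` keeps it above the previous constant. The speed is at most `1 / (2 *
    -- M)`, so that `M` times the receding transient falls no faster than half of the drain.
    refine ⟨2 * M + 1 + C * Γ + Γ, min c (1 / (2 * M)), by linarith, by positivity, ?_⟩
    intro p o τ b η κ G hb hη hG hκ hΓ ho ha hσ hcomp hd e he
    set c' := min c (1 / (2 * M)) with hc'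
    have hΓ' : Γ * b ≤ κ := le_trans (by gcongr; linarith) hΓ
    have hM' : 2 * M * b ≤ κ := le_trans (by gcongr; linarith) hΓ
    have IH := ih p o τ b η κ G hb hη hG hκ hΓ' ho ha hσ hcomp hd
    have hc'c : c' ≤ c := min_le_left _ _
    have hc'M : M * c' ≤ 1 / 2 := by
      have : c' ≤ 1 / (2 * M) := min_le_right _ _
      calc M * c' ≤ M * (1 / (2 * M)) := by gcongr
        _ = 1 / 2 := by field_simp
    have hθ : ∀ t, 0 ≤ t → max (G - c * κ * t) 0 ≤ max (G - c' * κ * t) 0 := by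
      intro t ht
      have : c' * κ * t ≤ c * κ * t := by gcongr
      exact max_le_max (by linarith) le_rfl
    have hsum : ∀ s t, 0 ≤ s → s ≤ t → t ≤ τ →
        |∑ e' ∈ ch e, ((p e' t - p e' s) + (o e' t - o e' s))| ≤
          C * Γ * (max (G - c * κ * s) 0 + η + b * (t - s)) := by
      intro s t hs hst htτ
      have h0 : 0 ≤ Γ * (max (G - c * κ * s) 0 + η + b * (t - s)) := by
        have := le_max_right (G - c * κ * s) 0
        have := mul_nonneg hb (sub_nonneg.2 hst)
        exact mul_nonneg (by linarith) (by linarith)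
      calc |∑ e' ∈ ch e, ((p e' t - p e' s) + (o e' t - o e' s))|
          ≤ ∑ e' ∈ ch e, |(p e' t - p e' s) + (o e' t - o e' s)| := Finset.abs_sum_le_sum_abs _ _
        _ ≤ ∑ _e' ∈ ch e, Γ * (max (G - c * κ * s) 0 + η + b * (t - s)) :=
            Finset.sum_le_sum fun e' he' => (IH e' (by have := hch e e' he'; omega)).2 s t hs hst htτ
        _ = (ch e).card * (Γ * (max (G - c * κ * s) 0 + η + b * (t - s))) := by
            rw [Finset.sum_const, nsmul_eq_mul]
        _ ≤ C * (Γ * (max (G - c * κ * s) 0 + η + b * (t - s))) := by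
            gcongr
            rw [hC]
            exact_mod_cast Finset.card_le_univ _
        _ = _ := by ring
    -- The change of the gap is that of `p e + o e`, minus the balance of `e`, plus the changes of
    -- `p e' + o e'` over the children. This closes the induction.
    have hgap : ∀ s t, ∑ e' ∈ ch e, o e' t - ∑ e' ∈ ch e, o e' s =
        (p e t - p e s) + (o e t - o e s) -
        ((p e t - p e s) + (o e t - o e s) + ∑ e' ∈ ch e, (p e' t - p e' s)) +
        ∑ e' ∈ ch e, ((p e' t - p e' s) + (o e' t - o e' s)) := by
      intro s t
      simp only [Finset.sum_add_distrib, Finset.sum_sub_distrib]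
      ring
    have key : ∀ t, 0 ≤ t → t ≤ τ →
        ∑ e' ∈ ch e, o e' t ≤ M * (max (G - c' * κ * t) 0 + η) := by
      intro t ht htτ
      have hnn : 0 ≤ M * (max (G - c' * κ * t) 0 + η) := by
        have := le_max_right (G - c' * κ * t) 0
        exact mul_nonneg (by linarith) (by linarith)
      rcases le_or_gt (∑ e' ∈ ch e, o e' t) 0 with hle | hpos
      · exact hle.trans hnn
      have hot := hcomp e t ht htτ hpos
      obtain ⟨σ, hσ0, hσt, hσ1, hσ2⟩ := hσ e t ht htτ
      set θ := max (G - c * κ * σ) 0 with hθdef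
      have hθ0 : 0 ≤ θ := le_max_right _ _
      have h1 : ∑ e' ∈ ch e, o e' σ ≤ η + θ := by
        rcases hσ1 with h | h
        · have h2 := hd e
          rw [h]
          have : G ≤ θ := by rw [hθdef, h]; simp
          linarith
        · linarith
      have h2 := hsum σ t hσ0 hσt htτ
      have h3 := ha e σ t hσ0 hσt htτ
      have h4 := hgap σ t
      have h5 := ho e σ hσ0 (hσt.trans htτ)
      rw [hot] at h4 h3
      have h2' := (abs_le.1 h2).2
      have h3' := (abs_le.1 h3).1
      have hts : 0 ≤ t - σ := sub_nonneg.2 hσt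
      have hbt : 0 ≤ b * (t - σ) := mul_nonneg hb hts
      -- Since `o e t = 0` and `o e σ ≥ 0`, the change of `p e + o e` is at most that of `p e`,
      -- which brings in the drain `-κ * (t - σ)`. Half of it then absorbs the drift `b`, and the
      -- other half follows the moving front of the transient.
      have h6 : ∑ e' ∈ ch e, o e' t ≤ M * θ + M * η + M * (b * (t - σ)) - κ * (t - σ) := by
        have : M * θ + M * η + M * (b * (t - σ)) =
          C * Γ * (θ + η + b * (t - σ)) + 3 * (θ + η + b * (t - σ)) := by rw [hM]; ring
        linarith
      have h7 : M * (b * (t - σ)) ≤ κ / 2 * (t - σ) := by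
        have := mul_le_mul_of_nonneg_right hM' hts
        linarith
      have h8 : M * θ - κ / 2 * (t - σ) ≤ M * max (G - c' * κ * t) 0 := by
        rcases le_total (G - c * κ * σ) 0 with h | h
        · have : θ = 0 := max_eq_right h
          rw [this]
          have := mul_nonneg hκ hts
          have := mul_nonneg (show 0 ≤ M by linarith) (le_max_right (G - c' * κ * t) 0)
          linarith
        · have h9 : θ = G - c * κ * σ := max_eq_left h
          have h10 := mul_le_mul_of_nonneg_left (le_max_left (G - c' * κ * t) 0)
            (show 0 ≤ M by linarith)
          have h11 : M * c' * (κ * (t - σ)) ≤ 1 / 2 * (κ * (t - σ)) :=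
            mul_le_mul_of_nonneg_right hc'M (mul_nonneg hκ hts)
          have h12 : M * (c' * κ * σ) ≤ M * (c * κ * σ) := by gcongr
          rw [h9]
          linarith
      linarith
    have hpos : ∀ t, 0 ≤ t → t ≤ τ → 0 ≤ ∑ e' ∈ ch e, o e' t := fun t ht htτ =>
      Finset.sum_nonneg fun e' _ => ho e' t ht htτ
    refine ⟨fun t ht htτ => (key t ht htτ).trans ?_, fun s t hs hst htτ => ?_⟩
    · have := le_max_right (G - c' * κ * t) 0
      gcongr
      linarith
    · have h1 := hsum s t hs hst htτ
      have h2 := ha e s t hs hst htτ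
      have h3 := hgap s t
      have h4 := key s hs (hst.trans htτ)
      have h5 := key t (hs.trans hst) htτ
      have h6 := hpos s hs (hst.trans htτ)
      have h7 := hpos t (hs.trans hst) htτ
      have h8 : max (G - c' * κ * t) 0 ≤ max (G - c' * κ * s) 0 := by
        have : c' * κ * s ≤ c' * κ * t := by gcongr
        exact max_le_max (by linarith) le_rfl
      have h9 := hθ s hs
      set θ := max (G - c' * κ * s) 0
      have hθ0 : 0 ≤ θ := le_max_right _ _
      have hbt : 0 ≤ b * (t - s) := mul_nonneg hb (sub_nonneg.2 hst)
      have h10 : C * Γ * (max (G - c * κ * s) 0 + η + b * (t - s)) ≤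
          C * Γ * (θ + η + b * (t - s)) := by gcongr
      have h11 : M * (max (G - c' * κ * t) 0 + η) ≤ M * (θ + η) := by gcongr
      have h12 : 0 ≤ M * (b * (t - s)) := mul_nonneg (by linarith) hbt
      have h13 : 0 ≤ Γ * (θ + η + b * (t - s)) := mul_nonneg (by linarith) (by linarith)
      have h14 : (2 * M + 1 + C * Γ + Γ) * (θ + η + b * (t - s)) =
        2 * (M * (θ + η)) + 2 * (M * (b * (t - s))) + (θ + η + b * (t - s)) +
          C * Γ * (θ + η + b * (t - s)) + Γ * (θ + η + b * (t - s)) := by ring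
      have hMn : 0 ≤ M * (θ + η) := mul_nonneg (by linarith) (by linarith)
      rw [h14]
      rw [abs_le] at h1 h2 ⊢
      constructor <;> linarith [h1.1, h1.2, h2.1, h2.2]

/-- Grönwall's inequality in integral form. -/
theorem le_of_le_add_integral {u : ℝ → ℝ} {T E C D : ℝ} (hC : 0 < C) (hE : 0 ≤ E)
    (hint : ∀ t, 0 ≤ t → t ≤ T → IntervalIntegrable u MeasureTheory.volume 0 t)
    (hbdd : ∀ t, 0 ≤ t → t ≤ T → u t ≤ D)
    (h : ∀ t, 0 ≤ t → t ≤ T → u t ≤ E + C * ∫ s in (0 : ℝ)..t, u s) :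
    ∀ t, 0 ≤ t → t ≤ T → u t ≤ 2 * E * Real.exp (2 * C * t) := by
  rcases lt_or_ge T 0 with hT | hT
  · intro t ht htT; linarith
  -- In the supremum weighted by `exp (-(2 * C * t))` the integral operator has norm at most one
  -- half, so the supremum `A` satisfies `A ≤ E + A / 2`.
  set S : Set ℝ := (fun t => u t * Real.exp (-(2 * C * t))) '' Set.Icc 0 T
  have hne : S.Nonempty := ⟨_, 0, ⟨le_rfl, hT⟩, rfl⟩
  have hb : BddAbove S := by
    refine ⟨max D 0, ?_⟩
    rintro _ ⟨t, ⟨ht, htT⟩, rfl⟩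
    have h1 : Real.exp (-(2 * C * t)) ≤ 1 := Real.exp_le_one_iff.2 (by
      have : 0 ≤ 2 * C * t := by positivity
      linarith)
    have h2 := Real.exp_pos (-(2 * C * t))
    have h3 := (hbdd t ht htT).trans (le_max_left D 0)
    have h4 := le_max_right D 0
    calc u t * Real.exp (-(2 * C * t)) ≤ max D 0 * Real.exp (-(2 * C * t)) := by gcongr
      _ ≤ max D 0 * 1 := by gcongr
      _ = _ := mul_one _
  set A := sSup S
  have hA : ∀ t, 0 ≤ t → t ≤ T → u t ≤ A * Real.exp (2 * C * t) := by
    intro t ht htT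
    have h1 : u t * Real.exp (-(2 * C * t)) ≤ A := le_csSup hb ⟨t, ⟨ht, htT⟩, rfl⟩
    calc u t = u t * Real.exp (-(2 * C * t)) * Real.exp (2 * C * t) := by
          rw [mul_assoc, ← Real.exp_add]; simp
      _ ≤ _ := by gcongr
  have hI : ∀ t, ∫ s in (0 : ℝ)..t, A * Real.exp (2 * C * s) =
      A * ((Real.exp (2 * C * t) - 1) / (2 * C)) := by
    intro t
    rw [intervalIntegral.integral_const_mul, intervalIntegral.integral_comp_mul_left
      (fun x => Real.exp x) (by positivity), integral_exp]
    simp only [mul_zero, Real.exp_zero, smul_eq_mul]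
    ring
  have hle : A ≤ 2 * E := by
    rcases le_or_gt A 0 with hA0 | hA0
    · linarith
    have : A ≤ E + A / 2 := by
      refine csSup_le hne ?_
      rintro _ ⟨t, ⟨ht, htT⟩, rfl⟩
      have h1 : ∫ s in (0 : ℝ)..t, u s ≤ ∫ s in (0 : ℝ)..t, A * Real.exp (2 * C * s) :=
        intervalIntegral.integral_mono_on ht (hint t ht htT)
          (Continuous.intervalIntegrable (by fun_prop) _ _)
          fun s hs => hA s hs.1 (hs.2.trans htT)
      rw [hI] at h1
      have h2 := h t ht htT
      have h3 : u t ≤ E + A / 2 * Real.exp (2 * C * t) - A / 2 := by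
        have : C * (A * ((Real.exp (2 * C * t) - 1) / (2 * C))) =
          A / 2 * Real.exp (2 * C * t) - A / 2 := by field_simp
        have h4 := mul_le_mul_of_nonneg_left h1 hC.le
        linarith
      have h5 : Real.exp (-(2 * C * t)) ≤ 1 := Real.exp_le_one_iff.2 (by
        have : 0 ≤ 2 * C * t := by positivity
        linarith)
      have h6 := Real.exp_pos (-(2 * C * t))
      calc u t * Real.exp (-(2 * C * t))
          ≤ (E + A / 2 * Real.exp (2 * C * t)) * Real.exp (-(2 * C * t)) := by gcongr; linarith
        _ = E * Real.exp (-(2 * C * t)) + A / 2 := by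
            rw [add_mul, mul_assoc (A / 2), ← Real.exp_add]; simp
        _ ≤ E * 1 + A / 2 := by gcongr
        _ = E + A / 2 := by ring
    linarith
  intro t ht htT
  exact (hA t ht htT).trans (by gcongr)

/-- Decay of a scalar linear equation with an exponentially decaying forcing term. -/
theorem abs_le_of_linear_integral_equation {y v : ℝ → ℝ} {μ a G : ℝ} (ha : a < μ)
    (hv : Continuous v) (hG : 0 ≤ G)
    (hy : ∀ t, 0 ≤ t → y t = y 0 - ∫ s in (0 : ℝ)..t, v s)
    (hb : ∀ t, 0 ≤ t → |v t - μ * y t| ≤ G * Real.exp (-a * t)) :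
    ∀ t, 0 ≤ t → |y t| ≤ (|y 0| + G / (μ - a)) * Real.exp (-a * t) := by
  have hμa : 0 < μ - a := sub_pos.2 ha
  have hder : ∀ t, 0 ≤ t → HasDerivWithinAt y (-v t) (Set.Ici t) t := by
    intro t ht
    have h1 : HasDerivAt (fun u => y 0 - ∫ s in (0 : ℝ)..u, v s) (-v t) t :=
      (hv.integral_hasStrictDerivAt 0 t).hasDerivAt.const_sub (y 0)
    exact h1.hasDerivWithinAt.congr (fun u hu => hy u (ht.trans hu)) (hy t ht)
  have hcont : ContinuousOn y (Set.Ici 0) := by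
    have h1 : Continuous fun u => y 0 - ∫ s in (0 : ℝ)..u, v s :=
      continuous_const.sub (intervalIntegral.continuous_primitive
        (fun a b => hv.intervalIntegrable a b) 0)
    exact h1.continuousOn.congr fun u hu => hy u hu
  intro t ht
  -- Multiply by the integrating factor `exp (μ * s)` and compare with the primitive of the forcing
  -- `G * exp ((μ - a) * s)`.
  have key := image_norm_le_of_norm_deriv_right_le_deriv_boundary
    (f := fun s => Real.exp (μ * s) * y s)
    (f' := fun s => Real.exp (μ * s) * μ * y s + Real.exp (μ * s) * (-v s))
    (a := 0) (b := t)
    (B := fun s => |y 0| + G / (μ - a) * (Real.exp ((μ - a) * s) - 1))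
    (B' := fun s => G * Real.exp ((μ - a) * s))
    ((Continuous.continuousOn (by fun_prop)).mul (hcont.mono fun s hs => hs.1))
    (fun s hs => by
      have h1 : HasDerivAt (fun s => Real.exp (μ * s)) (Real.exp (μ * s) * μ) s := by
        simpa using ((hasDerivAt_id s).const_mul μ).exp
      exact h1.hasDerivWithinAt.mul (hder s hs.1))
    (by simp)
    (fun s => by
      have h1 : HasDerivAt (fun s => Real.exp ((μ - a) * s)) (Real.exp ((μ - a) * s) * (μ - a)) s := by
        simpa using ((hasDerivAt_id s).const_mul (μ - a)).exp
      have h2 : G * Real.exp ((μ - a) * s) =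
          G / (μ - a) * (Real.exp ((μ - a) * s) * (μ - a)) := by
        field_simp
      rw [h2]
      exact ((h1.sub_const 1).const_mul (G / (μ - a))).const_add (|y 0|))
    (fun s hs => by
      have h1 : Real.exp (μ * s) * μ * y s + Real.exp (μ * s) * (-v s) =
        -(Real.exp (μ * s) * (v s - μ * y s)) := by ring
      rw [h1, norm_neg, norm_mul, Real.norm_eq_abs, Real.norm_eq_abs, Real.abs_exp]
      calc Real.exp (μ * s) * |v s - μ * y s| ≤ Real.exp (μ * s) * (G * Real.exp (-a * s)) := by
            gcongr; exact hb s hs.1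
        _ = G * (Real.exp (μ * s) * Real.exp (-a * s)) := by ring
        _ = _ := by rw [← Real.exp_add]; ring_nf)
    (x := t) ⟨ht, le_rfl⟩
  rw [norm_mul, Real.norm_eq_abs, Real.norm_eq_abs, Real.abs_exp] at key
  have hE : Real.exp (-a * t) = Real.exp ((μ - a) * t) / Real.exp (μ * t) := by
    rw [← Real.exp_sub]; ring_nf
  rw [hE, ← mul_div_assoc, le_div_iff₀ (Real.exp_pos _), mul_comm]
  refine key.trans ?_
  have h1 : 1 ≤ Real.exp ((μ - a) * t) := Real.one_le_exp (by positivity)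
  have h2 : 0 ≤ G / (μ - a) := by positivity
  nlinarith [abs_nonneg (y 0)]

/-! ### Local fluid models: exponential decay and existence -/

namespace Network

variable {m n : ℕ} {N : Network m n}

theorem abs_act_le (v : N.Vec) (e : N.Edge) : |v.act e| ≤ ‖v‖ :=
  PiLp.norm_apply_le v (Sum.inl e)

theorem abs_queue_le (v : N.Vec) (i : Fin (m + 1)) : |v.queue i| ≤ ‖v‖ :=
  PiLp.norm_apply_le v (Sum.inr i)

theorem norm_le_sum (v : N.Vec) : ‖v‖ ≤ ∑ e, |v.act e| + ∑ i, |v.queue i| := by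
  rw [EuclideanSpace.norm_eq]
  refine Real.sqrt_le_iff.2 ⟨by positivity, ?_⟩
  rw [Fintype.sum_sum_type]
  have h : ∀ {ι : Type} (s : Finset ι) (f : ι → ℝ), (∀ i ∈ s, 0 ≤ f i) →
      ∑ i ∈ s, f i ^ 2 ≤ (∑ i ∈ s, f i) ^ 2 := fun s f hf => Finset.sum_sq_le_sq_sum_of_nonneg hf
  have h1 := h Finset.univ (fun e => |v.act e|) fun _ _ => abs_nonneg _
  have h2 := h Finset.univ (fun i => |v.queue i|) fun _ _ => abs_nonneg _
  have h3 : 0 ≤ ∑ e, |v.act e| := by positivity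
  have h4 : 0 ≤ ∑ i, |v.queue i| := by positivity
  simp only [Real.norm_eq_abs]
  change ∑ e, |v.act e| ^ 2 + ∑ i, |v.queue i| ^ 2 ≤ _
  nlinarith

/-- One exponent strictly below every service rate avoids resonance, so the same exponential passes
through all levels of the tree without polynomial factors. -/
theorem Standing.exists_decay_rate (hN : N.Standing) : ∃ a, 0 < a ∧ ∀ e, a < N.rate e := by
  have : Nonempty N.Edge := ⟨hN.exists_root.choose⟩
  obtain ⟨e0, h⟩ := Finite.exists_min N.rate
  exact ⟨N.rate e0 / 2, half_pos (hN.rate_pos e0),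
    fun e => (half_lt_self (hN.rate_pos e0)).trans_le (h e)⟩

/-- Exponential stability on the invariant manifold. -/
theorem Standing.exists_decay (hN : N.Standing) : ∃ c₁ c₂ : ℝ, 0 < c₁ ∧ 0 < c₂ ∧
    ∀ f : ℝ → N.Vec, ContinuousOn f (Set.Ici 0) → (∀ t, 0 ≤ t → ∀ i, (f t).queue i = 0) →
    (∀ t, 0 ≤ t → ∀ i, N.classSum (f t).act i = N.classSum (f 0).act i -
      N.classSum (fun e => ∫ s in (0 : ℝ)..t, N.rate e * (f s).act e) i) →
    (∀ t, 0 ≤ t → ∀ j, j ≠ Fin.last n → N.poolSum (f t).act j = 0) →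
    ∀ t : ℝ, 0 ≤ t → ‖f t‖ ≤ ‖f 0‖ * c₁ * Real.exp (-c₂ * t) := by
  obtain ⟨a, ha0, ha⟩ := hN.exists_decay_rate
  have key : ∀ e, ∃ C : ℝ, 0 ≤ C ∧
    ∀ f : ℝ → N.Vec, ContinuousOn f (Set.Ici 0) → (∀ t, 0 ≤ t → ∀ i, (f t).queue i = 0) →
    (∀ t, 0 ≤ t → ∀ i, N.classSum (f t).act i = N.classSum (f 0).act i -
      N.classSum (fun e => ∫ s in (0 : ℝ)..t, N.rate e * (f s).act e) i) →
    (∀ t, 0 ≤ t → ∀ j, j ≠ Fin.last n → N.poolSum (f t).act j = 0) →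
    ∀ t : ℝ, 0 ≤ t → |(f t).act e| ≤ C * (‖f 0‖ * Real.exp (-a * t)) := by
    intro e
    induction e using hN.children_induction with
    | h e ih =>
      choose! C hC0 hC using ih
      by_cases hc : N.ClsLast e
      · have hCs : 0 ≤ ∑ e' ∈ N.children e, C e' := Finset.sum_nonneg hC0
        set H := ∑ e' ∈ N.children e, |N.rate e' - N.rate e| * C e' with hH
        have hH0 : 0 ≤ H := Finset.sum_nonneg fun e' he' => mul_nonneg (abs_nonneg _) (hC0 e' he')
        have hra : 0 < N.rate e - a := sub_pos.2 (ha e)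
        refine ⟨Fintype.card N.Edge + H / (N.rate e - a) + ∑ e' ∈ N.children e, C e',
          by positivity, fun f hf hq ht hp t ht0 => ?_⟩
        -- The trajectory is frozen at its initial value for negative times, to have a function
        -- continuous on the whole line.
        have hact : ∀ e', Continuous fun t => (f (max t 0)).act e' := by
          intro e'
          have h1 : Continuous fun t : ℝ => f (max t 0) :=
            hf.comp_continuous (by fun_prop) fun t => Set.mem_Ici.2 (le_max_right _ _)
          exact (PiLp.continuous_apply 2 _ (Sum.inl e')).comp h1
        set y : ℝ → ℝ := fun t => N.classSum (f t).act e.cls with hy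
        set v : ℝ → ℝ := fun t => N.classSum (fun e' => N.rate e' * (f (max t 0)).act e') e.cls
          with hv
        have h1 := abs_le_of_linear_integral_equation (y := y) (v := v) (G := H * ‖f 0‖) (ha e)
          (by
            simp only [hv, classSum]
            exact continuous_finsetSum _ fun e' _ => continuous_const.mul (hact e'))
          (by positivity)
          (by
            intro t ht0
            simp only [hy, hv]
            rw [ht t ht0]
            congr 1
            simp only [classSum]
            rw [intervalIntegral.integral_finsetSum (fun e' _ => Continuous.intervalIntegrable
              (u := fun s => N.rate e' * (f (max s 0)).act e')
              (continuous_const.mul (hact e')) _ _)]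
            refine Finset.sum_congr rfl fun e' _ => intervalIntegral.integral_congr fun s hs => ?_
            rw [Set.uIcc_of_le ht0] at hs
            simp only [max_eq_left hs.1])
          (by
            intro t ht0
            simp only [hy, hv, max_eq_left ht0, sum_children_cls hc]
            -- The outflow of the class is the rate of `e` times the class total, plus a forcing by
            -- the children only, which already decay.
            have : N.rate e * (f t).act e + ∑ e' ∈ N.children e, N.rate e' * (f t).act e' -
                N.rate e * ((f t).act e + ∑ e' ∈ N.children e, (f t).act e') =
                ∑ e' ∈ N.children e, (N.rate e' - N.rate e) * (f t).act e' := by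
              simp only [sub_mul, Finset.sum_sub_distrib, ← Finset.mul_sum]
              ring
            rw [this]
            refine (Finset.abs_sum_le_sum_abs _ _).trans ?_
            rw [hH, Finset.sum_mul, Finset.sum_mul]
            refine Finset.sum_le_sum fun e' he' => ?_
            rw [abs_mul, mul_assoc, mul_assoc]
            gcongr
            exact hC e' he' f hf hq ht hp t ht0) t ht0
        have h2 : |∑ e' ∈ N.children e, (f t).act e'| ≤
            (∑ e' ∈ N.children e, C e') * (‖f 0‖ * Real.exp (-a * t)) := by
          refine (Finset.abs_sum_le_sum_abs _ _).trans ?_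
          rw [Finset.sum_mul]
          exact Finset.sum_le_sum fun e' he' => hC e' he' f hf hq ht hp t ht0
        have h3 : |y 0| ≤ Fintype.card N.Edge * ‖f 0‖ := by
          simp only [hy, classSum]
          refine (Finset.abs_sum_le_sum_abs _ _).trans ?_
          refine (Finset.sum_le_card_nsmul _ _ ‖f 0‖ fun e' _ => abs_act_le _ _).trans ?_
          rw [nsmul_eq_mul]
          gcongr
          exact Finset.card_le_univ _
        have h4 : (f t).act e = y t - ∑ e' ∈ N.children e, (f t).act e' := by
          simp only [hy, sum_children_cls hc]
          ring
        rw [h4]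
        calc |y t - ∑ e' ∈ N.children e, (f t).act e'|
            ≤ |y t| + |∑ e' ∈ N.children e, (f t).act e'| := abs_sub _ _
          _ ≤ (Fintype.card N.Edge * ‖f 0‖ + H * ‖f 0‖ / (N.rate e - a)) * Real.exp (-a * t) +
              (∑ e' ∈ N.children e, C e') * (‖f 0‖ * Real.exp (-a * t)) := by
            refine add_le_add (h1.trans ?_) h2
            gcongr
          _ = _ := by ring
      · refine ⟨∑ e' ∈ N.children e, C e', Finset.sum_nonneg hC0, fun f hf hq ht hp t ht0 => ?_⟩
        have h1 := sum_children_pool hc (f t).act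
        rw [hp t ht0 _ (hN.pool_ne_last hc)] at h1
        have h2 : (f t).act e = -∑ e' ∈ N.children e, (f t).act e' := by linarith
        rw [h2, abs_neg, Finset.sum_mul]
        exact (Finset.abs_sum_le_sum_abs _ _).trans
          (Finset.sum_le_sum fun e' he' => hC e' he' f hf hq ht hp t ht0)
  choose C hC0 hC using key
  refine ⟨∑ e, C e + 1, a, by have := Finset.sum_nonneg fun e (_ : e ∈ Finset.univ) => hC0 e
                              linarith, ha0, fun f hf hq ht hp t ht0 => ?_⟩
  refine (norm_le_sum _).trans ?_
  have h1 : ∑ i, |(f t).queue i| = 0 := Finset.sum_eq_zero fun i _ => by rw [hq t ht0 i, abs_zero]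
  have h2 : ∑ e, |(f t).act e| ≤ (∑ e, C e) * (‖f 0‖ * Real.exp (-a * t)) := by
    rw [Finset.sum_mul]
    exact Finset.sum_le_sum fun e _ => hC e f hf hq ht hp t ht0
  have h3 : 0 ≤ ‖f 0‖ * Real.exp (-a * t) := by positivity
  rw [h1]
  linarith

/-- The generator of the dynamics on the invariant manifold. -/
noncomputable def Standing.generator (hN : N.Standing) : N.Vec →L[ℝ] N.Vec :=
  LinearMap.toContinuousLinearMap
    { toFun := fun v => -hN.relax (WithLp.toLp 2 (Sum.elim (fun e => N.rate e * v.act e) 0))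
      map_add' := fun v w => by
        rw [← neg_add, ← map_add]
        congr 2
        ext x
        rcases x with e | i <;> simp [Vec.act, mul_add]
      map_smul' := fun a v => by
        rw [RingHom.id_apply, smul_neg, ← map_smul]
        congr 2
        ext x
        rcases x with e | i <;> simp [Vec.act, mul_left_comm] }

theorem Standing.generator_apply (hN : N.Standing) (v : N.Vec) : hN.generator v =
    -hN.relax (WithLp.toLp 2 (Sum.elim (fun e => N.rate e * v.act e) 0)) := rfl

theorem classSum_neg_act (v : N.Vec) (i : Fin (m + 1)) :
    N.classSum (-v).act i = -N.classSum v.act i := by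
  simp [classSum, Vec.act]

theorem poolSum_neg_act (v : N.Vec) (j : Fin (n + 1)) :
    N.poolSum (-v).act j = -N.poolSum v.act j := by
  simp [poolSum, Vec.act]

theorem act_add (v w : N.Vec) : (v + w).act = v.act + w.act := rfl

/-- The exponential flow of the generator applied to the relaxed state. In integral form it is a
relaxed vector plus a value of the generator, so its queues and its pool totals other than the last
vanish. The class totals satisfy the fluid equation because relaxation preserves them. -/
theorem Standing.exists_localFluidModel (hN : N.Standing) (f0 : N.Vec) :
    ∃ f : ℝ → N.Vec, N.IsLocalFluidModel f ∧ f 0 = hN.relax f0 := by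
  set f : ℝ → N.Vec := fun t => NormedSpace.exp (t • hN.generator) (hN.relax f0) with hf
  have hder : ∀ t, HasDerivAt f (hN.generator (f t)) t := by
    intro t
    have h1 := hasDerivAt_exp_smul_const' (𝕂 := ℝ) hN.generator t
    have h2 := h1.clm_apply (hasDerivAt_const t (hN.relax f0))
    simpa using h2
  have hf0 : f 0 = hN.relax f0 := by simp [hf, zero_smul ℝ hN.generator]
  have hcont : Continuous f := continuous_iff_continuousAt.2 fun t => (hder t).continuousAt
  have hint : ∀ t, f t = hN.relax f0 + hN.generator (∫ s in (0 : ℝ)..t, f s) := by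
    intro t
    rw [← ContinuousLinearMap.intervalIntegral_comp_comm _ (hcont.intervalIntegrable _ _),
      intervalIntegral.integral_eq_sub_of_hasDerivAt (fun s _ => hder s)
        ((hN.generator.continuous.comp hcont).intervalIntegrable _ _), hf0]
    abel
  have hr0 := hN.isRelaxation_relax f0
  have hq : ∀ t, 0 ≤ t → ∀ i, (f t).queue i = 0 := by
    intro t _ i
    rw [hint t, hN.generator_apply]
    have h1 := (hN.isRelaxation_relax (WithLp.toLp 2
      (Sum.elim (fun e => N.rate e * (∫ s in (0 : ℝ)..t, f s : N.Vec).act e) 0))).queue i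
    have h2 := hr0.queue i
    simp only [Vec.queue, PiLp.add_apply, PiLp.neg_apply] at h1 h2 ⊢
    rw [h1, h2]
    simp
  have hp : ∀ t, 0 ≤ t → ∀ j, j ≠ Fin.last n → N.poolSum (f t).act j = 0 := by
    intro t _ j hj
    rw [hint t, hN.generator_apply, act_add, poolSum_add, poolSum_neg_act, hr0.pools j hj,
      (hN.isRelaxation_relax _).pools j hj]
    simp
  have ht : ∀ t, 0 ≤ t → ∀ i, N.classSum (f t).act i = N.classSum (f 0).act i -
      N.classSum (fun e => ∫ s in (0 : ℝ)..t, N.rate e * (f s).act e) i := by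
    intro t _ i
    rw [hint t, hN.generator_apply, act_add, classSum_add, classSum_neg_act, hf0,
      ← (hN.isRelaxation_relax (WithLp.toLp 2
      (Sum.elim (fun e => N.rate e * (∫ s in (0 : ℝ)..t, f s : N.Vec).act e) 0))).total i,
      sub_eq_add_neg]
    congr 2
    have h1 : ∀ e : N.Edge, ∫ s in (0 : ℝ)..t, N.rate e * (f s).act e =
        N.rate e * (∫ s in (0 : ℝ)..t, f s : N.Vec).act e := by
      intro e
      rw [intervalIntegral.integral_const_mul]
      congr 1
      exact ContinuousLinearMap.intervalIntegral_comp_comm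
        (EuclideanSpace.proj (𝕜 := ℝ) (Sum.inl e : N.Edge ⊕ Fin (m + 1)))
        (hcont.intervalIntegrable _ _)
    simp only [h1]
    simp only [Vec.queue, Sum.elim_inr, Pi.zero_apply, add_zero]
    rfl
  refine ⟨f, ⟨?_, hq, ht, hp⟩, hf0⟩
  -- The decay estimate assumes only continuity, so it applies before the Lipschitz property is
  -- known. It bounds the trajectory, hence its derivative, on the whole half-line.
  obtain ⟨c₁, c₂, hc₁, hc₂, hdecay⟩ := hN.exists_decay
  have hb : ∀ t, 0 ≤ t → ‖f t‖ ≤ ‖f 0‖ * c₁ := by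
    intro t ht0
    refine (hdecay f hcont.continuousOn hq ht hp t ht0).trans ?_
    refine mul_le_of_le_one_right (by positivity) (Real.exp_le_one_iff.2 ?_)
    nlinarith
  refine ⟨(‖hN.generator‖ * (‖f 0‖ * c₁)).toNNReal, ?_⟩
  refine Convex.lipschitzOnWith_of_nnnorm_hasDerivWithin_le (f' := fun t => hN.generator (f t))
    (convex_Ici 0)
    (fun t _ => (hder t).hasDerivWithinAt) fun t ht0 => ?_
  rw [← NNReal.coe_le_coe, coe_nnnorm, Real.coe_toNNReal _ (by positivity)]
  exact (hN.generator.le_opNorm _).trans (by gcongr; exact hb t ht0)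

/-! ### Controlled realizations and the fast collapse of deficits -/

theorem scaled_act (r h : ℝ) (x : N.State) (e : N.Edge) :
    (N.scaled r h x).act e = h⁻¹ * ((x.Psi e : ℝ) - r * N.psiStar e) := rfl

theorem scaled_queue (r h : ℝ) (x : N.State) (i : Fin (m + 1)) :
    (N.scaled r h x).queue i = h⁻¹ * (x.Q i : ℝ) := rfl

theorem abs_classSum_le {x y : N.Edge → ℝ} (h : ∀ e, |x e| ≤ y e) (i : Fin (m + 1)) :
    |N.classSum x i| ≤ ∑ e, y e :=
  (Finset.abs_sum_le_sum_abs _ _).trans <| (Finset.sum_le_sum fun e _ => h e).trans <|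
    Finset.sum_le_univ_sum_of_nonneg fun e => (abs_nonneg _).trans (h e)

theorem abs_poolSum_le {x y : N.Edge → ℝ} (h : ∀ e, |x e| ≤ y e) (j : Fin (n + 1)) :
    |N.poolSum x j| ≤ ∑ e, y e :=
  (Finset.abs_sum_le_sum_abs _ _).trans <| (Finset.sum_le_sum fun e _ => h e).trans <|
    Finset.sum_le_univ_sum_of_nonneg fun e => (abs_nonneg _).trans (h e)

theorem poolSum_scaled (r h : ℝ) (x : N.State) (j : Fin (n + 1)) :
    N.poolSum (N.scaled r h x).act j =
      h⁻¹ * ((N.poolSum x.Psi j : ℕ) - r * N.poolSum N.psiStar j) := by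
  simp only [poolSum, scaled_act, ← Finset.mul_sum, Finset.sum_sub_distrib, Nat.cast_sum]

theorem classSum_scaled (r h : ℝ) (x : N.State) (i : Fin (m + 1)) :
    N.classSum (N.scaled r h x).act i =
      h⁻¹ * ((N.classSum x.Psi i : ℕ) - r * N.classSum N.psiStar i) := by
  simp only [classSum, scaled_act, ← Finset.mul_sum, Finset.sum_sub_distrib, Nat.cast_sum]

theorem Standing.classSum_eqRate (hN : N.Standing) (i : Fin (m + 1)) :
    N.classSum N.eqRate i = N.lam i := by
  rw [hN.feasibleOcc_psiStar.demand i]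
  simp only [psiStar_mul_rate hN]

/-- The quantitative conditions on a realization up to time `τ`: the fluctuations of arrivals and
departures on the scale `h` are at most `η`, and the scaled occupancies are at most `B`. -/
structure Controlled (N : Network m n) (r h : ℝ) (X : ℝ → N.State) (η B τ : ℝ) : Prop where
  realization : N.IsRealization r X
  r_pos : 0 < r
  one_le_h : 1 ≤ h
  eta_nonneg : 0 ≤ η
  card_le : (Fintype.card N.Edge : ℝ) * h⁻¹ ≤ η
  one_le_B : 1 ≤ B
  arrivals : ∀ i t, 0 ≤ t → t ≤ τ → |h⁻¹ * (((X t).A i : ℝ) - N.lam i * r * t)| ≤ η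
  departures : ∀ e t, 0 ≤ t → t ≤ τ →
    |h⁻¹ * (((X t).D e : ℝ) - N.rate e * ∫ s in (0 : ℝ)..t, ((X s).Psi e : ℝ))| ≤ η
  bounded : ∀ e t, 0 ≤ t → t ≤ τ → |(N.scaled r h (X t)).act e| ≤ B

namespace Controlled

variable {r h η B τ : ℝ} {X : ℝ → N.State}

theorem h_pos (H : N.Controlled r h X η B τ) : 0 < h := one_pos.trans_le H.one_le_h

theorem intervalIntegrable (H : N.Controlled r h X η B τ) (e : N.Edge) {s t : ℝ} (hs : 0 ≤ s)
    (ht : 0 ≤ t) : IntervalIntegrable (fun u => (N.scaled r h (X u)).act e)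
      MeasureTheory.volume s t := by
  simp only [scaled_act]
  exact ((H.realization.intervalIntegrable e hs ht).sub intervalIntegrable_const).const_mul _

/-- Splits the expected completions into the large equilibrium drift, of order `r / h`, and the
fluid-scale part. -/
theorem integral_Psi (H : N.Controlled r h X η B τ) (hN : N.Standing) (e : N.Edge) {s t : ℝ}
    (hs : 0 ≤ s) (ht : 0 ≤ t) :
    h⁻¹ * (N.rate e * ∫ u in s..t, ((X u).Psi e : ℝ)) =
      r / h * N.eqRate e * (t - s) +
        N.rate e * ∫ u in s..t, (N.scaled r h (X u)).act e := by
  simp only [scaled_act]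
  rw [intervalIntegral.integral_const_mul, intervalIntegral.integral_sub
    (H.realization.intervalIntegrable e hs ht) intervalIntegrable_const,
    intervalIntegral.integral_const, ← psiStar_mul_rate hN, smul_eq_mul, div_eq_mul_inv]
  ring

theorem departures_sub (H : N.Controlled r h X η B τ) (hN : N.Standing) (e : N.Edge) {s t : ℝ}
    (hs : 0 ≤ s) (hst : s ≤ t) (ht : t ≤ τ) :
    |h⁻¹ * (((X t).D e : ℝ) - (X s).D e) - r / h * N.eqRate e * (t - s)| ≤
      2 * η + N.rate e * B * (t - s) := by
  have h1 := H.departures e s hs (hst.trans ht)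
  have h2 := H.departures e t (hs.trans hst) ht
  have h3 := H.integral_Psi hN e hs (hs.trans hst)
  rw [← intervalIntegral.integral_interval_sub_left
    (H.realization.intervalIntegrable e le_rfl (hs.trans hst))
    (H.realization.intervalIntegrable e le_rfl hs)] at h3
  have h4 : |∫ u in s..t, (N.scaled r h (X u)).act e| ≤ B * (t - s) := by
    have := intervalIntegral.norm_integral_le_of_norm_le_const (a := s) (b := t) (C := B)
      (f := fun u => (N.scaled r h (X u)).act e) (fun u hu => by
        rw [Set.uIoc_of_le hst] at hu
        exact H.bounded e u (hs.trans hu.1.le) (hu.2.trans ht))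
    rwa [abs_of_nonneg (sub_nonneg.2 hst)] at this
  have h5 : |N.rate e * ∫ u in s..t, (N.scaled r h (X u)).act e| ≤ N.rate e * B * (t - s) := by
    rw [abs_mul, abs_of_pos (hN.rate_pos e), mul_assoc]
    gcongr
    exact (hN.rate_pos e).le
  rw [abs_le] at *
  constructor <;> linarith [h1.1, h1.2, h2.1, h2.2, h5.1, h5.2]

theorem conservation (H : N.Controlled r h X η B τ) (i : Fin (m + 1)) {s t : ℝ} (hs : 0 ≤ s)
    (ht : 0 ≤ t) :
    (N.classSum (N.scaled r h (X t)).act i - N.classSum (N.scaled r h (X s)).act i) +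
      ((N.scaled r h (X t)).queue i - (N.scaled r h (X s)).queue i) =
      h⁻¹ * (((X t).A i : ℝ) - (X s).A i) -
        N.classSum (fun e => h⁻¹ * (((X t).D e : ℝ) - (X s).D e)) i := by
  have h1 : ((N.classSum (X t).Psi i + (X t).Q i + N.classSum (X t).D i : ℕ) : ℝ) =
      ((N.classSum (X 0).Psi i + (X 0).Q i + (X t).A i : ℕ) : ℝ) :=
    congrArg _ (H.realization.conservation t ht i)
  have h2 : ((N.classSum (X s).Psi i + (X s).Q i + N.classSum (X s).D i : ℕ) : ℝ) =
      ((N.classSum (X 0).Psi i + (X 0).Q i + (X s).A i : ℕ) : ℝ) :=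
    congrArg _ (H.realization.conservation s hs i)
  have h3 : N.classSum (fun e => h⁻¹ * (((X t).D e : ℝ) - (X s).D e)) i =
      h⁻¹ * (((N.classSum (X t).D i : ℕ) : ℝ) - (N.classSum (X s).D i : ℕ)) := by
    simp only [classSum, ← Finset.mul_sum, Finset.sum_sub_distrib, Nat.cast_sum]
  rw [h3, classSum_scaled, classSum_scaled, scaled_queue, scaled_queue]
  push_cast at h1 h2
  have h4 : ((N.classSum (X t).Psi i : ℕ) : ℝ) + (X t).Q i + (N.classSum (X t).D i : ℕ) -
      ((N.classSum (X s).Psi i : ℕ) + (X s).Q i + (N.classSum (X s).D i : ℕ)) =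
      (X t).A i - (X s).A i := by linarith
  linear_combination h⁻¹ * h4

end Controlled

/-- Scaled deficits. -/
noncomputable def scaledOwn (N : Network m n) (r h : ℝ) (e : N.Edge) (x : N.State) : ℝ :=
  h⁻¹ * N.own (N.capacity r) e x

theorem sum_children_scaledOwn (r h : ℝ) (e : N.Edge) (x : N.State) :
    ∑ e' ∈ N.children e, N.scaledOwn r h e' x = h⁻¹ * (N.gap (N.capacity r) e x : ℕ) := by
  simp only [scaledOwn, gap, Nat.cast_sum, Finset.mul_sum]

theorem scaledOwn_cls {r h : ℝ} {e : N.Edge} (hc : N.ClsLast e) (x : N.State) :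
    N.scaledOwn r h e x = (N.scaled r h x).queue e.cls := by
  rw [scaledOwn, own_cls hc, scaled_queue]

/-- The equilibrium fills the pool, so its idleness is minus the deviation of its total, up to the
rounding of the number of servers. -/
theorem scaledOwn_pool {r h : ℝ} (hN : N.Standing) {e : N.Edge} (hc : ¬ N.ClsLast e) {x : N.State}
    (hx : N.Legit (N.capacity r) x) :
    N.scaledOwn r h e x = -N.poolSum (N.scaled r h x).act e.pool -
      h⁻¹ * (r * N.beta e.pool - N.capacity r e.pool) := by
  rw [scaledOwn, own_pool hc, poolSum_scaled, hN.poolSum_psiStar _ (hN.pool_ne_last hc),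
    Nat.cast_sub (hx.cap_le _)]
  ring

theorem capacity_le {r : ℝ} (hN : N.Standing) (hr : 0 < r) (j : Fin (n + 1)) :
    (N.capacity r j : ℝ) ≤ r * N.beta j :=
  Nat.floor_le (mul_pos hr (hN.beta_pos j)).le

theorem lt_capacity_add_one {r : ℝ} (j : Fin (n + 1)) :
    r * N.beta j < N.capacity r j + 1 := Nat.lt_floor_add_one _

theorem scaledOwn_le {r h : ℝ} (hN : N.Standing) (hr : 0 < r) (hh : 0 < h) (e : N.Edge)
    {x : N.State} (hx : N.Legit (N.capacity r) x) :
    N.scaledOwn r h e x ≤ (Fintype.card N.Edge) * ‖N.scaled r h x‖ := by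
  have hcard : (1 : ℝ) ≤ Fintype.card N.Edge := by
    exact_mod_cast Fintype.card_pos_iff.2 ⟨e⟩
  by_cases hc : N.ClsLast e
  · rw [scaledOwn_cls hc]
    have h1 := (le_abs_self _).trans (abs_queue_le (N.scaled r h x) e.cls)
    nlinarith [norm_nonneg (N.scaled r h x)]
  · rw [scaledOwn_pool hN hc hx]
    have h1 := abs_poolSum_le (abs_act_le (N.scaled r h x)) e.pool
    rw [Finset.sum_const, Finset.card_univ, nsmul_eq_mul] at h1
    have h2 : 0 ≤ h⁻¹ * (r * N.beta e.pool - N.capacity r e.pool) :=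
      mul_nonneg (inv_nonneg.2 hh.le) (sub_nonneg.2 (capacity_le hN hr _))
    linarith [neg_abs_le (N.poolSum (N.scaled r h x).act e.pool)]

namespace Controlled

variable {r h η B τ : ℝ} {X : ℝ → N.State}

/-- For a class, the drifts of order `r / h` of arrivals and completions cancel because the
equilibrium rates sum to the arrival rate. For a pool, busy plus idle servers are constant, so the
left side is exactly zero. -/
theorem balance (H : N.Controlled r h X η B τ) (hN : N.Standing) (e : N.Edge) {s t : ℝ}
    (hs : 0 ≤ s) (hst : s ≤ t) (htτ : t ≤ τ) :
    |((N.scaled r h (X t)).act e - (N.scaled r h (X s)).act e) +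
      (N.scaledOwn r h e (X t) - N.scaledOwn r h e (X s)) +
      ∑ e' ∈ N.children e, ((N.scaled r h (X t)).act e' - (N.scaled r h (X s)).act e')| ≤
      (∑ e, N.rate e) * B * (t - s) + (3 + 2 * (Fintype.card N.Edge : ℝ)) * η := by
  have hη := H.eta_nonneg
  have hlegit := H.realization.legit
  have hB0 : 0 ≤ B := zero_le_one.trans H.one_le_B
  have hR0 : 0 ≤ ∑ e, N.rate e := Finset.sum_nonneg fun e _ => (hN.rate_pos e).le
  set C : ℝ := (Fintype.card N.Edge : ℝ) with hC
  have hC0 : 0 ≤ C := Nat.cast_nonneg _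
  set R : ℝ := ∑ e, N.rate e with hR
  have hts : 0 ≤ t - s := sub_nonneg.2 hst
  by_cases hc : N.ClsLast e
  · have h1 := H.conservation e.cls hs (hs.trans hst)
    have h2 := abs_classSum_le (fun e => H.departures_sub hN e hs hst htτ) e.cls
    have h3 : N.classSum (fun e => h⁻¹ * (((X t).D e : ℝ) - (X s).D e) -
        r / h * N.eqRate e * (t - s)) e.cls =
        N.classSum (fun e => h⁻¹ * (((X t).D e : ℝ) - (X s).D e)) e.cls -
          r / h * N.lam e.cls * (t - s) := by
      rw [← hN.classSum_eqRate]
      simp only [classSum, Finset.sum_sub_distrib, Finset.mul_sum, Finset.sum_mul]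
    have h4 : ∑ e, (2 * η + N.rate e * B * (t - s)) = 2 * C * η + R * B * (t - s) := by
      rw [Finset.sum_add_distrib, Finset.sum_const, Finset.card_univ, nsmul_eq_mul, hR,
        Finset.sum_mul, Finset.sum_mul]
      ring
    rw [h3, h4] at h2
    have h5 := H.arrivals e.cls t (hs.trans hst) htτ
    have h6 := H.arrivals e.cls s hs (hst.trans htτ)
    have h7 : h⁻¹ * (((X t).A e.cls : ℝ) - N.lam e.cls * r * t) -
        h⁻¹ * (((X s).A e.cls : ℝ) - N.lam e.cls * r * s) =
        h⁻¹ * (((X t).A e.cls : ℝ) - (X s).A e.cls) - r / h * N.lam e.cls * (t - s) := by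
      rw [div_eq_mul_inv]; ring
    have h8 : ((N.scaled r h (X t)).act e - (N.scaled r h (X s)).act e) +
        (N.scaledOwn r h e (X t) - N.scaledOwn r h e (X s)) +
        ∑ e' ∈ N.children e, ((N.scaled r h (X t)).act e' - (N.scaled r h (X s)).act e') =
        h⁻¹ * (((X t).A e.cls : ℝ) - (X s).A e.cls) -
          N.classSum (fun e => h⁻¹ * (((X t).D e : ℝ) - (X s).D e)) e.cls := by
      rw [← h1, sum_children_cls hc, sum_children_cls hc, scaledOwn_cls hc, scaledOwn_cls hc,
        Finset.sum_sub_distrib]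
      ring
    rw [h8]
    rw [abs_le] at *
    constructor <;> linarith [h2.1, h2.2, h5.1, h5.2, h6.1, h6.2]
  · have h8 : ((N.scaled r h (X t)).act e - (N.scaled r h (X s)).act e) +
        (N.scaledOwn r h e (X t) - N.scaledOwn r h e (X s)) +
        ∑ e' ∈ N.children e, ((N.scaled r h (X t)).act e' - (N.scaled r h (X s)).act e') =
        0 := by
      rw [scaledOwn_pool hN hc (hlegit s hs), scaledOwn_pool hN hc (hlegit t (hs.trans hst)),
        sum_children_pool hc, sum_children_pool hc, Finset.sum_sub_distrib]
      ring
    rw [h8, abs_zero]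
    positivity

/-- With no service starts after `σ`, the occupancy of `e` changes only by completions, which run at
least at speed `r / h * ν` up to the error terms. -/
theorem exists_last_exit (H : N.Controlled r h X η B τ) (hN : N.Standing) (e : N.Edge) {ν : ℝ}
    (hν : ν ≤ N.eqRate e) {t : ℝ} (ht : 0 ≤ t) (htτ : t ≤ τ) :
    ∃ σ, 0 ≤ σ ∧ σ ≤ t ∧ (σ = 0 ∨ ∑ e' ∈ N.children e, N.scaledOwn r h e' (X σ) ≤
        (3 + 2 * (Fintype.card N.Edge : ℝ)) * η) ∧
      (N.scaled r h (X t)).act e - (N.scaled r h (X σ)).act e ≤ -(r / h * ν) * (t - σ) +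
        (∑ e, N.rate e) * B * (t - σ) + (3 + 2 * (Fintype.card N.Edge : ℝ)) * η := by
  have hη := H.eta_nonneg
  have hh := H.h_pos
  have hrh : 0 < r / h := div_pos H.r_pos hh
  have hB0 : 0 ≤ B := zero_le_one.trans H.one_le_B
  set C : ℝ := (Fintype.card N.Edge : ℝ) with hC
  have hC0 : 0 ≤ C := Nat.cast_nonneg _
  set R : ℝ := ∑ e, N.rate e with hR
  obtain ⟨σ, hσ0, hσt, h1, h2⟩ := H.realization.exists_last_exit hN e t ht
  refine ⟨σ, hσ0, hσt, h1.imp_right fun h1 => ?_, ?_⟩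
  · have h3 : ∑ e' ∈ N.children e, N.scaledOwn r h e' (X σ) =
        h⁻¹ * (N.gap (N.capacity r) e (X σ) : ℕ) := by
      simp only [scaledOwn, gap, Nat.cast_sum, Finset.mul_sum]
    rw [h3]
    calc h⁻¹ * (N.gap (N.capacity r) e (X σ) : ℕ) ≤ h⁻¹ * C := by
          gcongr; rw [hC]; exact_mod_cast h1
      _ = C * h⁻¹ := mul_comm _ _
      _ ≤ η := H.card_le
      _ ≤ _ := by nlinarith
  · have h3 : ((X t).Psi e : ℝ) + (X t).D e = (X σ).Psi e + (X σ).D e := by exact_mod_cast h2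
    have h4 : (N.scaled r h (X t)).act e - (N.scaled r h (X σ)).act e =
        -(h⁻¹ * (((X t).D e : ℝ) - (X σ).D e)) := by
      rw [scaled_act, scaled_act]
      linear_combination h⁻¹ * h3
    rw [h4]
    have h5 := (abs_le.1 (H.departures_sub hN e hσ0 hσt htτ)).1
    have hts : 0 ≤ t - σ := sub_nonneg.2 hσt
    have h6 : r / h * ν * (t - σ) ≤ r / h * N.eqRate e * (t - σ) := by
      gcongr
    have h7 : N.rate e * B * (t - σ) ≤ R * B * (t - σ) := by
      gcongr
      exact Finset.single_le_sum (f := N.rate) (fun e _ => (hN.rate_pos e).le)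
        (Finset.mem_univ e)
    nlinarith

theorem own_eq_zero (H : N.Controlled r h X η B τ) (hN : N.Standing) (e : N.Edge) {t : ℝ}
    (ht : 0 ≤ t) (hpos : 0 < ∑ e' ∈ N.children e, N.scaledOwn r h e' (X t)) :
    N.scaledOwn r h e (X t) = 0 := by
  have hh := H.h_pos
  have hlegit := H.realization.legit
  rw [sum_children_scaledOwn] at hpos
  have h4 : 0 < N.gap (N.capacity r) e (X t) := by
    have := pos_of_mul_pos_right hpos (inv_nonneg.2 hh.le)
    exact_mod_cast this
  rw [scaledOwn, hN.own_eq_zero (hlegit t ht) h4, Nat.cast_zero, mul_zero]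

theorem sum_own_zero_le (H : N.Controlled r h X η B τ) (hN : N.Standing) (e : N.Edge) :
    ∑ e' ∈ N.children e, N.scaledOwn r h e' (X 0) ≤
      (Fintype.card N.Edge : ℝ) * (Fintype.card N.Edge) * ‖N.scaled r h (X 0)‖ := by
  have hh := H.h_pos
  have hr := H.r_pos
  have hlegit := H.realization.legit
  set C : ℝ := (Fintype.card N.Edge : ℝ) with hC
  have hS := norm_nonneg (N.scaled r h (X 0))
  calc ∑ e' ∈ N.children e, N.scaledOwn r h e' (X 0)
      ≤ ∑ _e' ∈ N.children e, C * ‖N.scaled r h (X 0)‖ :=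
        Finset.sum_le_sum fun e' _ => scaledOwn_le hN hr hh e' (hlegit 0 le_rfl)
    _ = (N.children e).card * (C * ‖N.scaled r h (X 0)‖) := by
        rw [Finset.sum_const, nsmul_eq_mul]
    _ ≤ C * (C * ‖N.scaled r h (X 0)‖) := by
        gcongr; rw [hC]; exact_mod_cast Finset.card_le_univ _
    _ = C * C * ‖N.scaled r h (X 0)‖ := by ring


/-- The equilibrium slack of the last pool is of order `r`, while deviations are at most of order `h
* B`, so this pool always has an idle server. -/
theorem poolSum_last_lt (H : N.Controlled r h X η B τ) {d : ℝ}
    (hd : d = N.beta (Fin.last n) - N.poolSum N.psiStar (Fin.last n)) (hd0 : 0 < d)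
    (hB : ((Fintype.card N.Edge : ℝ) + 1) / d * B ≤ r / h) {t : ℝ} (ht : 0 ≤ t) (htτ : t ≤ τ) :
    N.poolSum (X t).Psi (Fin.last n) < N.capacity r (Fin.last n) := by
  have hh := H.h_pos
  have h1 := abs_poolSum_le (fun e => H.bounded e t ht htτ) (Fin.last n)
  rw [Finset.sum_const, Finset.card_univ, nsmul_eq_mul, poolSum_scaled] at h1
  have h2 := (abs_le.1 h1).2
  rw [inv_mul_le_iff₀ hh] at h2
  have h3 := lt_capacity_add_one (N := N) (r := r) (Fin.last n)
  rw [le_div_iff₀ hh, div_mul_eq_mul_div, div_mul_eq_mul_div, div_le_iff₀ hd0] at hB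
  have h5 : 1 ≤ B * h := one_le_mul_of_one_le_of_one_le H.one_le_B H.one_le_h
  have h6 : ((N.poolSum (X t).Psi (Fin.last n) : ℕ) : ℝ) < N.capacity r (Fin.last n) := by
    rw [hd] at hB
    linarith
  exact_mod_cast h6

end Controlled

/-- Queues and deviations of the pool totals (of all pools but the last) stay bounded, and become
small after a short time. -/
theorem Standing.exists_deficit_bound (hN : N.Standing) : ∃ Γ c : ℝ, 1 ≤ Γ ∧ 0 < c ∧
    ∀ (r h η B τ : ℝ) (X : ℝ → N.State), N.Controlled r h X η B τ → Γ * B ≤ r / h →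
      ∀ t, 0 ≤ t → t ≤ τ →
        (∀ i, |(N.scaled r h (X t)).queue i| ≤
          Γ * (max (Γ * ‖N.scaled r h (X 0)‖ - c * (r / h) * t) 0 + η)) ∧
        (∀ j, j ≠ Fin.last n → |N.poolSum (N.scaled r h (X t)).act j| ≤
          Γ * (max (Γ * ‖N.scaled r h (X 0)‖ - c * (r / h) * t) 0 + η)) := by
  obtain ⟨Γ, c, hΓ, hc0, hgap⟩ := exists_gap_bound N.rank N.children
    (fun _ _ h => hN.rank_lt_of_mem_children h)
  obtain ⟨e0, -⟩ := hN.exists_root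
  have : Nonempty N.Edge := ⟨e0⟩
  obtain ⟨e1, he1⟩ := Finite.exists_min N.eqRate
  set ν := N.eqRate e1 with hν
  have hν0 : 0 < ν := by
    rw [hν, ← psiStar_mul_rate hN]
    exact mul_pos (hN.rate_pos _) (hN.psiStar_pos _)
  set C : ℝ := (Fintype.card N.Edge : ℝ) with hC
  have hC1 : 1 ≤ C := by
    rw [hC]; exact_mod_cast Fintype.card_pos_iff.2 this
  set R : ℝ := ∑ e, N.rate e with hR
  have hR0 : 0 ≤ R := Finset.sum_nonneg fun e _ => (hN.rate_pos e).le
  set d := N.beta (Fin.last n) - N.poolSum N.psiStar (Fin.last n) with hd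
  have hd0 : 0 < d := sub_pos.2 hN.feasibleOcc_psiStar.slack
  have hn1 : 0 ≤ Γ * (3 + 2 * C) := by positivity
  have hn2 : 0 ≤ C * C := by positivity
  have hn3 : 0 ≤ Γ * R / ν := by positivity
  have hn4 : 0 ≤ (C + 1) / d := by positivity
  -- The first two terms give the final estimate, `C * C` bounds the initial gaps, `Γ * R / ν` makes
  -- the drain dominate the drift, and `(C + 1) / d` keeps the last pool from filling.
  set Γ' := Γ * (3 + 2 * C) + 1 + C * C + Γ * R / ν + (C + 1) / d with hΓ'
  refine ⟨Γ', c * ν, by linarith, by positivity, fun r h η B τ X H hB t ht htτ => ?_⟩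
  have hh := H.h_pos
  have hr := H.r_pos
  have hrh : 0 < r / h := div_pos hr hh
  have hB0 : 0 ≤ B := zero_le_one.trans H.one_le_B
  have hη := H.eta_nonneg
  have hlegit := H.realization.legit
  have hg := hgap (fun e t => (N.scaled r h (X t)).act e) (fun e t => N.scaledOwn r h e (X t)) τ
    (R * B) ((3 + 2 * C) * η) (r / h * ν) (Γ' * ‖N.scaled r h (X 0)‖)
    (by positivity) (by positivity) (by positivity) (by positivity)
    (by
      have h1 : Γ * R / ν * B ≤ r / h := le_trans (by gcongr; linarith) hB
      calc Γ * (R * B) = Γ * R / ν * B * ν := by field_simp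
        _ ≤ _ := by gcongr)
    (fun e t _ _ => mul_nonneg (inv_nonneg.2 hh.le) (Nat.cast_nonneg _))
    (fun e s t hs hst htτ => H.balance hN e hs hst htτ)
    (fun e t ht htτ => by
      have := H.exists_last_exit hN e (he1 e) ht htτ
      simpa only [neg_mul] using this)
    (fun e t ht _ hpos => H.own_eq_zero hN e ht hpos)
    (fun e => (H.sum_own_zero_le hN e).trans (by
      gcongr
      linarith))
  have hθ : c * (r / h * ν) * t = c * ν * (r / h) * t := by ring
  set θ := max (Γ' * ‖N.scaled r h (X 0)‖ - c * ν * (r / h) * t) 0 with hθdef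
  have hθ0 : 0 ≤ θ := le_max_right _ _
  have hcap := H.poolSum_last_lt hd hd0 (le_trans (by gcongr; linarith) hB) ht htτ
  have hchild : ∀ e e', e' ∈ N.children e → N.scaledOwn r h e' (X t) ≤
      Γ * (θ + (3 + 2 * C) * η) := by
    intro e e' he'
    have h1 := hg e t ht htτ
    rw [hθ] at h1
    exact (Finset.single_le_sum (f := fun e' => N.scaledOwn r h e' (X t))
      (fun e'' _ => mul_nonneg (inv_nonneg.2 hh.le) (Nat.cast_nonneg _)) he').trans h1
  have hfin : Γ * (θ + (3 + 2 * C) * η) + η ≤ Γ' * (θ + η) := by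
    have h1 : Γ * θ ≤ Γ * (3 + 2 * C) * θ := by
      have : Γ * (3 + 2 * C) * θ = Γ * θ + Γ * (2 + 2 * C) * θ := by ring
      have : 0 ≤ Γ * (2 + 2 * C) * θ := by positivity
      linarith
    have h2 : (Γ * (3 + 2 * C) + 1) * (θ + η) ≤ Γ' * (θ + η) := by gcongr; linarith
    linarith
  refine ⟨fun i => ?_, fun j hj => ?_⟩
  · obtain ⟨e, rfl, hcl⟩ := hN.exists_clsLast i
    have hq0 : 0 ≤ (N.scaled r h (X t)).queue e.cls := by
      rw [scaled_queue]; positivity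
    rw [abs_of_nonneg hq0]
    -- A class whose last activity ends in the last pool is nobody's child, but there idle servers
    -- exclude a queue. Any other class is a child of the last activity of its pool, so its queue is
    -- part of a gap.
    by_cases hp : e.pool = Fin.last n
    · have h1 : (X t).Q e.cls = 0 := by
        by_contra hne
        have := (hlegit t ht).work e (Nat.pos_of_ne_zero hne)
        rw [hp] at this
        omega
      rw [scaled_queue, h1, Nat.cast_zero, mul_zero]
      have : 0 ≤ Γ' := by linarith
      positivity
    · obtain ⟨e', he', hc'⟩ := hN.exists_poolLast e.pool hp
      have h1 := hchild e' e ((mem_children_pool hc').2 ⟨he'.symm, by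
        rintro rfl; exact hc' hcl⟩)
      rw [scaledOwn_cls hcl] at h1
      linarith
  · obtain ⟨e, rfl, hcl⟩ := hN.exists_poolLast j hj
    obtain ⟨e', he', hc'⟩ := hN.exists_clsLast e.cls
    have h1 := hchild e' e ((mem_children_cls hc').2 ⟨he'.symm, by
      rintro rfl; exact hcl hc'⟩)
    have h2 : 0 ≤ N.scaledOwn r h e (X t) := mul_nonneg (inv_nonneg.2 hh.le) (Nat.cast_nonneg _)
    rw [scaledOwn_pool hN hcl (hlegit t ht)] at h1 h2
    -- Rounding loses less than one server, which is below `η` on the scale `h`.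
    have h3 : h⁻¹ * (r * N.beta e.pool - N.capacity r e.pool) ≤ η := by
      refine le_trans ?_ H.card_le
      rw [mul_comm]
      gcongr
      have := lt_capacity_add_one (N := N) (r := r) e.pool
      linarith
    have h4 : 0 ≤ h⁻¹ * (r * N.beta e.pool - N.capacity r e.pool) :=
      mul_nonneg (inv_nonneg.2 hh.le) (sub_nonneg.2 (capacity_le hN hr _))
    rw [abs_le]
    have h5 : 0 ≤ Γ * (θ + (3 + 2 * C) * η) := by positivity
    constructor <;> linarith

end Network

/-! ### Comparison with local fluid models and tracking -/

/-- The transient has height at most `G` and lasts for a time `G / k`. With `k` of order `r / h` its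
accumulated effect is of order `h / r`. -/
theorem integral_max_sub_le {G k t : ℝ} (hG : 0 ≤ G) (hk : 0 < k) (ht : 0 ≤ t) :
    ∫ s in (0 : ℝ)..t, max (G - k * s) 0 ≤ G * (G / k) := by
  have hδ : 0 ≤ G / k := by positivity
  have hle : ∀ s, 0 ≤ s → ‖max (G - k * s) 0‖ ≤ G := by
    intro s hs
    rw [Real.norm_eq_abs, abs_of_nonneg (le_max_right _ _)]
    exact max_le (by nlinarith) hG
  have hint : ∀ a b : ℝ, IntervalIntegrable (fun s => max (G - k * s) 0)
      MeasureTheory.volume a b := fun a b => Continuous.intervalIntegrable (by fun_prop) _ _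
  have h1 : ∀ u, 0 ≤ u → u ≤ G / k → ∫ s in (0 : ℝ)..u, max (G - k * s) 0 ≤ G * (G / k) := by
    intro u hu huδ
    have := intervalIntegral.norm_integral_le_of_norm_le_const (a := 0) (b := u) (C := G)
      (f := fun s => max (G - k * s) 0) (fun s hs => by
        rw [Set.uIoc_of_le hu] at hs
        exact hle s hs.1.le)
    rw [sub_zero, abs_of_nonneg hu] at this
    exact (le_abs_self _).trans (this.trans (by gcongr))
  rcases le_total t (G / k) with h | h
  · exact h1 t ht h
  · rw [← intervalIntegral.integral_add_adjacent_intervals (hint 0 (G / k)) (hint (G / k) t)]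
    have h2 : ∫ s in (G / k)..t, max (G - k * s) 0 = ∫ s in (G / k)..t, (0 : ℝ) := by
      refine intervalIntegral.integral_congr fun s hs => ?_
      rw [Set.uIcc_of_le h] at hs
      refine max_eq_right ?_
      have := (div_le_iff₀ hk).1 hs.1
      linarith
    rw [h2, intervalIntegral.integral_zero, add_zero]
    exact h1 _ hδ le_rfl

namespace Network

variable {m n : ℕ} {N : Network m n}

theorem sum_classSum (x : N.Edge → ℝ) : ∑ i, N.classSum x i = ∑ e, x e :=
  Finset.sum_fiberwise _ _ _

theorem IsLocalFluidModel.continuousOn_act {f : ℝ → N.Vec} (hf : N.IsLocalFluidModel f)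
    (e : N.Edge) : ContinuousOn (fun t => (f t).act e) (Set.Ici 0) := by
  obtain ⟨c, hc⟩ := hf.lipschitz
  exact (PiLp.continuous_apply 2 _ (Sum.inl e)).comp_continuousOn hc.continuousOn

theorem IsLocalFluidModel.intervalIntegrable {f : ℝ → N.Vec} (hf : N.IsLocalFluidModel f)
    (e : N.Edge) {s t : ℝ} (hs : 0 ≤ s) (ht : 0 ≤ t) :
    IntervalIntegrable (fun u => (f u).act e) MeasureTheory.volume s t :=
  ((hf.continuousOn_act e).mono fun _ hu => (le_inf hs ht).trans hu.1).intervalIntegrable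

/-- The class totals of a controlled realization satisfy the fluid equation up to small errors. -/
theorem Controlled.classSum_sub_le {r h η B τ : ℝ} {X : ℝ → N.State}
    (H : N.Controlled r h X η B τ) (hN : N.Standing) {f : ℝ → N.Vec} (hf : N.IsLocalFluidModel f)
    (i : Fin (m + 1)) {t : ℝ} (ht : 0 ≤ t) (htτ : t ≤ τ) :
    |(N.classSum (N.scaled r h (X t)).act i + (N.scaled r h (X t)).queue i -
        N.classSum (f t).act i) -
      ((N.classSum (N.scaled r h (X 0)).act i + (N.scaled r h (X 0)).queue i -
        N.classSum (f 0).act i) - N.classSum (fun e => N.rate e * ∫ s in (0 : ℝ)..t,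
          ((N.scaled r h (X s)).act e - (f s).act e)) i)| ≤
      (1 + (Fintype.card N.Edge : ℝ)) * η := by
  have h1 := H.conservation i le_rfl ht
  rw [H.realization.init_A, H.realization.init_D] at h1
  simp only [Pi.zero_apply, Nat.cast_zero, sub_zero] at h1
  have h2 := hf.total t ht i
  have h3 : N.classSum (fun e => N.rate e * ∫ s in (0 : ℝ)..t,
      ((N.scaled r h (X s)).act e - (f s).act e)) i =
      N.classSum (fun e => N.rate e * ∫ s in (0 : ℝ)..t, (N.scaled r h (X s)).act e) i -
      N.classSum (fun e => ∫ s in (0 : ℝ)..t, N.rate e * (f s).act e) i := by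
    simp only [classSum]
    rw [← Finset.sum_sub_distrib]
    refine Finset.sum_congr rfl fun e _ => ?_
    rw [intervalIntegral.integral_sub (H.intervalIntegrable e le_rfl ht)
      (hf.intervalIntegrable e le_rfl ht), intervalIntegral.integral_const_mul, mul_sub]
  have h4 := H.arrivals i t ht htτ
  have h5 := abs_classSum_le (fun e => H.departures e t ht htτ) i
  rw [Finset.sum_const, Finset.card_univ, nsmul_eq_mul] at h5
  have h6 : N.classSum (fun e => h⁻¹ * (((X t).D e : ℝ) -
      N.rate e * ∫ s in (0 : ℝ)..t, ((X s).Psi e : ℝ))) i =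
      N.classSum (fun e => h⁻¹ * ((X t).D e : ℝ)) i - (r / h * N.lam i * t +
        N.classSum (fun e => N.rate e * ∫ s in (0 : ℝ)..t, (N.scaled r h (X s)).act e) i) := by
    simp only [mul_sub, H.integral_Psi hN _ le_rfl ht, sub_zero]
    rw [← hN.classSum_eqRate]
    simp only [classSum, Finset.sum_sub_distrib, Finset.sum_add_distrib, Finset.mul_sum,
      Finset.sum_mul]
  have h7 : h⁻¹ * (((X t).A i : ℝ) - N.lam i * r * t) =
      h⁻¹ * (X t).A i - r / h * N.lam i * t := by
    rw [div_eq_mul_inv]; ring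
  rw [h6] at h5
  rw [h7] at h4
  rw [h3]
  rw [abs_le] at h4 h5 ⊢
  constructor <;> linarith [h4.1, h4.2, h5.1, h5.2]

/-- Comparison of a controlled realization with a local fluid model. -/
theorem Standing.exists_comparison (hN : N.Standing) : ∃ Γ c : ℝ, 1 ≤ Γ ∧ 0 < c ∧
    ∀ T : ℝ, 0 < T → ∃ C : ℝ, 1 ≤ C ∧
    ∀ (r h η B τ : ℝ) (X : ℝ → N.State) (f : ℝ → N.Vec), N.Controlled r h X η B τ →
      Γ * B ≤ r / h → τ ≤ T → N.IsLocalFluidModel f → ∀ t, 0 ≤ t → t ≤ τ →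
        ‖N.scaled r h (X t) - f t‖ ≤ C *
          (∑ i, |N.classSum (N.scaled r h (X 0)).act i + (N.scaled r h (X 0)).queue i -
            N.classSum (f 0).act i| + η + ‖N.scaled r h (X 0)‖ ^ 2 * (h / r) +
            max (Γ * ‖N.scaled r h (X 0)‖ - c * (r / h) * t) 0) := by
  obtain ⟨Γ, c, hΓ, hc0, hdef⟩ := hN.exists_deficit_bound
  obtain ⟨CR, hCR, hrec⟩ := hN.exists_bound
  refine ⟨Γ, c, hΓ, hc0, fun T hT => ?_⟩
  obtain ⟨e0, -⟩ := hN.exists_root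
  set K : ℝ := (Fintype.card N.Edge : ℝ) with hK
  have hK0 : 0 ≤ K := Nat.cast_nonneg _
  set R : ℝ := ∑ e, N.rate e with hR
  have hR0 : 0 < R := Finset.sum_pos (fun e _ => hN.rate_pos e) ⟨e0, Finset.mem_univ _⟩
  set R' := R * CR with hR'
  have hR'0 : 0 < R' := by positivity
  set M := R' * ((1 + K + Γ) * T + Γ ^ 3 / c) with hM
  have hM0 : 0 ≤ M := by positivity
  set C₁ := 2 * (1 + M) * Real.exp (2 * R' * T) + (1 + K) + Γ with hC₁
  have hC₁1 : 1 ≤ C₁ := by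
    have : 0 ≤ 2 * (1 + M) * Real.exp (2 * R' * T) := by positivity
    linarith
  refine ⟨(K * CR + (m + 1)) * C₁, ?_, fun r h η B τ X f H hB hτ hf t ht htτ => ?_⟩
  · have h1 : 1 ≤ K * CR + (m + 1) := by
      have : 0 ≤ K * CR := by positivity
      have : (0 : ℝ) ≤ m := Nat.cast_nonneg _
      linarith
    exact one_le_mul_of_one_le_of_one_le h1 hC₁1
  have hh := H.h_pos
  have hr := H.r_pos
  have hη := H.eta_nonneg
  set G := ‖N.scaled r h (X 0)‖ with hG
  have hG0 : 0 ≤ G := norm_nonneg _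
  have hdef' := hdef r h η B τ X H hB
  set θ : ℝ → ℝ := fun t => max (Γ * G - c * (r / h) * t) 0 with hθ
  have hθ0 : ∀ t, 0 ≤ θ t := fun t => le_max_right _ _
  -- Grönwall is applied to the right side of the class equation rather than to the jumping class
  -- totals. It is continuous and differs from them by a multiple of `η`.
  set U : Fin (m + 1) → ℝ → ℝ := fun i t =>
    (N.classSum (N.scaled r h (X 0)).act i + (N.scaled r h (X 0)).queue i -
        N.classSum (f 0).act i) - N.classSum (fun e => N.rate e * ∫ s in (0 : ℝ)..t,
          ((N.scaled r h (X s)).act e - (f s).act e)) i with hU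
  set u : ℝ → ℝ := fun t => ∑ i, |U i t| with hu
  set u0 := ∑ i, |N.classSum (N.scaled r h (X 0)).act i + (N.scaled r h (X 0)).queue i -
            N.classSum (f 0).act i| with hu0
  have hu00 : 0 ≤ u0 := Finset.sum_nonneg fun _ _ => abs_nonneg _
  have hunn : ∀ t, 0 ≤ u t := fun t => Finset.sum_nonneg fun _ _ => abs_nonneg _
  have hint : ∀ e s t, 0 ≤ s → 0 ≤ t → IntervalIntegrable
      (fun s => (N.scaled r h (X s)).act e - (f s).act e) MeasureTheory.volume s t :=
    fun e s t hs ht => (H.intervalIntegrable e hs ht).sub (hf.intervalIntegrable e hs ht)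
  have hcont : ContinuousOn u (Set.Icc 0 τ) := by
    refine continuousOn_finsetSum _ fun i _ => ContinuousOn.abs (continuousOn_const.sub ?_)
    refine continuousOn_finsetSum _ fun e _ => continuousOn_const.mul ?_
    rcases lt_or_ge τ 0 with h0 | h0
    · rw [Set.Icc_eq_empty (not_le.2 h0)]; exact continuousOn_empty _
    · have h1 := intervalIntegral.continuousOn_primitive_interval
        (a := 0) (b := τ) (f := fun s => (N.scaled r h (X s)).act e - (f s).act e)
        (μ := MeasureTheory.volume) (by
          rw [Set.uIcc_of_le h0]
          exact (intervalIntegrable_iff_integrableOn_Icc_of_le h0).1 (hint e 0 τ le_rfl h0))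
      rwa [Set.uIcc_of_le h0] at h1
  -- Class totals differ by `u` plus fluctuations and queues, and pool totals are small; the inverse
  -- of the totals map passes this on to each activity.
  have hdiff : ∀ e t, 0 ≤ t → t ≤ τ → |(N.scaled r h (X t)).act e - (f t).act e| ≤
      CR * (u t + (1 + K) * η + Γ * (θ t + η)) := by
    intro e t ht htτ
    have hnn : 0 ≤ Γ * (θ t + η) := mul_nonneg (by linarith) (add_nonneg (hθ0 t) hη)
    have hnn2 : 0 ≤ (1 + K) * η := by positivity
    refine hrec (fun e => (N.scaled r h (X t)).act e - (f t).act e) _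
      (by linarith [hunn t]) (fun i => ?_) (fun j hj => ?_) e
    · have h1 := H.classSum_sub_le hN hf i ht htτ
      have h2 := (hdef' t ht htτ).1 i
      have h3 : |U i t| ≤ u t :=
        Finset.single_le_sum (f := fun i => |U i t|) (fun _ _ => abs_nonneg _) (Finset.mem_univ i)
      have h4 : N.classSum (fun e => (N.scaled r h (X t)).act e - (f t).act e) i =
          N.classSum (N.scaled r h (X t)).act i - N.classSum (f t).act i := by
        simp only [classSum, Finset.sum_sub_distrib]
      rw [h4]
      rw [abs_le] at h1 h2 h3 ⊢
      constructor <;> linarith [h1.1, h1.2, h2.1, h2.2, h3.1, h3.2]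
    · have h2 := (hdef' t ht htτ).2 j hj
      have h4 : N.poolSum (fun e => (N.scaled r h (X t)).act e - (f t).act e) j =
          N.poolSum (N.scaled r h (X t)).act j := by
        have := hf.pools t ht j hj
        simp only [poolSum, Finset.sum_sub_distrib] at this ⊢
        linarith
      rw [h4]
      linarith [hunn t]
  have hGr := le_of_le_add_integral (u := u) (T := τ) (C := R')
    (E := u0 + R' * ((1 + K + Γ) * η * T + Γ * (Γ * G * (Γ * G / (c * (r / h))))))
    (D := sSup (u '' Set.Icc 0 τ)) hR'0 (by positivity)
    (fun t ht htτ => (hcont.mono (by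
      rw [Set.uIcc_of_le ht]; exact Set.Icc_subset_Icc_right htτ)).intervalIntegrable)
    (fun t ht htτ => le_csSup (isCompact_Icc.image_of_continuousOn hcont).bddAbove
      ⟨t, ⟨ht, htτ⟩, rfl⟩)
    (by
      intro t ht htτ
      have hiu : IntervalIntegrable u MeasureTheory.volume 0 t := (hcont.mono (by
        rw [Set.uIcc_of_le ht]; exact Set.Icc_subset_Icc_right htτ)).intervalIntegrable
      have hiθ : IntervalIntegrable θ MeasureTheory.volume 0 t :=
        Continuous.intervalIntegrable (by fun_prop) _ _
      have hI : ∀ e, |∫ s in (0 : ℝ)..t, ((N.scaled r h (X s)).act e - (f s).act e)| ≤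
          CR * ((∫ s in (0 : ℝ)..t, u s) + (1 + K + Γ) * η * t + Γ * ∫ s in (0 : ℝ)..t, θ s) := by
        intro e
        have h1 : |∫ s in (0 : ℝ)..t, ((N.scaled r h (X s)).act e - (f s).act e)| ≤
            ∫ s in (0 : ℝ)..t, CR * (u s + (1 + K + Γ) * η + Γ * θ s) := by
          refine (intervalIntegral.abs_integral_le_integral_abs ht).trans
            (intervalIntegral.integral_mono_on ht (hint e 0 t le_rfl ht).abs
              (((hiu.add intervalIntegrable_const).add (hiθ.const_mul _)).const_mul _)
              fun s hs => ?_)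
          refine (hdiff e s hs.1 (hs.2.trans htτ)).trans (le_of_eq ?_)
          ring
        refine h1.trans (le_of_eq ?_)
        rw [intervalIntegral.integral_const_mul, intervalIntegral.integral_add
          (hiu.add intervalIntegrable_const) (hiθ.const_mul _), intervalIntegral.integral_add hiu
          intervalIntegrable_const, intervalIntegral.integral_const,
          intervalIntegral.integral_const_mul, smul_eq_mul]
        ring
      have hIθ : ∫ s in (0 : ℝ)..t, θ s ≤ Γ * G * (Γ * G / (c * (r / h))) :=
        integral_max_sub_le (by positivity) (by positivity) ht
      have h2 : u t ≤ u0 + ∑ e, N.rate e *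
          |∫ s in (0 : ℝ)..t, ((N.scaled r h (X s)).act e - (f s).act e)| := by
        rw [← sum_classSum, hu0, ← Finset.sum_add_distrib]
        refine Finset.sum_le_sum fun i _ => ?_
        refine (abs_sub _ _).trans (add_le_add le_rfl ?_)
        refine (Finset.abs_sum_le_sum_abs _ _).trans (le_of_eq ?_)
        exact Finset.sum_congr rfl fun e _ => by rw [abs_mul, abs_of_pos (hN.rate_pos e)]
      refine h2.trans ?_
      have h3 : ∑ e, N.rate e *
          |∫ s in (0 : ℝ)..t, ((N.scaled r h (X s)).act e - (f s).act e)| ≤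
          R * (CR * ((∫ s in (0 : ℝ)..t, u s) + (1 + K + Γ) * η * t +
            Γ * ∫ s in (0 : ℝ)..t, θ s)) := by
        rw [hR, Finset.sum_mul]
        exact Finset.sum_le_sum fun e _ => mul_le_mul_of_nonneg_left (hI e) (hN.rate_pos e).le
      have h4 : R * (CR * ((∫ s in (0 : ℝ)..t, u s) + (1 + K + Γ) * η * t +
            Γ * ∫ s in (0 : ℝ)..t, θ s)) ≤ R * (CR * ((∫ s in (0 : ℝ)..t, u s) +
            (1 + K + Γ) * η * T + Γ * (Γ * G * (Γ * G / (c * (r / h)))))) := by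
        gcongr
        exact htτ.trans hτ
      have h5 : R * (CR * ((∫ s in (0 : ℝ)..t, u s) +
            (1 + K + Γ) * η * T + Γ * (Γ * G * (Γ * G / (c * (r / h)))))) =
          R' * ((1 + K + Γ) * η * T + Γ * (Γ * G * (Γ * G / (c * (r / h))))) +
          R' * ∫ s in (0 : ℝ)..t, u s := by rw [hR']; ring
      linarith) t ht htτ
  have hGc : Γ * (Γ * G * (Γ * G / (c * (r / h)))) = Γ ^ 3 / c * (G ^ 2 * (h / r)) := by
    field_simp
  have hG2 : 0 ≤ G ^ 2 * (h / r) := by positivity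
  have hexp : Real.exp (2 * R' * t) ≤ Real.exp (2 * R' * T) := by
    gcongr
    exact htτ.trans hτ
  set Z := u0 + η + G ^ 2 * (h / r) + θ t with hZ
  have hZ0 : 0 ≤ Z := by linarith [hθ0 t]
  have hE : u0 + R' * ((1 + K + Γ) * η * T + Γ * (Γ * G * (Γ * G / (c * (r / h))))) ≤
      (1 + M) * Z := by
    rw [hGc]
    have h1 : R' * ((1 + K + Γ) * η * T + Γ ^ 3 / c * (G ^ 2 * (h / r))) ≤ M * Z := by
      have h2 : (1 + K + Γ) * η * T ≤ (1 + K + Γ) * T * Z := by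
        have : η ≤ Z := by linarith [hθ0 t]
        calc (1 + K + Γ) * η * T = (1 + K + Γ) * T * η := by ring
          _ ≤ _ := by gcongr
      have h3 : Γ ^ 3 / c * (G ^ 2 * (h / r)) ≤ Γ ^ 3 / c * Z := by
        gcongr
        linarith [hθ0 t]
      calc R' * ((1 + K + Γ) * η * T + Γ ^ 3 / c * (G ^ 2 * (h / r)))
          ≤ R' * ((1 + K + Γ) * T * Z + Γ ^ 3 / c * Z) := by gcongr
        _ = _ := by rw [hM]; ring
    linarith [hθ0 t]
  have hut : u t ≤ 2 * (1 + M) * Real.exp (2 * R' * T) * Z := by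
    calc u t ≤ _ := hGr
      _ ≤ 2 * ((1 + M) * Z) * Real.exp (2 * R' * T) := by gcongr
      _ = _ := by ring
  have hηθ : Γ * (θ t + η) ≤ Γ * Z := by gcongr; linarith
  have hηK : (1 + K) * η ≤ (1 + K) * Z := by gcongr; linarith [hθ0 t]
  have hδ : u t + (1 + K) * η + Γ * (θ t + η) ≤ C₁ * Z := by
    rw [hC₁, add_mul, add_mul]
    linarith
  have hCnn : 0 ≤ 2 * (1 + M) * Real.exp (2 * R' * T) * Z := by positivity
  have hKZ : 0 ≤ (1 + K) * Z := by positivity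
  calc ‖N.scaled r h (X t) - f t‖
      ≤ ∑ e, |(N.scaled r h (X t) - f t).act e| +
        ∑ i, |(N.scaled r h (X t) - f t).queue i| := norm_le_sum _
    _ ≤ ∑ _e : N.Edge, CR * (C₁ * Z) + ∑ _i : Fin (m + 1), C₁ * Z := by
        refine add_le_add (Finset.sum_le_sum fun e _ => ?_) (Finset.sum_le_sum fun i _ => ?_)
        · exact (hdiff e t ht htτ).trans (by gcongr)
        · have h1 : (N.scaled r h (X t) - f t).queue i = (N.scaled r h (X t)).queue i := by
            have h2 := hf.queue t ht i
            have h3 : (N.scaled r h (X t) - f t).queue i =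
                (N.scaled r h (X t)).queue i - (f t).queue i := rfl
            rw [h3, h2, sub_zero]
          rw [h1]
          refine ((hdef' t ht htτ).1 i).trans (hηθ.trans ?_)
          rw [hC₁, add_mul, add_mul]
          linarith
    _ = (K * CR + (m + 1)) * C₁ * Z := by
        rw [Finset.sum_const, Finset.sum_const, Finset.card_univ, Finset.card_univ,
          Fintype.card_fin, nsmul_eq_mul, nsmul_eq_mul]
        push_cast
        ring

theorem Step.abs_Psi_sub_le {cap : Fin (n + 1) → ℕ} {x y : N.State} (h : N.Step cap x y)
    (e : N.Edge) : |(y.Psi e : ℝ) - x.Psi e| ≤ 1 := by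
  have hs : ∀ e', Pi.single (M := fun _ : N.Edge => ℕ) e' 1 e ≤ 1 := fun e' => by
    rw [Pi.single_apply]; split_ifs <;> omega
  have key : y.Psi e ≤ x.Psi e + 1 ∧ x.Psi e ≤ y.Psi e + 1 := by
    rcases h with ⟨e0, idle, best⟩ | ⟨i', full⟩ | ⟨e0, e', busy, same, waiting, best⟩ |
      ⟨e0, busy, empty⟩
    · have := hs e0
      simp only [Pi.add_apply]
      omega
    · simp
    · have := hs e0
      have := hs e'
      simp only [Pi.add_apply, Pi.sub_apply]
      omega
    · have := hs e0
      simp only [Pi.sub_apply]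
      omega
  have h1 : (y.Psi e : ℝ) ≤ x.Psi e + 1 := by exact_mod_cast key.1
  have h2 : (x.Psi e : ℝ) ≤ y.Psi e + 1 := by exact_mod_cast key.2
  rw [abs_le]
  constructor <;> linarith

/-- Comparison with this model gives the a priori bound of a path by its initial state. -/
theorem isLocalFluidModel_zero (N : Network m n) : N.IsLocalFluidModel fun _ => 0 where
  lipschitz := ⟨0, (LipschitzWith.const 0).lipschitzOnWith⟩
  queue _ _ _ := rfl
  total _ _ _ := by simp [Vec.act, classSum]
  pools _ _ _ _ := by simp [Vec.act, poolSum]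

/-- A realization with small fluctuations stays bounded by its initial state and follows the local
fluid models. -/
theorem Standing.exists_tracking (hN : N.Standing) : ∃ Γ c : ℝ, 1 ≤ Γ ∧ 0 < c ∧
    ∀ T : ℝ, 0 < T → ∃ C : ℝ, 1 ≤ C ∧
    ∀ (r h η : ℝ) (X : ℝ → N.State), N.IsRealization r X → 0 < r → 1 ≤ h → 0 ≤ η → η ≤ 1 →
      (Fintype.card N.Edge : ℝ) * h⁻¹ ≤ η →
      (∀ i t, 0 ≤ t → t ≤ T → |h⁻¹ * (((X t).A i : ℝ) - N.lam i * r * t)| ≤ η) →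
      (∀ e t, 0 ≤ t → t ≤ T →
        |h⁻¹ * (((X t).D e : ℝ) - N.rate e * ∫ s in (0 : ℝ)..t, ((X s).Psi e : ℝ))| ≤ η) →
      Γ * (C * (‖N.scaled r h (X 0)‖ + 1) + 1) ≤ r / h → ∀ t, 0 ≤ t → t ≤ T →
      ‖N.scaled r h (X t)‖ ≤ C * (‖N.scaled r h (X 0)‖ + η) ∧
      ∀ f : ℝ → N.Vec, N.IsLocalFluidModel f → ‖N.scaled r h (X t) - f t‖ ≤ C *
          (∑ i, |N.classSum (N.scaled r h (X 0)).act i + (N.scaled r h (X 0)).queue i -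
            N.classSum (f 0).act i| + η + ‖N.scaled r h (X 0)‖ ^ 2 * (h / r) +
            max (Γ * ‖N.scaled r h (X 0)‖ - c * (r / h) * t) 0) := by
  obtain ⟨Γ, c, hΓ, hc0, hcomp⟩ := hN.exists_comparison
  refine ⟨Γ, c, hΓ, hc0, fun T hT => ?_⟩
  obtain ⟨C', hC', hcomp⟩ := hcomp T hT
  set K : ℝ := (Fintype.card N.Edge : ℝ) with hK
  have hK0 : 0 ≤ K := Nat.cast_nonneg _
  have hq : 0 ≤ (m + 1) * (K + 1) + 1 + Γ := by positivity
  -- With the zero model, the initial class totals contribute `(m + 1) * (K + 1) * G`, the quadratic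
  -- term at most `G`, and the transient at most `Γ * G`.
  set C := C' * ((m + 1) * (K + 1) + 2 + Γ) with hC
  have hC'C : C' ≤ C := le_mul_of_one_le_right (by linarith) (by linarith)
  have hC1 : 1 ≤ C := hC'.trans hC'C
  refine ⟨C, hC1, fun r h η X hX hr hh hη hη1 hcard hA hD hB => ?_⟩
  have hh0 : 0 < h := one_pos.trans_le hh
  set G := ‖N.scaled r h (X 0)‖ with hG
  have hG0 : 0 ≤ G := norm_nonneg _
  -- The extra 1 leaves room for one event, which moves a scaled occupancy by at most `1 / h ≤ 1`.
  set B := C * (G + 1) + 1 with hBdef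
  have hB1 : 1 ≤ B := by
    have : 0 ≤ C * (G + 1) := by positivity
    linarith
  have hctrl : ∀ τ, τ ≤ T → (∀ e t, 0 ≤ t → t ≤ τ → |(N.scaled r h (X t)).act e| ≤ B) →
      N.Controlled r h X η B τ := fun τ hτ hb =>
    ⟨hX, hr, hh, hη, hcard, hB1, fun i t ht htτ => hA i t ht (htτ.trans hτ),
      fun e t ht htτ => hD e t ht (htτ.trans hτ), hb⟩
  have hGrh : G * (h / r) ≤ 1 := by
    have h1 : G ≤ r / h := by
      have h2 : G ≤ B := by nlinarith
      have h3 : B ≤ Γ * B := le_mul_of_one_le_left (by linarith) hΓ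
      linarith
    rw [le_div_iff₀ hh0] at h1
    rwa [← mul_div_assoc, div_le_one hr]
  have hzero : ∀ τ, τ ≤ T → N.Controlled r h X η B τ → ∀ t, 0 ≤ t → t ≤ τ →
      ‖N.scaled r h (X t)‖ ≤ C * (G + η) := by
    intro τ hτ H t ht htτ
    have h1 := hcomp r h η B τ X (fun _ => 0) H hB hτ N.isLocalFluidModel_zero t ht htτ
    rw [sub_zero] at h1
    have h2 : ∑ i, |N.classSum (N.scaled r h (X 0)).act i + (N.scaled r h (X 0)).queue i -
        N.classSum (Vec.act (0 : N.Vec)) i| ≤ (m + 1) * (K + 1) * G := by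
      have h3 : ∀ i ∈ Finset.univ, |N.classSum (N.scaled r h (X 0)).act i +
          (N.scaled r h (X 0)).queue i - N.classSum (Vec.act (0 : N.Vec)) i| ≤ (K + 1) * G := by
        intro i _
        have h4 : N.classSum (Vec.act (0 : N.Vec)) i = 0 := by simp [classSum, Vec.act]
        have h5 := abs_classSum_le (abs_act_le (N.scaled r h (X 0))) i
        rw [Finset.sum_const, Finset.card_univ, nsmul_eq_mul] at h5
        rw [h4, sub_zero]
        refine (abs_add_le _ _).trans ?_
        have h6 := abs_queue_le (N.scaled r h (X 0)) i
        linarith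
      refine (Finset.sum_le_card_nsmul _ _ _ h3).trans (le_of_eq ?_)
      rw [Finset.card_univ, Fintype.card_fin, nsmul_eq_mul]
      push_cast
      ring
    have h3 : G ^ 2 * (h / r) ≤ G := by
      calc G ^ 2 * (h / r) = G * (G * (h / r)) := by ring
        _ ≤ G * 1 := by gcongr
        _ = G := mul_one G
    have h4 : max (Γ * G - c * (r / h) * t) 0 ≤ Γ * G := by
      refine max_le ?_ (by positivity)
      have : 0 ≤ c * (r / h) * t := by positivity
      linarith
    refine h1.trans ?_
    have hC'0 : 0 ≤ C' := by linarith
    rw [hC, mul_assoc C']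
    have h5 : 0 ≤ ((m + 1) * (K + 1) + 1 + Γ) * η := by positivity
    refine mul_le_mul_of_nonneg_left ?_ hC'0
    linarith
  have hall : ∀ t, 0 ≤ t → t ≤ T → ‖N.scaled r h (X t)‖ ≤ C * (G + η) := by
    refine real_induction_Ici (P := fun t => t ≤ T → ‖N.scaled r h (X t)‖ ≤ C * (G + η))
      (fun _ => ?_) (fun t ht hlt htT => ?_) (fun t ht hle => ?_)
    · rw [← hG]
      nlinarith
    · have hb0 : C * (G + η) ≤ B - 1 := by
        rw [hBdef, add_sub_cancel_right]
        gcongr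
      obtain ⟨x, hx, hxt⟩ := hX.left_step t ht
      have h1 : ∀ᶠ s in 𝓝[<] t, s ∈ Set.Ioo 0 t := Ioo_mem_nhdsLT ht
      obtain ⟨s, hs, hs0, hst⟩ := (hx.and h1).exists
      have hxb : ‖N.scaled r h x‖ ≤ C * (G + η) := hs ▸ hlt s hs0.le hst (hst.le.trans htT)
      -- Continuation: the bound before `t` plus one jump stays below `B` up to and including `t`,
      -- and the comparison on `[0, t]` then restores the sharper bound at `t`.
      refine hzero t htT (hctrl t htT fun e u hu hut => ?_) t ht.le le_rfl
      rcases hut.lt_or_eq with h2 | rfl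
      · exact (abs_act_le _ e).trans ((hlt u hu h2 (hut.trans htT)).trans (by linarith))
      · have h3 := (abs_act_le (N.scaled r h x) e).trans hxb
        have h4 : |(X u).Psi e - (x.Psi e : ℝ)| ≤ 1 := by
          rcases hxt with h5 | h5
          · rw [h5]; simp
          · exact h5.abs_Psi_sub_le e
        have h5 : (N.scaled r h (X u)).act e =
            (N.scaled r h x).act e + h⁻¹ * ((X u).Psi e - (x.Psi e : ℝ)) := by
          rw [scaled_act, scaled_act]; ring
        have h6 : |h⁻¹ * ((X u).Psi e - (x.Psi e : ℝ))| ≤ 1 := by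
          rw [abs_mul, abs_of_pos (inv_pos.2 hh0)]
          exact mul_le_one₀ (inv_le_one_of_one_le₀ hh) (abs_nonneg _) h4
        rw [h5]
        refine (abs_add_le _ _).trans ?_
        linarith
    · filter_upwards [hX.right_const t ht, self_mem_nhdsWithin] with s hs hts hsT
      rw [hs]
      exact hle t ht le_rfl ((le_of_lt hts).trans hsT)
  intro t ht htT
  refine ⟨hall t ht htT, fun f hf => ?_⟩
  have H := hctrl T le_rfl fun e t ht htT => (abs_act_le _ e).trans ((hall t ht htT).trans (by
    have : C * (G + η) ≤ C * (G + 1) := by gcongr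
    linarith))
  have h0 : 0 ≤ ∑ i, |N.classSum (N.scaled r h (X 0)).act i + (N.scaled r h (X 0)).queue i -
            N.classSum (f 0).act i| := Finset.sum_nonneg fun _ _ => abs_nonneg _
  have h1 : 0 ≤ G ^ 2 * (h / r) := by positivity
  refine (hcomp r h η B T X f H hB le_rfl hf t ht htT).trans ?_
  gcongr

/-! ### Passage to the limit -/

namespace IsLocalFluidSequence

variable {ε : ℝ} {r h : ℕ → ℝ} {X : ℕ → ℝ → N.State} {f0 : N.Vec}

theorem h_pos (H : N.IsLocalFluidSequence ε r h X f0) (k : ℕ) : 0 < h k :=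
  (Real.rpow_pos_of_pos (H.r_pos k) _).trans_le (H.h_ge k)

theorem h_tendsto (H : N.IsLocalFluidSequence ε r h X f0) : Tendsto h atTop atTop :=
  tendsto_atTop_mono H.h_ge ((tendsto_rpow_atTop (by linarith [H.eps_pos])).comp H.r_tendsto)

theorem ratio_tendsto (H : N.IsLocalFluidSequence ε r h X f0) :
    Tendsto (fun k => r k / h k) atTop atTop := by
  have h1 : Tendsto (fun k => h k / r k) atTop (𝓝[>] 0) :=
    tendsto_nhdsWithin_iff.2 ⟨H.h_small, Eventually.of_forall fun k =>
      div_pos (H.h_pos k) (H.r_pos k)⟩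
  exact (tendsto_inv_nhdsGT_zero.comp h1).congr fun k => inv_div _ _

theorem eventually_small (H : N.IsLocalFluidSequence ε r h X f0) (T : ℝ) {η : ℝ} (hη : 0 < η) :
    ∀ᶠ k in atTop, 1 ≤ h k ∧ (Fintype.card N.Edge : ℝ) * (h k)⁻¹ ≤ η ∧
      (∀ i t, 0 ≤ t → t ≤ T → |(h k)⁻¹ * (((X k t).A i : ℝ) - N.lam i * r k * t)| ≤ η) ∧
      (∀ e t, 0 ≤ t → t ≤ T → |(h k)⁻¹ * (((X k t).D e : ℝ) -
        N.rate e * ∫ s in (0 : ℝ)..t, ((X k s).Psi e : ℝ))| ≤ η) := by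
  have h1 : Tendsto (fun k => (Fintype.card N.Edge : ℝ) * (h k)⁻¹) atTop (𝓝 0) := by
    simpa using (tendsto_inv_atTop_zero.comp H.h_tendsto).const_mul (Fintype.card N.Edge : ℝ)
  have h2 : ∀ᶠ k in atTop, ∀ i t, 0 ≤ t → t ≤ T →
      |(h k)⁻¹ * (((X k t).A i : ℝ) - N.lam i * r k * t)| ≤ η := by
    refine eventually_all.2 fun i => ?_
    filter_upwards [Metric.tendstoUniformlyOn_iff.1 (H.arrivals i T) η hη] with k hk t ht htT
    have := hk t ⟨ht, htT⟩
    rw [Real.dist_eq, zero_sub, abs_neg] at this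
    exact this.le
  have h3 : ∀ᶠ k in atTop, ∀ e t, 0 ≤ t → t ≤ T → |(h k)⁻¹ * (((X k t).D e : ℝ) -
        N.rate e * ∫ s in (0 : ℝ)..t, ((X k s).Psi e : ℝ))| ≤ η := by
    refine eventually_all.2 fun e => ?_
    filter_upwards [Metric.tendstoUniformlyOn_iff.1 (H.departures e T) η hη] with k hk t ht htT
    have := hk t ⟨ht, htT⟩
    rw [Real.dist_eq, zero_sub, abs_neg] at this
    exact this.le
  filter_upwards [H.h_tendsto.eventually_ge_atTop 1, h1.eventually_le_const hη, h2, h3]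
    with k a b c d using ⟨a, b, c, d⟩

end IsLocalFluidSequence

/-- The tracking estimate on `[0, 1]` holds with a constant independent of `K`; here `K` only
affects how far along the sequence one has to go. -/
theorem Standing.exists_limsup_bound (hN : N.Standing) (K : ℝ) (hK : 0 < K) : ∃ C : ℝ, 0 < C ∧
    ∀ (ε : ℝ) (r h : ℕ → ℝ) (X : ℕ → ℝ → N.State) (f0 : N.Vec),
      N.IsLocalFluidSequence ε r h X f0 → ‖f0‖ ≤ K →
      limsup (fun k => ⨆ t ∈ Set.Icc (0 : ℝ) 1, ‖N.scaled (r k) (h k) (X k t)‖ₑ) atTop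
        ≤ ENNReal.ofReal (C * K) := by
  obtain ⟨Γ, c, hΓ, hc0, htr⟩ := hN.exists_tracking
  obtain ⟨C, hC, htr⟩ := htr 1 one_pos
  refine ⟨C * 3, by positivity, fun ε r h X f0 H hf0 => ?_⟩
  refine limsup_le_of_le (h := ?_)
  -- Fluctuations are taken below `K`, and the initial norms are eventually below `2 * K`. This is
  -- the origin of the factor 3.
  have hη : 0 < min 1 K := lt_min one_pos hK
  have h1 : ∀ᶠ k in atTop, ‖N.scaled (r k) (h k) (X k 0)‖ < 2 * K :=
    H.initial.norm.eventually_lt_const (by linarith)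
  filter_upwards [h1, H.eventually_small 1 hη,
    H.ratio_tendsto.eventually_ge_atTop (Γ * (C * (2 * K + 1) + 1))] with k hk hs hr
  refine iSup₂_le fun t ht => ?_
  have h2 := (htr (r k) (h k) (min 1 K) (X k) (H.realization k) (H.r_pos k) hs.1 hη.le
    (min_le_left _ _) hs.2.1 hs.2.2.1 hs.2.2.2 (le_trans (by gcongr) hr) t ht.1 ht.2).1
  rw [← ofReal_norm]
  refine ENNReal.ofReal_le_ofReal (h2.trans ?_)
  have h3 := min_le_right 1 K
  calc C * (‖N.scaled (r k) (h k) (X k 0)‖ + min 1 K) ≤ C * (2 * K + K) := by gcongr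
    _ = _ := by ring

/-- Away from time zero, the scaled realizations converge to the local fluid model which starts in
the relaxed initial state. -/
theorem Standing.tendstoUniformlyOn (hN : N.Standing) {ε : ℝ} {r h : ℕ → ℝ}
    {X : ℕ → ℝ → N.State} {f0 : N.Vec} (H : N.IsLocalFluidSequence ε r h X f0) {f : ℝ → N.Vec}
    (hf : N.IsLocalFluidModel f) (hf0 : f 0 = hN.relax f0) {S : Set ℝ} (hS : IsCompact S)
    (hS0 : S ⊆ Set.Ioi 0) :
    TendstoUniformlyOn (fun k t => N.scaled (r k) (h k) (X k t)) f atTop S := by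
  rcases S.eq_empty_or_nonempty with rfl | hne
  · exact tendstoUniformlyOn_empty
  obtain ⟨δ, hδ, hδle⟩ := hS.exists_isLeast hne
  obtain ⟨T, hT, hTle⟩ := hS.exists_isGreatest hne
  have hδ0 : 0 < δ := hS0 hδ
  have hT0 : 0 < T := hS0 hT
  obtain ⟨Γ, c, hΓ, hc0, htr⟩ := hN.exists_tracking
  obtain ⟨C, hC, htr⟩ := htr T hT0
  rw [Metric.tendstoUniformlyOn_iff]
  intro η0 hη0
  -- Three error terms remain after the transient, each at most `η0 / 4` once multiplied by `C`.
  set η := min 1 (η0 / (4 * C)) with hηdef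
  have hη : 0 < η := by positivity
  have h1 : ∀ᶠ k in atTop, ‖N.scaled (r k) (h k) (X k 0)‖ < ‖f0‖ + 1 :=
    H.initial.norm.eventually_lt_const (by linarith)
  have h2 : Tendsto (fun k => ∑ i, |N.classSum (N.scaled (r k) (h k) (X k 0)).act i +
      (N.scaled (r k) (h k) (X k 0)).queue i - N.classSum (f 0).act i|) atTop (𝓝 0) := by
    have hcont : Continuous fun v : N.Vec => ∑ i, |N.classSum v.act i + v.queue i -
        N.classSum (f 0).act i| := by
      unfold classSum Vec.act Vec.queue
      fun_prop
    have h3 : ∑ i, |N.classSum f0.act i + f0.queue i - N.classSum (f 0).act i| = 0 := by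
      refine Finset.sum_eq_zero fun i _ => ?_
      rw [hf0, (hN.isRelaxation_relax f0).total i, sub_self, abs_zero]
    have h4 := (hcont.tendsto f0).comp H.initial
    rwa [h3] at h4
  have h3 : Tendsto (fun k => ‖N.scaled (r k) (h k) (X k 0)‖ ^ 2 * (h k / r k)) atTop (𝓝 0) := by
    simpa using (H.initial.norm.pow 2).mul H.h_small
  filter_upwards [h1, h2.eventually_lt_const hη, h3.eventually_lt_const hη,
    H.eventually_small T hη,
    H.ratio_tendsto.eventually_ge_atTop (Γ * (C * ((‖f0‖ + 1) + 1) + 1)),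
    H.ratio_tendsto.eventually_ge_atTop (Γ * (‖f0‖ + 1) / (c * δ))] with k a1 a2 a3 a4 a5 a6 t ht
  have htδ : δ ≤ t := hδle ht
  have htT : t ≤ T := hTle ht
  have h4 := (htr (r k) (h k) η (X k) (H.realization k) (H.r_pos k) a4.1 hη.le
    (min_le_left _ _) a4.2.1 a4.2.2.1 a4.2.2.2 (le_trans (by gcongr) a5) t
    (hδ0.le.trans htδ) htT).2 f hf
  -- The compact set starts at `δ > 0`, and the transient is over before `δ` once `r / h` is large.
  have h5 : max (Γ * ‖N.scaled (r k) (h k) (X k 0)‖ - c * (r k / h k) * t) 0 = 0 := by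
    refine max_eq_right ?_
    rw [div_le_iff₀ (by positivity)] at a6
    have h6 : Γ * ‖N.scaled (r k) (h k) (X k 0)‖ ≤ Γ * (‖f0‖ + 1) := by gcongr
    have h7 : c * (r k / h k) * δ ≤ c * (r k / h k) * t := by
      have := div_pos (H.r_pos k) (H.h_pos k)
      gcongr
    linarith
  rw [h5, add_zero] at h4
  rw [dist_comm, dist_eq_norm]
  have h6 : C * η ≤ η0 / 4 := by
    calc C * η ≤ C * (η0 / (4 * C)) := by gcongr; exact min_le_right _ _
      _ = η0 / 4 := by field_simp
  have h7 : 0 < C := by linarith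
  refine h4.trans_lt ?_
  have h8 := mul_lt_mul_of_pos_left a2 h7
  have h9 := mul_lt_mul_of_pos_left a3 h7
  linarith

end Network

theorem theorem6 {m n : ℕ} (N : Network m n) (hN : N.Standing) :
    ∃ L : N.Vec →ₗ[ℝ] N.Vec,
      (∀ v c : N.Vec, N.IsRelaxation v c ↔ c = L v) ∧
      (∀ (ε : ℝ) (r h : ℕ → ℝ) (X : ℕ → ℝ → N.State) (f0 : N.Vec),
        N.IsLocalFluidSequence ε r h X f0 →
        ∀ φ : ℕ → ℕ, StrictMono φ →
        ∃ θ : ℕ → ℕ, StrictMono θ ∧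
        ∃ f : ℝ → N.Vec, N.IsLocalFluidModel f ∧ f 0 = L f0 ∧
          ∀ S : Set ℝ, IsCompact S → S ⊆ Set.Ioi 0 →
            TendstoUniformlyOn
              (fun k t => N.scaled (r (φ (θ k))) (h (φ (θ k))) (X (φ (θ k)) t)) f atTop S) ∧
      (∃ c₁ c₂ : ℝ, 0 < c₁ ∧ 0 < c₂ ∧ ∀ f : ℝ → N.Vec, N.IsLocalFluidModel f →
        ∀ t : ℝ, 0 ≤ t → ‖f t‖ ≤ ‖f 0‖ * c₁ * Real.exp (-c₂ * t)) ∧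
      (∀ K : ℝ, 0 < K → ∃ C : ℝ, 0 < C ∧
        ∀ (ε : ℝ) (r h : ℕ → ℝ) (X : ℕ → ℝ → N.State) (f0 : N.Vec),
          N.IsLocalFluidSequence ε r h X f0 → ‖f0‖ ≤ K →
          limsup (fun k => ⨆ t ∈ Set.Icc (0 : ℝ) 1, ‖N.scaled (r k) (h k) (X k t)‖ₑ) atTop
            ≤ ENNReal.ofReal (C * K)) := by
  refine ⟨hN.relax, hN.isRelaxation_iff, fun ε r h X f0 H φ hφ => ?_, ?_, hN.exists_limsup_bound⟩
  · obtain ⟨f, hf, hf0⟩ := hN.exists_localFluidModel f0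
    -- The limit is built in advance and the whole sequence converges to it, so no further
    -- extraction is needed.
    refine ⟨id, strictMono_id, f, hf, hf0, fun S hS hS0 => ?_⟩
    have := hN.tendstoUniformlyOn H hf hf0 hS hS0
    exact fun u hu => hφ.tendsto_atTop.eventually (this u hu)
  · obtain ⟨c₁, c₂, h₁, h₂, hd⟩ := hN.exists_decay
    refine ⟨c₁, c₂, h₁, h₂, fun f hf => hd f ?_ hf.queue hf.total hf.pools⟩
    obtain ⟨c, hc⟩ := hf.lipschitz
    exact hc.continuousOn
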